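/- Identify $\mathbb R^7$ with the imaginary octonions $\operatorname{Im}\mathbb O$ (with its standard inner product) and let $v\times w=\operatorname{Im}(v\cdot w)$ be the octonionic vector product, extended complex-bilinearly to $\mathbb C^7$. Let $S^6\subset\mathbb R^7$ be the unit sphere with the almost complex structure $J_x v=x\times v$ $(x\in S^6,\ v\in T_xS^6=x^\perp)$. Let $M$ be a Riemann surface (a connected one-dimensional complex manifold) and let $F:M\to S^6$ be a non-constant almost complex map, i.e. a smooth map whose differential intertwines the complex structure of $M$ with $J$. Let $f=\operatorname{span}_{\mathbb C}\{F\}$, a line subbundle of the trivial bundle $\underline{\mathbb C}^7=M\times\mathbb C^7$. For mutually orthogonal (with respect to the Hermitian inner product) smooth subbundles $\varphi,\psi$ of $\underline{\mathbb C}^7$, let $A'_{\varphi,\psi}:\varphi\to\psi$ and $A''_{\varphi,\psi}:\varphi\to\psi$ be the second fundamental forms $v\mapsto\pi_\psi(\partial_z v)$ and $v\mapsto\pi_\psi(\partial_{\bar z}v)$ for sections $v$ of $\varphi$, where $z$ is a local complex coordinate and $\pi_\psi$ is orthogonal projection onto $\psi$. Let $G'(\varphi)$ and $G''(\varphi)$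 be the images of $A'_{\varphi,\varphi^\perp}$ and $A''_{\varphi,\varphi^\perp}$, extended to subbundles over the isolated points where the rank drops ("filling out zeros"). Set $G^{(0)}(f)=f$ and, for $i\ge1$, $G^{(i)}(f)=G'(G^{(i-1)}(f))$ and $G^{(-i)}(f)=G''(G^{(-i+1)}(f))$. Then exactly one of the following holds: (i) $F$ is weakly conformal with image in a totally geodesic $S^2=\Pi^3\cap S^6$, where $\Pi^3\subset\mathbb R^7$ is an associative $3$-dimensional subspace, i.e. the imaginary part of a subalgebra of $\mathbb O$ isomorphic to the quaternions; (ii) there is a smooth map $\psi=(\psi_{-3},\psi_{-2},\psi_{-1},\psi_0,\psi_1,\psi_2,\psi_3)$ from $M$ to the space $G_2/(\mathrm U(1)\times\mathrm U(1))$ of $G_2$-flags with one-dimensional legs (that is, the $\psi_i$ are smooth, mutually orthogonal line subbundles with sum $\underline{\mathbb C}^7$, $\psi_{-i}=\overline{\psi_i}$, and $\psi_i\times\psi_j\subset\psi_{i+j}$ for all $i,j\in\mathbb Z$, where $\psi_i=0$ for $|i|>3$), such that $\psi_i=G^{(i)}(f)$ for $|i|\le2$, and, for $i\neq j$ in $\{-3,\dots,3\}$,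 the second fundamental form $A'_{\psi_i,\psi_j}$ vanishes identically unless $i\to j$ is an arrow of the diagram $$-3\to-2\to-1\to0\to1\to2\to3,\qquad 2\to-3,\qquad 3\to-2 .$$ -/

import Mathlib

open scoped Manifold ContDiff Topology Quaternion InnerProductSpace

noncomputable section

namespace AlmostComplexS6

/-! ### Octonions and the vector product -/

/-- The octonions `𝕆 = ℍ ⊕ ℍ·e` over `R`, as pairs `(a, b) = a + b·e` of quaternions. For `R = ℝ`
these are the Cayley numbers, for `R = ℂ` they are the complexification `𝕆 ⊗ ℂ`. -/
abbrev Oct (R : Type*) [CommRing R] : Type _ := ℍ[R] × ℍ[R]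

/-- Octonion multiplication `(a + b·e)(c + d·e) = (a c - d̄ b) + (d a + b c̄)·e`. Here `star` is
quaternionic conjugation, which is linear over `R`. -/
def octMul {R : Type*} [CommRing R] (x y : Oct R) : Oct R :=
  (x.1 * y.1 - star y.2 * x.2, y.2 * x.1 + x.2 * star y.1)

/-- `ℝ⁷`, identified with the imaginary octonions. -/
abbrev R7 : Type := EuclideanSpace ℝ (Fin 7)

/-- `ℂ⁷`, identified with the complexified imaginary octonions. Its inner product is the standard
Hermitian one. -/
abbrev C7 : Type := EuclideanSpace ℂ (Fin 7)

/-- The identification of coordinate vectors with imaginary octonions, given by the orthonormal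
basis `i, j, k, e, i·e, j·e, k·e`. -/
def toOct {R : Type*} [CommRing R] (v : EuclideanSpace R (Fin 7)) : Oct R :=
  (⟨0, v 0, v 1, v 2⟩, ⟨v 3, v 4, v 5, v 6⟩)

/-- The imaginary part of an octonion, in the same coordinates. -/
def octIm {R : Type*} [CommRing R] (x : Oct R) : EuclideanSpace R (Fin 7) :=
  WithLp.toLp 2 ![x.1.imI, x.1.imJ, x.1.imK, x.2.re, x.2.imI, x.2.imJ, x.2.imK]

/-- The vector product `v × w = Im (v · w)` on `Im 𝕆 = ℝ⁷`, and its complex bilinear extension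
to `ℂ⁷`. -/
def cross {R : Type*} [CommRing R] (v w : EuclideanSpace R (Fin 7)) : EuclideanSpace R (Fin 7) :=
  octIm (octMul (toOct v) (toOct w))

/-- A subspace of `Im 𝕆` is associative if it is the imaginary part of a subalgebra of `𝕆`
isomorphic to the quaternions (so it has dimension `3`). -/
def IsAssociative (P : Submodule ℝ R7) : Prop :=
  ∃ j : ℍ[ℝ] →ₗ[ℝ] Oct ℝ, Function.Injective j ∧ j 1 = (1, 0) ∧
    (∀ a b, j (a * b) = octMul (j a) (j b)) ∧
    ∀ v : R7, v ∈ P ↔ toOct v ∈ LinearMap.range j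

/-- The inclusion of `ℝ⁷` in `ℂ⁷`. -/
def complexify (v : R7) : C7 := WithLp.toLp 2 fun k => (v k : ℂ)

/-- Complex conjugation on `ℂ⁷`. -/
def conjVec (v : C7) : C7 := WithLp.toLp 2 fun k => (starRingEnd ℂ) (v k)

/-! ### `G₂`-flags with one-dimensional legs -/

/-- `L = (L₋₃, …, L₃)`, extended by `Lᵢ = 0` for `|i| > 3`, is a `G₂`-flag: the legs are mutually
orthogonal complex lines with sum `ℂ⁷`, with `L₋ᵢ` the conjugate of `Lᵢ`, and
`Lᵢ × Lⱼ ⊆ Lᵢ₊ⱼ` for all integers `i, j`. -/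
structure IsG2Flag (L : ℤ → Submodule ℂ C7) : Prop where
  finrank_leg : ∀ i : ℤ, |i| ≤ 3 → Module.finrank ℂ (L i) = 1
  leg_eq_bot : ∀ i : ℤ, 3 < |i| → L i = ⊥
  orthogonal : ∀ i j : ℤ, i ≠ j → L i ⟂ L j
  iSup_eq_top : ⨆ i, L i = ⊤
  conj_mem : ∀ (i : ℤ) (v : C7), v ∈ L (-i) ↔ conjVec v ∈ L i
  cross_mem : ∀ (i j : ℤ) (u v : C7), u ∈ L i → v ∈ L j → cross u v ∈ L (i + j)

/-! ### Maps from a Riemann surface -/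

section Surface

variable {M : Type*} [TopologicalSpace M] [ChartedSpace ℂ M]

/-- The real differential at `p` of a map from `M` to a real normed space `W`; the tangent space
of `M` at `p` is `ℂ` through the preferred chart at `p`. -/
def realDeriv {W : Type*} [NormedAddCommGroup W] [NormedSpace ℝ W] (f : M → W) (p : M) :
    ℂ →L[ℝ] W :=
  mfderiv 𝓘(ℝ, ℂ) 𝓘(ℝ, W) f p

/-- `∂f/∂z = ½ (∂f/∂x - i ∂f/∂y)` at `p`, with `z = x + iy` the preferred holomorphic chart
at `p`. Another holomorphic coordinate changes the value by a nonzero scalar factor. -/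
def dz {W : Type*} [NormedAddCommGroup W] [NormedSpace ℝ W] [Module ℂ W] (f : M → W) (p : M) : W :=
  (1 / 2 : ℂ) • (realDeriv f p 1 - Complex.I • realDeriv f p Complex.I)

/-- `∂f/∂z̄ = ½ (∂f/∂x + i ∂f/∂y)` at `p`, with the same conventions. -/
def dzbar {W : Type*} [NormedAddCommGroup W] [NormedSpace ℝ W] [Module ℂ W] (f : M → W) (p : M) :
    W :=
  (1 / 2 : ℂ) • (realDeriv f p 1 + Complex.I • realDeriv f p Complex.I)

/-- Orthogonal projection onto the fibres of a family of subspaces of `ℂ⁷`. -/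
def proj (φ : M → Submodule ℂ C7) (p : M) : C7 →L[ℂ] C7 := (φ p).starProjection

/-- `φ` is a smooth family of subspaces, i.e. a smooth map into Grassmannians (embedded by
orthogonal projections), i.e. a smooth subbundle of `M × ℂ⁷`. -/
def IsSmoothSubbundle (φ : M → Submodule ℂ C7) : Prop :=
  ContMDiff 𝓘(ℝ, ℂ) 𝓘(ℝ, C7 →L[ℂ] C7) ∞ (proj φ)

/-- The second fundamental form `A'_{φ,ψ} : φ → ψ`, `v ↦ π_ψ (∂_z v)` for sections `v` of `φ`, where
`φ` and `ψ` are mutually orthogonal smooth subbundles. It is evaluated on the sections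
`q ↦ π_{φ(q)} v` with `v` a constant vector; see `secondForm_section` for arbitrary sections. -/
def secondForm (φ ψ : M → Submodule ℂ C7) (p : M) : φ p →L[ℂ] ψ p :=
  (ψ p).orthogonalProjectionOnto ∘L dz (proj φ) p ∘L (φ p).subtypeL

theorem hasFDerivAt_realDeriv {W : Type*} [NormedAddCommGroup W] [NormedSpace ℝ W] (f : M → W) (p : M)
    (hf : MDifferentiableAt 𝓘(ℝ, ℂ) 𝓘(ℝ, W) f p) :
    HasFDerivAt (f ∘ (extChartAt 𝓘(ℝ, ℂ) p).symm) (realDeriv f p) (extChartAt 𝓘(ℝ, ℂ) p p) := by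
  have := hf.hasMFDerivAt.2
  have h2 : HasFDerivWithinAt (f ∘ (extChartAt 𝓘(ℝ, ℂ) p).symm) (realDeriv f p)
      (Set.range (𝓘(ℝ, ℂ))) (extChartAt 𝓘(ℝ, ℂ) p p) := this
  rw [show Set.range (𝓘(ℝ, ℂ)) = Set.univ by simp, hasFDerivWithinAt_univ] at h2
  exact h2

theorem realDeriv_apply (P : M → C7 →L[ℂ] C7) (s : M → C7) (p : M)
    (hP : MDifferentiableAt 𝓘(ℝ, ℂ) 𝓘(ℝ, C7 →L[ℂ] C7) P p)
    (hs : MDifferentiableAt 𝓘(ℝ, ℂ) 𝓘(ℝ, C7) s p) (x : ℂ) :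
    realDeriv (fun q => P q (s q)) p x = realDeriv P p x (s p) + P p (realDeriv s p x) := by
  have h1 := hasFDerivAt_realDeriv P p hP
  have h2 := hasFDerivAt_realDeriv s p hs
  have h3 := (ContinuousLinearMap.restrictScalarsL ℂ C7 C7 ℝ ℝ).hasFDerivAt.comp _ h1
  have h4 := h3.clm_apply h2
  have h5 : MDifferentiableAt 𝓘(ℝ, ℂ) 𝓘(ℝ, C7) (fun q => P q (s q)) p := by
    rw [mdifferentiableAt_iff]
    refine ⟨?_, ?_⟩
    · exact hP.continuousAt.clm_apply hs.continuousAt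
    · exact h4.differentiableAt.differentiableWithinAt
  have h6 := (hasFDerivAt_realDeriv _ p h5).unique h4
  rw [h6]
  simp [Function.comp_def]
  rw [add_comm]

/-- `A'_{φ,ψ}(s) = π_ψ (∂_z s)` for every section `s` of `φ`. -/
theorem secondForm_section {φ ψ : M → Submodule ℂ C7} (hφ : IsSmoothSubbundle φ) (p : M)
    (hφψ : φ p ⟂ ψ p) (s : M → C7) (hs : ∀ q, s q ∈ φ q)
    (hsd : MDifferentiableAt 𝓘(ℝ, ℂ) 𝓘(ℝ, C7) s p) :
    (secondForm φ ψ p ⟨s p, hs p⟩ : C7) = (ψ p).starProjection (dz s p) := by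
  have hP : MDifferentiableAt 𝓘(ℝ, ℂ) 𝓘(ℝ, C7 →L[ℂ] C7) (proj φ) p :=
    (hφ p).mdifferentiableAt (by simp)
  have hsP : (fun q => proj φ q (s q)) = s := by
    funext q; exact Submodule.starProjection_eq_self_iff.2 (hs q)
  have key := realDeriv_apply (proj φ) s p hP hsd
  rw [hsP] at key
  have h0 : ∀ w, (ψ p).starProjection (proj φ p w) = 0 := fun w => by
    rw [Submodule.starProjection_apply_eq_zero_iff]
    exact hφψ ((φ p).starProjection_apply_mem w)
  have e : (secondForm φ ψ p ⟨s p, hs p⟩ : C7)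
      = (ψ p).starProjection (dz (proj φ) p (s p)) := rfl
  rw [e]
  unfold dz
  rw [key 1, key Complex.I]
  simp [h0]

/-- The second fundamental form `A''_{φ,ψ} : φ → ψ`, `v ↦ π_ψ (∂_z̄ v)` for sections `v` of `φ`. -/
def secondFormBar (φ ψ : M → Submodule ℂ C7) (p : M) : φ p →L[ℂ] ψ p :=
  (ψ p).orthogonalProjectionOnto ∘L dzbar (proj φ) p ∘L (φ p).subtypeL

/-- The limit of the subspaces `φ q` as `q → p`, `q ≠ p`: all vectors that are the limit of their
orthogonal projections onto `φ q`. -/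
def limitFibre (φ : M → Submodule ℂ C7) (p : M) : Submodule ℂ C7 where
  carrier := {w | Filter.Tendsto (fun q => proj φ q w) (𝓝[≠] p) (𝓝 w)}
  add_mem' {a b} ha hb := by simpa only [Set.mem_ofPred_eq, map_add] using ha.add hb
  zero_mem' := by simpa only [Set.mem_ofPred_eq, map_zero] using tendsto_const_nhds
  smul_mem' c a ha := by simpa only [Set.mem_ofPred_eq, map_smul] using ha.const_smul c

/-- Where `φ` agrees, away from `p`, with a subbundle `ψ` continuous at `p`, its limit at `p` is the
fibre of `ψ`. -/
theorem limitFibre_eq {φ ψ : M → Submodule ℂ C7} {p : M} [(𝓝[≠] p).NeBot]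
    (hψ : ContinuousAt (proj ψ) p) (h : ∀ᶠ q in 𝓝[≠] p, φ q = ψ q) :
    limitFibre φ p = ψ p := by
  ext w
  have h1 : Filter.Tendsto (fun q => proj ψ q w) (𝓝[≠] p) (𝓝 (proj ψ p w)) :=
    ((hψ.clm_apply continuousAt_const).tendsto).mono_left nhdsWithin_le_nhds
  have h2 : Filter.Tendsto (fun q => proj φ q w) (𝓝[≠] p) (𝓝 (proj ψ p w)) := by
    refine h1.congr' ?_
    filter_upwards [h] with q hq
    simp only [proj, hq]
  change Filter.Tendsto (fun q => proj φ q w) (𝓝[≠] p) (𝓝 w) ↔ _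
  constructor
  · intro h3
    exact Submodule.starProjection_eq_self_iff.1 (tendsto_nhds_unique h2 h3)
  · intro hw
    have h4 : proj ψ p w = w := Submodule.starProjection_eq_self_iff.2 hw
    rwa [h4] at h2

/-- The `∂'`-Gauss transform `G'(φ)`: the image of `A'_φ = A'_{φ,φ^⊥}`, with zeros filled out (the
rank of the image of `A'_φ` drops only at isolated points when `φ` is harmonic, and there the fibre
is the limit of the images at nearby points). -/
def gaussPrime (φ : M → Submodule ℂ C7) : M → Submodule ℂ C7 :=
  limitFibre fun q =>
    Submodule.map ((φ q)ᗮ.subtype) (LinearMap.range (secondForm φ (fun x => (φ x)ᗮ) q).toLinearMap)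

/-- The `∂''`-Gauss transform `G''(φ)`: the image of `A''_φ = A''_{φ,φ^⊥}`, with zeros filled
out. -/
def gaussDoublePrime (φ : M → Submodule ℂ C7) : M → Submodule ℂ C7 :=
  limitFibre fun q =>
    Submodule.map ((φ q)ᗮ.subtype)
      (LinearMap.range (secondFormBar φ (fun x => (φ x)ᗮ) q).toLinearMap)

/-- The Gauss bundles `G⁽ⁱ⁾(φ)`: the `i`-th iterate of `G'` for `i ≥ 0`, and the `|i|`-th iterate of
`G''` for `i < 0`. -/
def gaussBundle (φ : M → Submodule ℂ C7) : ℤ → M → Submodule ℂ C7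
  | Int.ofNat n => gaussPrime^[n] φ
  | Int.negSucc n => gaussDoublePrime^[n + 1] φ

/-- The unit sphere `S⁶` of the imaginary octonions. -/
abbrev S6 : Type := Metric.sphere (0 : EuclideanSpace ℝ (Fin (6 + 1))) 1

/-- A map into `S⁶`, regarded as a map into `ℝ⁷`. -/
def toR7 (F : M → S6) (p : M) : R7 := (F p : R7)

/-- `F : M → S⁶` is almost complex: it is smooth and its differential intertwines the complex
structure of `M` with the almost complex structure `J_x v = x × v` of `S⁶`, where
`v ∈ T_x S⁶ = x^⊥ ⊆ ℝ⁷`. -/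
def IsAlmostComplex (F : M → S6) : Prop :=
  ContMDiff 𝓘(ℝ, ℂ) (𝓡 6) ∞ F ∧
    ∀ (p : M) (v : ℂ),
      realDeriv (toR7 F) p (Complex.I * v) = cross (toR7 F p) (realDeriv (toR7 F) p v)

/-- `F : M → S⁶` is weakly conformal: the induced symmetric form is at each point a nonnegative
multiple (possibly zero) of the metrics in the conformal class of `M`. -/
def IsWeaklyConformal (F : M → S6) : Prop :=
  ∀ p : M, ∃ c : ℝ, 0 ≤ c ∧ ∀ v w : ℂ,
    ⟪realDeriv (toR7 F) p v, realDeriv (toR7 F) p w⟫_ℝ = c * ⟪v, w⟫_ℝ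

/-- The line bundle `f = span {F}` in `M × ℂ⁷`. -/
def lineOf (F : M → S6) (p : M) : Submodule ℂ C7 := Submodule.span ℂ {complexify (toR7 F p)}

/-- The arrows `i → j` of the diagram
`-3 → -2 → -1 → 0 → 1 → 2 → 3`, `2 → -3`, `3 → -2`. -/
def IsArrow (i j : ℤ) : Prop := j = i + 1 ∨ (i = 2 ∧ j = -3) ∨ (i = 3 ∧ j = -2)

end Surface

end AlmostComplexS6

end

open AlmostComplexS6

/-!
Near a point of `M`, write `F` as a function of a holomorphic coordinate `z` with values in the real
unit vectors of `ℂ⁷`. Almost complexity says that `F_z` is of type `(1, 0)`, i.e.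
`F × F_z = i F_z`. Differentiating this relation gives harmonicity, `∂_z̄ F_z = -|F_z|² F`. The
component `s` of `∂_z u` orthogonal to `u`, where `u` is `F_z` with its zero divided out, is again of
type `(1, 0)` and satisfies `∂_z̄ s = -|s|² u / |u|²`. Both equations have the form
`∂_z̄ s = -|s|² v` with `v ⟂ s`.

*Zeros.* A solution of such an equation vanishes near a point or is `zᵏ` times a nonvanishing smooth
function there (`eventually_eq_zero_or_exists_pow_smul`). If it has a zero, then Hadamard's lemma and
the equation show that it is divisible by `z`, and the quotient solves an equation of the same
kind. A zero of infinite order is excluded by the maximum principle for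
`|s|² |z|⁻²ᴺ exp(κ|z|²)`, with `κ` independent of `N`: on a disc of radius `R`, it forces `|s|` to be
at most a constant times `(|z|/R)ᴺ` for all `N`. Dividing out the zeros gives nonvanishing smooth
local sections of the Gauss bundles of `f`, and the limit fibres of `gaussPrime` and
`gaussDoublePrime` are the lines that these sections span. By connectedness, `s` vanishes identically
or only at isolated points (`IsAlmostComplex.forall_secondDeriv_or`).

*If `s` has isolated zeros*, let `w` be `s` with its zeros divided out. Then `u`, `w` are orthogonal
and of type `(1, 0)`, and the identities of the vector product show that
`F`, `u`, `w`, `u × w` and their conjugates span a `G₂`-flag (`IsAdapted.isG2Flag`). The rows `0`, `±1`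
and `-2` of the matrix of `∂_z` are read off from the equations above. Orthogonality and reality of
the frame make this matrix skew under `(i, j) ↦ (-j, -i)`, which annihilates the entries `(i, -i)` and
determines the other rows (`IsSecondFrame.inner_pz_legFrame_eq_zero`).

*If `s` vanishes identically*, the projection to the span of `ū`, `F` and `u` has zero derivative
(`IsFirstFrame.wirt_planeProj`), so this space is constant. It is the complexification of the real
span of `F`, `a` and `F × a`, with `a` the real part of `u`, and this is associative.

*Exclusivity.* In the second case `G⁽²⁾(f) = 0`, so there is no flag. In the first case, if the values
of `F` were in an associative subspace `P`, then so would be, after complexification, the five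
orthogonal vectors `w̄`, `ū`, `F`, `u`, `w`, while `P` has dimension at most `4`.
-/

noncomputable section

namespace AlmostComplexS6

set_option linter.unusedSectionVars false

/-! ### Wirtinger derivatives of functions on `ℂ` -/

/-- The operator `½ (∂_x + c ∂_y)` on functions of `z = x + iy`. It is `∂_z` for `c = -i` and
`∂_z̄` for `c = i`; one parameter serves both, so that each rule is proved once. -/
def wirt {E : Type*} [NormedAddCommGroup E] [NormedSpace ℝ E] [NormedSpace ℂ E]
    (c : ℂ) (f : ℂ → E) (z : ℂ) : E :=
  (1 / 2 : ℂ) • (fderiv ℝ f z 1 + c • fderiv ℝ f z Complex.I)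

/-- `∂/∂z`. -/
local notation "pz" => wirt (-Complex.I)

/-- `∂/∂z̄`. -/
local notation "pzb" => wirt Complex.I

section Wirtinger

variable {E : Type*} [NormedAddCommGroup E] [NormedSpace ℝ E] [NormedSpace ℂ E]
  [IsScalarTower ℝ ℂ E]

theorem fderiv_eq_pz_pzb (f : ℂ → E) (z w : ℂ) :
    fderiv ℝ f z w = w • pz f z + (starRingEnd ℂ) w • pzb f z := by
  have hw : w = w.re • (1 : ℂ) + w.im • Complex.I := by
    simp [Complex.re_add_im]
  have h1 : fderiv ℝ f z w = w.re • fderiv ℝ f z 1 + w.im • fderiv ℝ f z Complex.I := by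
    conv_lhs => rw [hw]
    rw [map_add, map_smul, map_smul]
  have hc : (starRingEnd ℂ) w = (w.re : ℂ) - w.im * Complex.I := by
    apply Complex.ext <;> simp
  have hw' : w = (w.re : ℂ) + w.im * Complex.I := (Complex.re_add_im w).symm
  have e1 : ∀ (r : ℝ) (x : E), r • x = (r : ℂ) • x := fun r x => by
    rw [← one_smul ℂ x, ← smul_assoc, one_smul]; simp
  rw [h1, e1, e1, hc]
  conv_rhs => rw [hw']
  simp only [wirt, smul_add, smul_smul]
  simp only [Complex.add_re, Complex.ofReal_re, Complex.mul_re, Complex.I_re, Complex.ofReal_im,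
    Complex.I_im, Complex.add_im, Complex.mul_im, mul_zero, sub_zero, mul_one, add_zero, zero_add]
  match_scalars
  · ring
  · linear_combination (w.im : ℂ) * Complex.I_sq

theorem contDiffAt_wirt {c : ℂ} {f : ℂ → E} {z : ℂ} (hf : ContDiffAt ℝ ∞ f z) :
    ContDiffAt ℝ ∞ (wirt c f) z := by
  have h := hf.fderiv_right (m := ∞) (by simp)
  unfold wirt
  exact ((h.clm_apply contDiffAt_const).add
    ((h.clm_apply contDiffAt_const).const_smul c)).const_smul (1 / 2 : ℂ)

theorem wirt_congr {c : ℂ} {f g : ℂ → E} {z : ℂ} (h : f =ᶠ[𝓝 z] g) :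
    wirt c f =ᶠ[𝓝 z] wirt c g := by
  filter_upwards [h.fderiv (𝕜 := ℝ)] with w hw
  simp only [wirt, hw]

theorem wirt_congr_at {c : ℂ} {f g : ℂ → E} {z : ℂ} (h : f =ᶠ[𝓝 z] g) :
    wirt c f z = wirt c g z := (wirt_congr h).eq_of_nhds

theorem wirt_const (c : ℂ) (x : E) (z : ℂ) : wirt c (fun _ => x) z = 0 := by
  simp [wirt]

theorem wirt_add {c : ℂ} {f g : ℂ → E} {z : ℂ} (hf : DifferentiableAt ℝ f z)
    (hg : DifferentiableAt ℝ g z) :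
    wirt c (fun w => f w + g w) z = wirt c f z + wirt c g z := by
  simp only [wirt]
  rw [fderiv_fun_add hf hg]
  simp only [add_apply]
  module

theorem wirt_sub {c : ℂ} {f g : ℂ → E} {z : ℂ} (hf : DifferentiableAt ℝ f z)
    (hg : DifferentiableAt ℝ g z) :
    wirt c (fun w => f w - g w) z = wirt c f z - wirt c g z := by
  simp only [wirt]
  rw [fderiv_fun_sub hf hg]
  simp only [sub_apply]
  module

theorem wirt_neg {c : ℂ} {f : ℂ → E} {z : ℂ} :
    wirt c (fun w => - f w) z = - wirt c f z := by
  simp only [wirt]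
  rw [fderiv_fun_neg]
  simp only [neg_apply]
  module

theorem wirt_smul {c : ℂ} {a : ℂ → ℂ} {f : ℂ → E} {z : ℂ} (ha : DifferentiableAt ℝ a z)
    (hf : DifferentiableAt ℝ f z) :
    wirt c (fun w => a w • f w) z = wirt c a z • f z + a z • wirt c f z := by
  simp only [wirt]
  rw [fderiv_fun_smul ha hf]
  simp only [add_apply, smul_apply,
    ContinuousLinearMap.smulRight_apply, smul_eq_mul]
  module

/-- The chain rule for a real-linear map that is linear or conjugate-linear over `ℂ`: it turns the
parameter `c` into `c'`. -/
theorem wirt_clm {E' : Type*} [NormedAddCommGroup E'] [NormedSpace ℝ E'] [NormedSpace ℂ E']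
    {c c' : ℂ} (A : E →L[ℝ] E') (hA : ∀ x, A (c • x) = c' • A x)
    (hA2 : ∀ x, A ((1 / 2 : ℂ) • x) = (1 / 2 : ℂ) • A x)
    {f : ℂ → E} {z : ℂ} (hf : DifferentiableAt ℝ f z) :
    wirt c' (fun w => A (f w)) z = A (wirt c f z) := by
  have h : fderiv ℝ (fun w => A (f w)) z = A.comp (fderiv ℝ f z) :=
    (A.hasFDerivAt.comp z hf.hasFDerivAt).fderiv
  simp only [wirt, h, ContinuousLinearMap.comp_apply, hA2, map_add, hA]

/-- The Leibniz rule for a real-bilinear map. -/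
theorem wirt_bilin {E' G : Type*} [NormedAddCommGroup E'] [NormedSpace ℝ E'] [NormedSpace ℂ E']
    [NormedAddCommGroup G] [NormedSpace ℝ G] [NormedSpace ℂ G]
    {c c₁ c₂ : ℂ} (B : E →L[ℝ] E' →L[ℝ] G)
    (h1 : ∀ x y, B (c₁ • x) y = c • B x y) (h1' : ∀ x y, B ((1 / 2 : ℂ) • x) y = (1 / 2 : ℂ) • B x y)
    (h2 : ∀ x y, B x (c₂ • y) = c • B x y) (h2' : ∀ x y, B x ((1 / 2 : ℂ) • y) = (1 / 2 : ℂ) • B x y)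
    {f : ℂ → E} {g : ℂ → E'} {z : ℂ} (hf : DifferentiableAt ℝ f z) (hg : DifferentiableAt ℝ g z) :
    wirt c (fun w => B (f w) (g w)) z = B (wirt c₁ f z) (g z) + B (f z) (wirt c₂ g z) := by
  have h := (B.hasFDerivAt_of_bilinear hf.hasFDerivAt hg.hasFDerivAt).fderiv
  simp only [wirt]
  rw [h]
  simp only [add_apply, ContinuousLinearMap.precompR_apply, ContinuousLinearMap.precompL_apply,
    map_add, h1, h2, h1', h2', ContinuousLinearMap.compL_apply, ContinuousLinearMap.comp_apply]
  module

theorem fderiv_wirt {d : ℂ} {f : ℂ → E} {z : ℂ} (hf : ContDiffAt ℝ ∞ f z) (v : ℂ) :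
    fderiv ℝ (wirt d f) z v =
      (1 / 2 : ℂ) • (fderiv ℝ (fderiv ℝ f) z v 1 + d • fderiv ℝ (fderiv ℝ f) z v Complex.I) := by
  have hd : DifferentiableAt ℝ (fderiv ℝ f) z :=
    (hf.fderiv_right (m := ∞) (by simp)).differentiableAt (by simp)
  have h1 : ∀ u : ℂ, HasFDerivAt (fun w => fderiv ℝ f w u)
      ((fderiv ℝ (fderiv ℝ f) z).flip u) z := fun u => by
    have := hd.hasFDerivAt.clm_apply (hasFDerivAt_const u z)
    simpa using this
  have h2 : HasFDerivAt (wirt d f) _ z :=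
    ((h1 1).add ((h1 Complex.I).const_smul d)).const_smul (1 / 2 : ℂ)
  rw [h2.fderiv]
  rfl

theorem isSymmSndFDerivAt_of_smooth {f : ℂ → E} {z : ℂ} (hf : ContDiffAt ℝ ∞ f z) :
    IsSymmSndFDerivAt ℝ f z :=
  hf.isSymmSndFDerivAt (by
    rw [minSmoothness_of_isRCLikeNormedField]
    exact WithTop.coe_le_coe.2 (le_top : (2 : ℕ∞) ≤ ⊤))

theorem wirt_comm {c d : ℂ} {f : ℂ → E} {z : ℂ} (hf : ContDiffAt ℝ ∞ f z) :
    wirt c (wirt d f) z = wirt d (wirt c f) z := by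
  have hsy := isSymmSndFDerivAt_of_smooth hf 1 Complex.I
  have key := fun d v => fderiv_wirt (d := d) hf v
  unfold wirt at key ⊢
  rw [key, key, key, key, hsy]
  module

/-- `4 ∂²/∂z∂z̄` is the Laplacian. -/
theorem pzb_pz_eq {f : ℂ → E} {z : ℂ} (hf : ContDiffAt ℝ ∞ f z) :
    pzb (pz f) z = (1 / 4 : ℂ) • (fderiv ℝ (fderiv ℝ f) z 1 1
      + fderiv ℝ (fderiv ℝ f) z Complex.I Complex.I) := by
  have hsy := isSymmSndFDerivAt_of_smooth hf 1 Complex.I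
  have key := fun d v => fderiv_wirt (d := d) hf v
  unfold wirt at key ⊢
  rw [key, key, hsy]
  match_scalars
  · ring
  · ring
  · linear_combination (-1 / 4 : ℂ) * Complex.I_sq

theorem pzb_eq_zero_of_hasDerivAt {f : ℂ → ℂ} {f' z : ℂ} (hf : HasDerivAt f f' z) :
    pzb f z = 0 := by
  have h : HasFDerivAt f _ z := hf.hasFDerivAt.restrictScalars ℝ
  simp only [wirt, h.fderiv]
  simp
  linear_combination f' * Complex.I_sq

theorem wirt_id (c z : ℂ) : wirt c (fun w : ℂ => w) z = (1 + c * Complex.I) / 2 := by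
  simp only [wirt, fderiv_fun_id, ContinuousLinearMap.id_apply, smul_eq_mul]
  ring

theorem wirt_conj_id (c z : ℂ) :
    wirt c (fun w : ℂ => (starRingEnd ℂ) w) z = (1 - c * Complex.I) / 2 := by
  have h : HasFDerivAt (fun w : ℂ => (starRingEnd ℂ) w) (Complex.conjCLE : ℂ →L[ℝ] ℂ) z :=
    (Complex.conjCLE : ℂ →L[ℝ] ℂ).hasFDerivAt
  simp only [wirt, h.fderiv]
  simp
  ring

theorem contDiff_conj : ContDiff ℝ ∞ (fun w : ℂ => (starRingEnd ℂ) w) :=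
  (Complex.conjCLE : ℂ →L[ℝ] ℂ).contDiff

theorem wirt_pow {c : ℂ} {f : ℂ → ℂ} {z : ℂ} (hf : DifferentiableAt ℝ f z) (n : ℕ) :
    wirt c (fun w => f w ^ (n + 1)) z = (n + 1) * f z ^ n * wirt c f z := by
  induction n with
  | zero => simp
  | succ n ih =>
    have h := wirt_smul (c := c) (a := fun w => f w ^ (n + 1)) (f := f) (hf.pow _) hf
    simp only [smul_eq_mul] at h
    simp only [pow_succ _ (n + 1)]
    rw [h, ih]
    push_cast
    ring

theorem pzb_pow (n : ℕ) (z : ℂ) : pzb (fun w : ℂ => w ^ n) z = 0 := by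
  cases n with
  | zero => simpa using wirt_const Complex.I (1 : ℂ) z
  | succ n =>
    rw [wirt_pow differentiableAt_fun_id, wirt_id]
    simp

theorem pzb_pow_smul {n : ℕ} {f : ℂ → E} {z : ℂ} (hf : DifferentiableAt ℝ f z) :
    pzb (fun w => w ^ n • f w) z = z ^ n • pzb f z := by
  have h := wirt_smul (c := Complex.I) (a := fun w : ℂ => w ^ n)
    (differentiableAt_fun_id.pow _) hf
  rw [h, pzb_pow]
  simp

theorem wirt_cexp {c : ℂ} {f : ℂ → ℂ} {z : ℂ} (hf : DifferentiableAt ℝ f z) :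
    wirt c (fun w => Complex.exp (f w)) z = Complex.exp (f z) * wirt c f z := by
  simp only [wirt]
  rw [hf.hasFDerivAt.cexp.fderiv]
  simp
  ring

end Wirtinger

section WirtingerInner

variable {E : Type*} [NormedAddCommGroup E] [InnerProductSpace ℂ E] [NormedSpace ℝ E]
  [IsScalarTower ℝ ℂ E]

theorem wirt_inner {c : ℂ} {f g : ℂ → E} {z : ℂ} (hf : DifferentiableAt ℝ f z)
    (hg : DifferentiableAt ℝ g z) :
    wirt c (fun w => inner ℂ (f w) (g w)) z
      = inner ℂ (wirt ((starRingEnd ℂ) c) f z) (g z) + inner ℂ (f z) (wirt c g z) := by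
  have h := (hf.hasFDerivAt.inner ℂ hg.hasFDerivAt).fderiv
  simp only [wirt]
  rw [h]
  simp only [ContinuousLinearMap.comp_apply, ContinuousLinearMap.prod_apply, fderivInnerCLM_apply,
    inner_smul_left, inner_smul_right, inner_add_left, inner_add_right, smul_eq_mul]
  simp
  ring_nf
  simp [Complex.conj_ofNat]

end WirtingerInner

/-! ### Hadamard's lemma -/

section Hadamard

/-- Smooth dependence on `z` of `∫₀¹ tⁿ G(t z) dt`; the power of `t` appears on differentiating. -/
theorem contDiff_integral_pow_smul (m : ℕ) : ∀ {V : Type} [NormedAddCommGroup V] [NormedSpace ℝ V]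
    [CompleteSpace V] (n : ℕ) {G : ℂ → V}, ContDiff ℝ ∞ G →
    ContDiff ℝ m (fun z : ℂ => ∫ t in (0 : ℝ)..1, t ^ n • G (t • z)) := by
  have hd : ∀ {V : Type} [NormedAddCommGroup V] [NormedSpace ℝ V] [CompleteSpace V] (n : ℕ)
      {G : ℂ → V}, ContDiff ℝ ∞ G → ∀ z : ℂ,
      HasFDerivAt (fun z : ℂ => ∫ t in (0 : ℝ)..1, t ^ n • G (t • z))
        (∫ t in (0 : ℝ)..1, t ^ (n + 1) • fderiv ℝ G (t • z)) z := by
    intro V _ _ _ n G hG z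
    have hG' : Continuous (fderiv ℝ G) := hG.continuous_fderiv (by simp)
    have hc : Continuous G := hG.continuous
    obtain ⟨C, hC⟩ := (isCompact_closedBall (0 : ℂ) (‖z‖ + 1)).exists_bound_of_continuousOn
      hG'.continuousOn
    refine intervalIntegral.hasFDerivAt_integral_of_dominated_of_fderiv_le
      (s := Metric.ball z 1) (bound := fun _ => C)
      (F := fun z t => t ^ n • G (t • z)) (F' := fun z t => t ^ (n + 1) • fderiv ℝ G (t • z))
      (Metric.ball_mem_nhds z one_pos) ?_ ?_ ?_ ?_ ?_ ?_
    · exact Filter.Eventually.of_forall fun w =>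
        (Continuous.aestronglyMeasurable (by fun_prop))
    · exact Continuous.intervalIntegrable (by fun_prop) _ _
    · exact Continuous.aestronglyMeasurable (by fun_prop)
    · refine Filter.Eventually.of_forall fun t ht w hw => ?_
      rw [Set.uIoc_of_le zero_le_one] at ht
      have h1 : ‖t ^ (n + 1)‖ ≤ 1 := by
        rw [norm_pow, Real.norm_of_nonneg ht.1.le]
        exact pow_le_one₀ ht.1.le ht.2
      have h2 : ‖fderiv ℝ G (t • w)‖ ≤ C := by
        refine hC _ ?_
        rw [mem_closedBall_zero_iff, norm_smul, Real.norm_of_nonneg ht.1.le]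
        have : ‖w‖ ≤ ‖z‖ + 1 := by
          have h3 : ‖w - z‖ < 1 := by simpa [dist_eq_norm] using hw
          have h4 := norm_add_le (w - z) z
          rw [sub_add_cancel] at h4
          linarith
        nlinarith [norm_nonneg w, ht.1, ht.2]
      rw [norm_smul]
      calc ‖t ^ (n + 1)‖ * ‖fderiv ℝ G (t • w)‖ ≤ 1 * ‖fderiv ℝ G (t • w)‖ := by gcongr
        _ ≤ C := by simpa using h2
    · exact intervalIntegrable_const
    · refine Filter.Eventually.of_forall fun t _ w _ => ?_
      have h1 : HasFDerivAt (fun w : ℂ => t • w) (t • ContinuousLinearMap.id ℝ ℂ) w :=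
        (hasFDerivAt_id w).const_smul t
      have h2 : HasFDerivAt G (fderiv ℝ G (t • w)) (t • w) :=
        (hG.differentiable (by simp) _).hasFDerivAt
      have h3 := (h2.comp w h1).const_smul (t ^ n)
      refine h3.congr_fderiv ?_
      ext v
      simp [pow_succ, smul_smul]
  induction m with
  | zero =>
    intro V _ _ _ n G hG
    have : Differentiable ℝ (fun z : ℂ => ∫ t in (0 : ℝ)..1, t ^ n • G (t • z)) :=
      fun z => (hd n hG z).differentiableAt
    simpa using this.continuous
  | succ m ih =>
    intro V _ _ _ n G hG
    push_cast
    rw [contDiff_succ_iff_hasFDerivAt]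
    exact ⟨_, ih (n + 1) (hG.fderiv_right (m := ∞) (by simp)), hd n hG⟩

variable {E : Type} [NormedAddCommGroup E] [NormedSpace ℝ E] [NormedSpace ℂ E]
  [IsScalarTower ℝ ℂ E] [CompleteSpace E]

/-- Hadamard's lemma: a smooth function vanishing at `0` is `z a + z̄ b` with `a`, `b` smooth. -/
theorem exists_eq_smul_add_conj_smul {s : ℂ → E} (hs : ContDiff ℝ ∞ s) (h0 : s 0 = 0) :
    ∃ a b : ℂ → E, ContDiff ℝ ∞ a ∧ ContDiff ℝ ∞ b ∧
      ∀ z, s z = z • a z + (starRingEnd ℂ) z • b z := by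
  have hw : ∀ c : ℂ, ContDiff ℝ ∞ (wirt c s) := fun c =>
    contDiff_iff_contDiffAt.2 fun z => contDiffAt_wirt hs.contDiffAt
  have hsm : ∀ c : ℂ, ContDiff ℝ ∞ (fun z : ℂ => ∫ t in (0 : ℝ)..1, wirt c s (t • z)) := by
    intro c
    refine contDiff_infty.2 fun m => ?_
    simpa using contDiff_integral_pow_smul m 0 (hw c)
  refine ⟨_, _, hsm (-Complex.I), hsm Complex.I, fun z => ?_⟩
  have hd : ∀ t : ℝ, HasDerivAt (fun t : ℝ => s (t • z)) (fderiv ℝ s (t • z) z) t := by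
    intro t
    have h1 : HasDerivAt (fun t : ℝ => t • z) z t := by
      simpa using (hasDerivAt_id t).smul_const z
    exact (hs.differentiable (by simp) _).hasFDerivAt.comp_hasDerivAt t h1
  have hc : ∀ c : ℂ, Continuous fun t : ℝ => wirt c s (t • z) := fun c =>
    (hw c).continuous.comp (by fun_prop)
  have hi : ∀ c : ℂ, IntervalIntegrable (fun t : ℝ => wirt c s (t • z)) MeasureTheory.volume 0 1 :=
    fun c => (hc c).intervalIntegrable _ _
  have hcd : Continuous fun t : ℝ => fderiv ℝ s (t • z) z := by
    have := hs.continuous_fderiv (by simp)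
    fun_prop
  have key := intervalIntegral.integral_eq_sub_of_hasDerivAt (a := 0) (b := 1)
    (fun t _ => hd t) (hcd.intervalIntegrable _ _)
  simp only [one_smul, zero_smul, h0, sub_zero] at key
  rw [← key, ← intervalIntegral.integral_smul, ← intervalIntegral.integral_smul,
    ← intervalIntegral.integral_add]
  · exact intervalIntegral.integral_congr fun t _ => fderiv_eq_pz_pzb s _ z
  · exact ((hc _).const_smul z).intervalIntegrable _ _
  · exact ((hc _).const_smul _).intervalIntegrable _ _

end Hadamard

/-! ### Smooth germs and division by `z` -/

section Germs

variable {E : Type*} [NormedAddCommGroup E] [NormedSpace ℝ E]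

/-- `f` is smooth in a neighbourhood of `0`. -/
def SmoothNear (f : ℂ → E) : Prop := ∀ᶠ z in 𝓝 (0 : ℂ), ContDiffAt ℝ ∞ f z

theorem SmoothNear.contDiffAt {f : ℂ → E} (hf : SmoothNear f) : ContDiffAt ℝ ∞ f 0 :=
  hf.self_of_nhds

theorem SmoothNear.congr {f g : ℂ → E} (hf : SmoothNear f) (h : g =ᶠ[𝓝 0] f) : SmoothNear g := by
  filter_upwards [hf, h.eventuallyEq_nhds] with z hz hz' using hz.congr_of_eventuallyEq hz'

theorem _root_.ContDiff.smoothNear {f : ℂ → E} (hf : ContDiff ℝ ∞ f) : SmoothNear f :=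
  Filter.Eventually.of_forall fun _ => hf.contDiffAt

/-- Two smooth germs that agree away from `0` agree. -/
theorem eventuallyEq_of_punctured {f g : ℂ → E} (hf : ContinuousAt f 0) (hg : ContinuousAt g 0)
    (h : ∀ᶠ z in 𝓝 (0 : ℂ), z ≠ 0 → f z = g z) : f =ᶠ[𝓝 0] g := by
  have h0 : f 0 = g 0 := by
    refine tendsto_nhds_unique (f := f) (l := 𝓝[≠] (0 : ℂ))
      (hf.tendsto.mono_left nhdsWithin_le_nhds) ?_
    refine (hg.tendsto.mono_left nhdsWithin_le_nhds).congr' ?_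
    exact (eventually_nhdsWithin_iff.2 h).mono fun z hz => hz.symm
  filter_upwards [h] with z hz
  by_cases hz0 : z = 0
  · rw [hz0, h0]
  · exact hz hz0

/-- Every smooth germ is the germ of a globally smooth function. -/
theorem SmoothNear.exists_contDiff {f : ℂ → E} (hf : SmoothNear f) :
    ∃ g : ℂ → E, ContDiff ℝ ∞ g ∧ g =ᶠ[𝓝 0] f := by
  obtain ⟨r, hr, hb⟩ := Metric.eventually_nhds_iff_ball.1 hf
  let χ : ContDiffBump (0 : ℂ) := ⟨r / 4, r / 2, by positivity, by linarith⟩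
  refine ⟨fun z => χ z • f z, contDiff_iff_contDiffAt.2 fun z => ?_, ?_⟩
  · by_cases hz : z ∈ Metric.ball (0 : ℂ) r
    · exact χ.contDiff.contDiffAt.smul (hb z hz)
    · have h1 : z ∉ tsupport χ := by
        rw [χ.tsupport_eq]
        intro h
        apply hz
        refine Metric.closedBall_subset_ball ?_ h
        change r / 2 < r
        linarith
      have h2 : (fun z => χ z • f z) =ᶠ[𝓝 z] fun _ => 0 := by
        filter_upwards [notMem_tsupport_iff_eventuallyEq.1 h1] with w hw
        simp [hw]
      exact contDiffAt_const.congr_of_eventuallyEq h2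
  · filter_upwards [χ.eventuallyEq_one] with z hz
    simp [hz]

end Germs

/-- `z̄ⁿ / zᵏ` is of class `Cᵐ` when `n` exceeds `k + m`. The junk value `0⁻¹ = 0` gives the correct
extension by `0` at the origin. -/
theorem contDiff_conj_pow_mul_inv_pow (m : ℕ) : ∀ (n k : ℕ), k + m + 1 ≤ n →
    ContDiff ℝ m (fun z : ℂ => (starRingEnd ℂ) z ^ n * (z ^ k)⁻¹) := by
  have hbase : ∀ n k : ℕ, k + 2 ≤ n → HasFDerivAt
      (fun z : ℂ => (starRingEnd ℂ) z ^ n * (z ^ k)⁻¹) (0 : ℂ →L[ℝ] ℂ) 0 := by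
    intro n k h
    rw [hasFDerivAt_iff_isLittleO_nhds_zero]
    have : ∀ z : ℂ, ‖(starRingEnd ℂ) z ^ n * (z ^ k)⁻¹‖ ≤ ‖z‖ ^ (n - k) := by
      intro z
      rw [norm_mul, norm_inv, norm_pow, norm_pow, RCLike.norm_conj]
      by_cases hz : z = 0
      · simp [hz, show n ≠ 0 by omega]
      · have : (0 : ℝ) < ‖z‖ := norm_pos_iff.2 hz
        rw [← pow_sub₀ _ this.ne' (by omega)]
    have h2 : (fun z : ℂ => ‖z‖ ^ (n - k)) =o[𝓝 0] fun z : ℂ => z := by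
      have h3 := Asymptotics.isLittleO_norm_pow_id (E' := ℂ) (n := n - k) (by omega)
      exact h3
    refine Asymptotics.IsBigO.trans_isLittleO ?_ h2
    refine Asymptotics.IsBigO.of_bound 1 (Filter.Eventually.of_forall fun z => ?_)
    have := this z
    simp [show n ≠ 0 by omega] at this ⊢
    exact this
  have hd : ∀ n k : ℕ, k + 2 ≤ n → ∀ z : ℂ, HasFDerivAt
      (fun z : ℂ => (starRingEnd ℂ) z ^ n * (z ^ k)⁻¹)
      (((n : ℂ) * ((starRingEnd ℂ) z ^ (n - 1) * (z ^ k)⁻¹)) • (Complex.conjCLE : ℂ →L[ℝ] ℂ) -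
        ((k : ℂ) * ((starRingEnd ℂ) z ^ n * (z ^ (k + 1))⁻¹)) • ContinuousLinearMap.id ℝ ℂ) z := by
    intro n k h z
    by_cases hz : z = 0
    · subst hz
      refine (hbase n k h).congr_fderiv ?_
      simp [show n ≠ 0 by omega, show n - 1 ≠ 0 by omega]
      ext; simp
    · have h1 : HasFDerivAt (fun z : ℂ => (starRingEnd ℂ) z) (Complex.conjCLE : ℂ →L[ℝ] ℂ) z :=
        (Complex.conjCLE : ℂ →L[ℝ] ℂ).hasFDerivAt
      have h2 := h1.pow n
      have h3 : HasDerivAt (fun z : ℂ => (z ^ k)⁻¹) (-(k * z ^ (k - 1)) / (z ^ k) ^ 2) z :=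
        (hasDerivAt_pow k z).inv (pow_ne_zero _ hz)
      have h4 := (h3.hasFDerivAt.restrictScalars ℝ)
      refine (h2.mul h4).congr_fderiv ?_
      ext v
      have h5 : (k : ℂ) * z ^ (k - 1) / (z ^ k) ^ 2 = k * (z ^ (k + 1))⁻¹ := by
        rcases k with _ | k
        · simp
        · simp only [Nat.add_sub_cancel]
          field_simp
          ring
      simp [neg_div, h5]
      ring
  induction m with
  | zero =>
    intro n k h
    by_cases h' : k + 2 ≤ n
    · have : Differentiable ℝ (fun z : ℂ => (starRingEnd ℂ) z ^ n * (z ^ k)⁻¹) :=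
        fun z => (hd n k h' z).differentiableAt
      simpa using this.continuous
    · obtain rfl : n = k + 1 := by omega
      simp only [Nat.cast_zero, contDiff_zero]
      rw [continuous_iff_continuousAt]
      intro z
      by_cases hz : z = 0
      · subst hz
        have hb : ∀ z : ℂ, ‖(starRingEnd ℂ) z ^ (k + 1) * (z ^ k)⁻¹‖ ≤ ‖z‖ := by
          intro z
          rw [norm_mul, norm_inv, norm_pow, norm_pow, RCLike.norm_conj]
          by_cases hz : z = 0
          · simp [hz]
          · have : (0 : ℝ) < ‖z‖ := norm_pos_iff.2 hz
            rw [pow_succ]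
            field_simp
            rfl
        have h0 : (starRingEnd ℂ) (0 : ℂ) ^ (k + 1) * ((0 : ℂ) ^ k)⁻¹ = 0 := by simp
        change Filter.Tendsto _ _ (𝓝 ((starRingEnd ℂ) (0 : ℂ) ^ (k + 1) * ((0 : ℂ) ^ k)⁻¹))
        rw [h0]
        exact squeeze_zero_norm hb (by simpa using (continuous_norm (E := ℂ)).tendsto 0)
      · have : ContinuousAt (fun z : ℂ => (starRingEnd ℂ) z) z := Complex.continuous_conj.continuousAt
        exact (this.pow _).mul ((continuousAt_id.pow k).inv₀ (pow_ne_zero _ hz))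
  | succ m ih =>
    intro n k h
    push_cast
    rw [contDiff_succ_iff_hasFDerivAt]
    refine ⟨_, ?_, hd n k (by omega)⟩
    exact (((contDiff_const.mul (ih (n - 1) k (by omega))).smul contDiff_const).sub
      ((contDiff_const.mul (ih n (k + 1) (by omega))).smul contDiff_const))

section SmoothNearOps

variable {E : Type*} [NormedAddCommGroup E] [InnerProductSpace ℂ E] [NormedSpace ℝ E]
  [IsScalarTower ℝ ℂ E] {f g : ℂ → E} {a : ℂ → ℂ}

theorem smoothNear_const (x : E) : SmoothNear fun _ : ℂ => x := contDiff_const.smoothNear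

theorem SmoothNear.add (hf : SmoothNear f) (hg : SmoothNear g) :
    SmoothNear fun z => f z + g z := by
  filter_upwards [hf, hg] with z h1 h2 using h1.add h2

theorem SmoothNear.sub (hf : SmoothNear f) (hg : SmoothNear g) :
    SmoothNear fun z => f z - g z := by
  filter_upwards [hf, hg] with z h1 h2 using h1.sub h2

theorem SmoothNear.neg (hf : SmoothNear f) : SmoothNear fun z => - f z := by
  filter_upwards [hf] with z h1 using h1.neg

theorem SmoothNear.smul (ha : SmoothNear a) (hf : SmoothNear f) :
    SmoothNear fun z => a z • f z := by
  filter_upwards [ha, hf] with z h1 h2 using h1.smul h2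

theorem SmoothNear.inner (hf : SmoothNear f) (hg : SmoothNear g) :
    SmoothNear fun z => inner ℂ (f z) (g z) := by
  filter_upwards [hf, hg] with z h1 h2 using h1.inner ℂ h2

theorem SmoothNear.wirt (c : ℂ) (hf : SmoothNear f) : SmoothNear (wirt c f) := by
  filter_upwards [hf] with z h1 using contDiffAt_wirt h1

theorem smoothNear_conj_pow (n : ℕ) : SmoothNear fun z : ℂ => (starRingEnd ℂ) z ^ n :=
  (contDiff_conj.pow n).smoothNear

theorem SmoothNear.continuousAt (hf : SmoothNear f) : ContinuousAt f 0 :=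
  hf.contDiffAt.continuousAt

theorem _root_.ContDiffAt.diffAt {V W : Type*} [NormedAddCommGroup V] [NormedSpace ℝ V]
    [NormedAddCommGroup W] [NormedSpace ℝ W] {f : V → W} {z : V} (h : ContDiffAt ℝ ∞ f z) :
    DifferentiableAt ℝ f z :=
  h.differentiableAt (by simp)

end SmoothNearOps

section Division

variable {E : Type} [NormedAddCommGroup E] [InnerProductSpace ℂ E] [NormedSpace ℝ E]
  [IsScalarTower ℝ ℂ E] [CompleteSpace E] {s t v : ℂ → E}

/-- The equation `∂s/∂z̄ = ⟨t, s⟩ v` trades powers: modulo `z`, a solution vanishing at `0` is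
divisible by every power of `z̄`. -/
theorem exists_eq_smul_add_conj_pow_smul (hs : SmoothNear s) (ht : SmoothNear t)
    (hv : SmoothNear v) (h0 : s 0 = 0)
    (heq : ∀ᶠ z in 𝓝 (0 : ℂ), pzb s z = inner ℂ (t z) (s z) • v z) (n : ℕ) :
    ∃ a b : ℂ → E, SmoothNear a ∧ SmoothNear b ∧
      ∀ᶠ z in 𝓝 (0 : ℂ), s z = z • a z + (starRingEnd ℂ) z ^ (n + 1) • b z := by
  induction n with
  | zero =>
    obtain ⟨S, hS, hSs⟩ := hs.exists_contDiff
    obtain ⟨a, b, ha, hb, hab⟩ := exists_eq_smul_add_conj_smul hS (by rw [hSs.eq_of_nhds, h0])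
    refine ⟨a, b, ha.smoothNear, hb.smoothNear, ?_⟩
    filter_upwards [hSs] with z hz
    rw [← hz, hab]
    simp
  | succ n ih =>
    obtain ⟨a, b, ha, hb, hab⟩ := ih
    have hn : ((n : ℂ) + 1) ≠ 0 := by exact_mod_cast n.succ_ne_zero
    have hA : SmoothNear fun z => inner ℂ (t z) (a z) • v z - pzb a z :=
      ((ht.inner ha).smul hv).sub (ha.wirt _)
    have hB : SmoothNear fun z => inner ℂ (t z) (b z) • v z - pzb b z :=
      ((ht.inner hb).smul hv).sub (hb.wirt _)
    refine ⟨fun z => a z + ((starRingEnd ℂ) z ^ 1) •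
        (((n : ℂ) + 1)⁻¹ • (inner ℂ (t z) (a z) • v z - pzb a z)),
      fun z => ((n : ℂ) + 1)⁻¹ • (inner ℂ (t z) (b z) • v z - pzb b z),
      ha.add ((smoothNear_conj_pow 1).smul ((smoothNear_const _).smul hA)),
      (smoothNear_const _).smul hB, ?_⟩
    have h1 : ∀ᶠ z in 𝓝 (0 : ℂ), pzb s z =
        pzb (fun z => z • a z + (starRingEnd ℂ) z ^ (n + 1) • b z) z := wirt_congr hab
    filter_upwards [h1, hab, heq, ha, hb] with z h1 h2 h3 h4 h5
    have hcd : DifferentiableAt ℝ (fun z : ℂ => (starRingEnd ℂ) z) z :=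
      contDiff_conj.contDiffAt.diffAt
    have hpd : DifferentiableAt ℝ (fun z : ℂ => (starRingEnd ℂ) z ^ (n + 1)) z := hcd.pow _
    rw [wirt_add (f := fun z => z • a z) (g := fun z => (starRingEnd ℂ) z ^ (n + 1) • b z)
      (DifferentiableAt.smul differentiableAt_fun_id h4.diffAt) (hpd.smul h5.diffAt),
      wirt_smul differentiableAt_fun_id h4.diffAt, wirt_smul hpd h5.diffAt] at h1
    have h6 : pzb (fun z : ℂ => (starRingEnd ℂ) z ^ (n + 1)) z
        = ((n : ℂ) + 1) * (starRingEnd ℂ) z ^ n := by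
      rw [wirt_pow hcd, wirt_conj_id]
      simp
    rw [h6, wirt_id, h3, h2, inner_add_right, inner_smul_right, inner_smul_right] at h1
    simp only [Complex.I_mul_I, add_neg_cancel, zero_div, zero_smul, zero_add] at h1
    rw [h2]
    have h7 : (starRingEnd ℂ) z ^ (n + 1) • b z = ((starRingEnd ℂ) z * ((n : ℂ) + 1)⁻¹) •
        ((((n : ℂ) + 1) * (starRingEnd ℂ) z ^ n) • b z) := by
      rw [smul_smul]
      congr 1
      field_simp
      ring
    have h8 : (((n : ℂ) + 1) * (starRingEnd ℂ) z ^ n) • b z =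
        z • (inner ℂ (t z) (a z) • v z - pzb a z) +
        (starRingEnd ℂ) z ^ (n + 1) • (inner ℂ (t z) (b z) • v z - pzb b z) := by
      have : (((n : ℂ) + 1) * (starRingEnd ℂ) z ^ n) • b z =
          (z * inner ℂ (t z) (a z) + (starRingEnd ℂ) z ^ (n + 1) * inner ℂ (t z) (b z)) • v z -
          (z • pzb a z + (starRingEnd ℂ) z ^ (n + 1) • pzb b z) := by
        rw [h1]
        abel
      rw [this]
      module
    rw [h7, h8]
    module

/-- A smooth solution of `∂s/∂z̄ = ⟨t, s⟩ v` vanishing at `0` is smoothly divisible by `z`. -/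
theorem exists_smoothNear_eq_smul (hs : SmoothNear s) (ht : SmoothNear t)
    (hv : SmoothNear v) (h0 : s 0 = 0)
    (heq : ∀ᶠ z in 𝓝 (0 : ℂ), pzb s z = inner ℂ (t z) (s z) • v z) :
    ∃ u : ℂ → E, SmoothNear u ∧ ∀ᶠ z in 𝓝 (0 : ℂ), s z = z • u z := by
  choose a b ha hb hab using exists_eq_smul_add_conj_pow_smul hs ht hv h0 heq
  set u : ℂ → E := fun z => if z = 0 then a 1 0 else z⁻¹ • s z with hu
  have hcont : ∀ n m : ℕ, m + 1 ≤ n → ContDiffAt ℝ m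
      (fun z => a n z + ((starRingEnd ℂ) z ^ (n + 1) * (z ^ 1)⁻¹) • b n z) 0 := by
    intro n m h
    refine ((ha n).contDiffAt.of_le (by exact_mod_cast le_top)).add (ContDiffAt.smul ?_
      ((hb n).contDiffAt.of_le (by exact_mod_cast le_top)))
    exact (contDiff_conj_pow_mul_inv_pow m (n + 1) 1 (by omega)).contDiffAt
  have hoff : ∀ n, ∀ᶠ z in 𝓝 (0 : ℂ), z ≠ 0 →
      a n z + ((starRingEnd ℂ) z ^ (n + 1) * (z ^ 1)⁻¹) • b n z = z⁻¹ • s z := by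
    intro n
    filter_upwards [hab n] with z hz hz0
    rw [hz, smul_add, smul_smul, smul_smul, inv_mul_cancel₀ hz0, one_smul, pow_one,
      mul_comm (z⁻¹)]
  have hloc : ∀ n, 1 ≤ n → u =ᶠ[𝓝 0]
      (fun z => a n z + ((starRingEnd ℂ) z ^ (n + 1) * (z ^ 1)⁻¹) • b n z) := by
    intro n hn
    have h1 := eventuallyEq_of_punctured (hcont 1 0 (by omega)).continuousAt
      (hcont n 0 (by omega)).continuousAt (by
        filter_upwards [hoff 1, hoff n] with z h1 h2 hz
        rw [h1 hz, h2 hz])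
    have h2 := h1.eq_of_nhds
    simp only [map_zero, pow_one, inv_zero, mul_zero, zero_smul, add_zero] at h2
    filter_upwards [hoff n] with z hz
    by_cases hz0 : z = 0
    · simp [hu, hz0, h2]
    · rw [hz hz0]
      simp [hu, hz0]
  refine ⟨u, ?_, ?_⟩
  · have hu0 : ContDiffAt ℝ ∞ u 0 := contDiffAt_infty.2 fun m =>
      (hcont (m + 1) m (by omega)).congr_of_eventuallyEq (hloc (m + 1) (by omega))
    filter_upwards [hs] with z hz
    by_cases hz0 : z = 0
    · rw [hz0]; exact hu0
    · have h1 : ContDiffAt ℝ ∞ (fun z : ℂ => z⁻¹ • s z) z :=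
        (contDiffAt_id.inv hz0).smul hz
      refine h1.congr_of_eventuallyEq ?_
      filter_upwards [isOpen_ne.mem_nhds hz0] with w hw
      simp only [hu, if_neg (show w ≠ 0 from hw)]
  · refine Filter.Eventually.of_forall fun z => ?_
    by_cases hz0 : z = 0
    · simp [hz0, h0]
    · simp [hu, hz0, smul_smul]

/-- Either a power of `z` splits off with nonvanishing quotient, or the solution is divisible by
all powers of `z`. -/
theorem exists_pow_smul_or_forall (hs : SmoothNear s) (ht : SmoothNear t) (hv : SmoothNear v)
    (heq : ∀ᶠ z in 𝓝 (0 : ℂ), pzb s z = inner ℂ (t z) (s z) • v z) :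
    (∃ (k : ℕ) (u : ℂ → E), SmoothNear u ∧ u 0 ≠ 0 ∧ ∀ᶠ z in 𝓝 (0 : ℂ), s z = z ^ k • u z) ∨
    ∀ k : ℕ, ∃ u : ℂ → E, SmoothNear u ∧ ∀ᶠ z in 𝓝 (0 : ℂ), s z = z ^ k • u z := by
  by_cases hex : ∃ (k : ℕ) (u : ℂ → E), SmoothNear u ∧ u 0 ≠ 0 ∧
      ∀ᶠ z in 𝓝 (0 : ℂ), s z = z ^ k • u z
  · exact Or.inl hex
  refine Or.inr fun k => ?_
  simp only [not_exists, not_and] at hex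
  induction k with
  | zero => exact ⟨s, hs, by simp⟩
  | succ k ih =>
    obtain ⟨u, hu, hsu⟩ := ih
    have hu0 : u 0 = 0 := by
      by_contra h
      exact hex k u hu h hsu
    have h1 : ∀ᶠ z in 𝓝 (0 : ℂ), pzb s z = pzb (fun z => z ^ k • u z) z := wirt_congr hsu
    have h2 : ∀ᶠ z in 𝓝 (0 : ℂ), pzb u z = inner ℂ (t z) (u z) • v z := by
      refine eventuallyEq_of_punctured (hu.wirt _).continuousAt
        ((ht.inner hu).smul hv).continuousAt ?_
      filter_upwards [h1, hsu, heq, hu] with z h1 h2 h3 h4 hz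
      rw [pzb_pow_smul h4.diffAt, h3, h2, inner_smul_right, mul_smul] at h1
      exact (smul_right_injective E (pow_ne_zero k hz) h1).symm
    obtain ⟨w, hw, huw⟩ := exists_smoothNear_eq_smul hu ht hv hu0 h2
    refine ⟨w, hw, ?_⟩
    filter_upwards [hsu, huw] with z h1 h2
    rw [h1, h2, smul_smul, pow_succ]

end Division

/-! ### Unique continuation by the maximum principle -/

section MaximumPrinciple

theorem deriv_deriv_nonpos_of_isLocalMax {φ : ℝ → ℝ} {x : ℝ} (h : IsLocalMax φ x)
    (hc : ContinuousAt φ x) : deriv (deriv φ) x ≤ 0 := by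
  by_contra! hpos
  have hmin := isLocalMin_of_deriv_deriv_pos hpos h.deriv_eq_zero hc
  have he : φ =ᶠ[𝓝 x] fun _ => φ x := by
    filter_upwards [h, hmin] with y h1 h2 using le_antisymm h1 h2
  have h2 := he.deriv.deriv_eq
  simp at h2
  linarith

/-- At a local maximum of a real function the gradient vanishes and the Laplacian is
nonpositive. -/
theorem pz_eq_zero_and_re_nonpos_of_isLocalMax {G : ℂ → ℂ} {g : ℂ → ℝ} {z : ℂ}
    (hG : ∀ᶠ w in 𝓝 z, ContDiffAt ℝ ∞ G w) (hg : ∀ w, G w = g w) (h : IsLocalMax g z) :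
    pz G z = 0 ∧ (pzb (pz G) z).re ≤ 0 := by
  have hgre : g = fun w => Complex.reCLM (G w) := by
    funext w; simp [hg]
  have hGof : G = fun w => Complex.ofRealCLM (g w) := by
    funext w; simp [hg]
  have hgd : ContDiffAt ℝ ∞ g z := by
    rw [hgre]; exact Complex.reCLM.contDiff.contDiffAt.comp z hG.self_of_nhds
  have hG0 : fderiv ℝ G z = 0 := by
    rw [hGof]
    have := (Complex.ofRealCLM.hasFDerivAt.comp z hgd.diffAt.hasFDerivAt).fderiv
    rw [h.fderiv_eq_zero] at this
    simpa [Function.comp_def] using this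
  refine ⟨by simp [wirt, hG0], ?_⟩
  have hD : ∀ v : ℂ, (fderiv ℝ (fderiv ℝ G) z v v).re ≤ 0 := by
    intro v
    have hl : ∀ t : ℝ, HasDerivAt (fun t : ℝ => z + t • v) v t := fun t => by
      simpa using ((hasDerivAt_id t).smul_const v).const_add z
    have hl0 : z + (0 : ℝ) • v = z := by simp
    have hlt : Filter.Tendsto (fun t : ℝ => z + t • v) (𝓝 0) (𝓝 z) := by
      have := (hl 0).continuousAt.tendsto
      rwa [hl0] at this
    set φ : ℝ → ℝ := fun t => g (z + t • v) with hφ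
    have hmax : IsLocalMax φ 0 := by
      have h1 := hlt.eventually h
      filter_upwards [h1] with t ht
      simpa [hφ] using ht
    have hd1 : ∀ᶠ t in 𝓝 (0 : ℝ), HasDerivAt φ (fderiv ℝ G (z + t • v) v).re t := by
      filter_upwards [hlt.eventually hG] with t ht
      have h1 := ht.diffAt.hasFDerivAt.comp_hasDerivAt t (hl t)
      have h2 := Complex.reCLM.hasFDerivAt.comp_hasDerivAt t h1
      rw [hφ, hgre]
      exact h2
    have hd2 : HasDerivAt (fun t : ℝ => (fderiv ℝ G (z + t • v) v).re)
        (fderiv ℝ (fderiv ℝ G) z v v).re 0 := by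
      have h1 : HasFDerivAt (fderiv ℝ G) (fderiv ℝ (fderiv ℝ G) z) (z + (0 : ℝ) • v) := by
        rw [hl0]
        exact ((hG.self_of_nhds.fderiv_right (m := ∞) (by simp)).differentiableAt
          (by simp)).hasFDerivAt
      have h2 := h1.comp_hasDerivAt (0 : ℝ) (hl 0)
      have h3 := h2.clm_apply (hasDerivAt_const (0 : ℝ) v)
      have h4 := Complex.reCLM.hasFDerivAt.comp_hasDerivAt (0 : ℝ) h3
      simpa [Function.comp_def] using h4
    have h5 : deriv (deriv φ) 0 = (fderiv ℝ (fderiv ℝ G) z v v).re := by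
      have h6 : deriv φ =ᶠ[𝓝 0] fun t : ℝ => (fderiv ℝ G (z + t • v) v).re :=
        hd1.mono fun t ht => ht.deriv
      rw [h6.deriv_eq, hd2.deriv]
    rw [← h5]
    exact deriv_deriv_nonpos_of_isLocalMax hmax hd1.self_of_nhds.continuousAt
  rw [pzb_pz_eq hG.self_of_nhds]
  have h1 := hD 1
  have h2 := hD Complex.I
  have h3 : ((1 / 4 : ℂ) • (fderiv ℝ (fderiv ℝ G) z 1 1
      + fderiv ℝ (fderiv ℝ G) z Complex.I Complex.I)).re = (1 / 4) * ((fderiv ℝ (fderiv ℝ G) z 1 1).re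
      + (fderiv ℝ (fderiv ℝ G) z Complex.I Complex.I).re) := by
    rw [smul_eq_mul, show (1 / 4 : ℂ) = ((1 / 4 : ℝ) : ℂ) by push_cast; rfl, Complex.re_ofReal_mul,
      Complex.add_re]
  rw [h3]
  linarith

variable {E : Type} [NormedAddCommGroup E] [InnerProductSpace ℂ E] [NormedSpace ℝ E]
  [IsScalarTower ℝ ℂ E]

/-- If `∂U/∂z̄ = -ρ v` with `v ⟂ U`, then `log |U|² + κ|z|²` is strictly subharmonic for large `κ`
where `U ≠ 0`, so `|U|² exp(κ|z|²)` has no local maximum there. -/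
theorem not_isLocalMax_norm_sq_mul_exp {U v : ℂ → E} {ρ : ℂ → ℂ} {z : ℂ} {K κ : ℝ}
    (hU : ∀ᶠ w in 𝓝 z, ContDiffAt ℝ ∞ U w) (hv : ∀ᶠ w in 𝓝 z, ContDiffAt ℝ ∞ v w)
    (hρ : ∀ᶠ w in 𝓝 z, ContDiffAt ℝ ∞ ρ w)
    (heq : ∀ᶠ w in 𝓝 z, pzb U w = -(ρ w • v w))
    (horth : ∀ᶠ w in 𝓝 z, inner ℂ (v w) (U w) = 0) (hU0 : U z ≠ 0)
    (hK : ‖ρ z‖ ^ 2 * ‖v z‖ ^ 2 ≤ K * ‖U z‖ ^ 2) (hκ : K < κ)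
    (hmax : IsLocalMax (fun w => ‖U w‖ ^ 2 * Real.exp (κ * ‖w‖ ^ 2)) z) : False := by
  set e : ℂ → ℂ := fun w => κ * (w * (starRingEnd ℂ) w) with he
  have hed : ∀ w, ContDiffAt ℝ ∞ e w := fun w =>
    contDiffAt_const.mul (contDiffAt_id.mul contDiff_conj.contDiffAt)
  have hexp : ∀ w, ContDiffAt ℝ ∞ (fun w => Complex.exp (e w)) w := fun w => (hed w).cexp
  have hwe : ∀ c w, wirt c e w = κ * ((1 + c * Complex.I) / 2 * (starRingEnd ℂ) w
      + w * ((1 - c * Complex.I) / 2)) := by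
    intro c w
    have h1 := wirt_smul (c := c) (a := fun w : ℂ => w) (f := fun w : ℂ => (starRingEnd ℂ) w)
      differentiableAt_fun_id (contDiff_conj.contDiffAt (x := w)).diffAt
    have h2 := wirt_smul (c := c) (a := fun _ : ℂ => (κ : ℂ))
      (f := fun w : ℂ => w * (starRingEnd ℂ) w) (z := w) (differentiableAt_const _)
      (differentiableAt_fun_id.mul contDiff_conj.contDiffAt.diffAt)
    simp only [smul_eq_mul] at h1 h2
    rw [he, h2, h1, wirt_const, wirt_id, wirt_conj_id]
    ring
  have hgG : ∀ w, inner ℂ (U w) (U w) * Complex.exp (e w)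
      = ((‖U w‖ ^ 2 * Real.exp (κ * ‖w‖ ^ 2) : ℝ) : ℂ) := by
    intro w
    rw [inner_self_eq_norm_sq_to_K, he]
    simp only [Complex.mul_conj, Complex.normSq_eq_norm_sq]
    push_cast
    rfl
  have hG : ∀ᶠ w in 𝓝 z, ContDiffAt ℝ ∞ (fun w => inner ℂ (U w) (U w) * Complex.exp (e w)) w := by
    filter_upwards [hU] with w hw using (hw.inner ℂ hw).mul (hexp w)
  obtain ⟨hG1, hG2⟩ := pz_eq_zero_and_re_nonpos_of_isLocalMax hG hgG hmax
  -- the first derivatives of `|U|²` and of the weighted function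
  have horth' : ∀ᶠ w in 𝓝 z, inner ℂ (U w) (v w) = 0 := by
    filter_upwards [horth] with w hw
    rw [← inner_conj_symm, hw, map_zero]
  have hh : ∀ᶠ w in 𝓝 z, pz (fun w => inner ℂ (U w) (U w)) w = inner ℂ (U w) (pz U w)
      ∧ pzb (fun w => inner ℂ (U w) (U w)) w = inner ℂ (pz U w) (U w) := by
    filter_upwards [hU, heq, horth, horth'] with w h1 h2 h3 h4
    rw [wirt_inner h1.diffAt h1.diffAt, wirt_inner h1.diffAt h1.diffAt]
    simp only [map_neg, Complex.conj_I, neg_neg, h2, inner_neg_left, inner_neg_right,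
      inner_smul_left, inner_smul_right, h3, h4, mul_zero, neg_zero, zero_add, add_zero, and_self]
  have hpG : ∀ᶠ w in 𝓝 z, pz (fun w => inner ℂ (U w) (U w) * Complex.exp (e w)) w =
      (inner ℂ (U w) (pz U w) + inner ℂ (U w) (U w) * (κ * (starRingEnd ℂ) w))
        * Complex.exp (e w) := by
    filter_upwards [hU, hh] with w h1 h2
    have := wirt_smul (c := -Complex.I) (h1.inner ℂ h1).diffAt (hexp w).diffAt
    simp only [smul_eq_mul] at this
    rw [this, wirt_cexp (hed w).diffAt, h2.1, hwe]
    simp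
    ring
  have hcrit : inner ℂ (U z) (pz U z) = -(inner ℂ (U z) (U z) * (κ * (starRingEnd ℂ) z)) := by
    have := hpG.self_of_nhds
    rw [hG1] at this
    rcases mul_eq_zero.1 this.symm with h | h
    · exact eq_neg_of_add_eq_zero_left h
    · exact absurd h (Complex.exp_ne_zero _)
  have hU1 := hU.self_of_nhds
  have hv1 := hv.self_of_nhds
  -- `⟨U, ∂²U/∂z∂z̄⟩ = -|ρ|²|v|²`
  have hmix : inner ℂ (U z) (pzb (pz U) z) = -((‖ρ z‖ ^ 2 * ‖v z‖ ^ 2 : ℝ) : ℂ) := by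
    have h1 : pz (fun w => inner ℂ (U w) (v w)) z = 0 := by
      rw [wirt_congr_at (show (fun w => inner ℂ (U w) (v w)) =ᶠ[𝓝 z] fun _ => 0 from horth'),
        wirt_const]
    rw [wirt_inner hU1.diffAt hv1.diffAt] at h1
    simp only [map_neg, Complex.conj_I, neg_neg, heq.self_of_nhds, inner_neg_left,
      inner_smul_left] at h1
    rw [wirt_comm hU1, wirt_congr_at heq, wirt_neg,
      wirt_smul hρ.self_of_nhds.diffAt hv1.diffAt, inner_neg_right, inner_add_right,
      inner_smul_right, inner_smul_right, horth'.self_of_nhds]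
    have h2 : inner ℂ (U z) (pz v z) = (starRingEnd ℂ) (ρ z) * inner ℂ (v z) (v z) := by
      linear_combination h1
    rw [h2, inner_self_eq_norm_sq_to_K]
    have h3 := Complex.mul_conj (ρ z)
    rw [Complex.normSq_eq_norm_sq] at h3
    push_cast at h3 ⊢
    simp only [Complex.coe_algebraMap]
    linear_combination (-(‖v z‖ : ℂ) ^ 2) * h3
  have hpU : DifferentiableAt ℝ (pz U) z := (contDiffAt_wirt hU1).diffAt
  have hlap : pzb (pz fun w => inner ℂ (U w) (U w) * Complex.exp (e w)) z =
      (inner ℂ (pz U z) (pz U z) - ((‖ρ z‖ ^ 2 * ‖v z‖ ^ 2 : ℝ) : ℂ)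
        - inner ℂ (U z) (U z) * κ ^ 2 * (z * (starRingEnd ℂ) z) + inner ℂ (U z) (U z) * κ)
        * Complex.exp (e z) := by
    have hconjd : DifferentiableAt ℝ (fun w : ℂ => (starRingEnd ℂ) w) z :=
      contDiff_conj.contDiffAt.diffAt
    have hd1 : DifferentiableAt ℝ (fun w => inner ℂ (U w) (pz U w)) z :=
      hU1.diffAt.inner ℂ hpU
    have hd2 : DifferentiableAt ℝ (fun w => inner ℂ (U w) (U w)) z :=
      hU1.diffAt.inner ℂ hU1.diffAt
    have hd3 : DifferentiableAt ℝ (fun w : ℂ => (κ : ℂ) * (starRingEnd ℂ) w) z :=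
      (differentiableAt_const _).mul hconjd
    have e1 := wirt_smul (c := Complex.I)
      (a := fun w => inner ℂ (U w) (pz U w) + inner ℂ (U w) (U w) * (κ * (starRingEnd ℂ) w))
      (hd1.add (hd2.mul hd3)) (hexp z).diffAt
    have hd4 : DifferentiableAt ℝ
        (fun w : ℂ => inner ℂ (U w) (U w) * ((κ : ℂ) * (starRingEnd ℂ) w)) z := hd2.mul hd3
    have e2 := wirt_add (c := Complex.I) hd1 hd4
    have e3 := wirt_smul (c := Complex.I) hd2 hd3
    have e4 := wirt_smul (c := Complex.I) (a := fun _ : ℂ => (κ : ℂ)) (differentiableAt_const _)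
      hconjd
    simp only [smul_eq_mul] at e1 e2 e3 e4
    rw [wirt_congr_at hpG, e1, e2, e3, e4, wirt_const, wirt_conj_id, wirt_cexp (hed z).diffAt, hwe,
      wirt_inner hU1.diffAt hpU, hh.self_of_nhds.2, hmix, hcrit]
    have hcrit' : inner ℂ (pz U z) (U z) = -(inner ℂ (U z) (U z) * (κ * z)) := by
      rw [← inner_conj_symm, hcrit]
      simp
    rw [hcrit']
    simp
    ring
  rw [hlap] at hG2
  have hre : ((inner ℂ (pz U z) (pz U z) - ((‖ρ z‖ ^ 2 * ‖v z‖ ^ 2 : ℝ) : ℂ)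
        - inner ℂ (U z) (U z) * κ ^ 2 * (z * (starRingEnd ℂ) z) + inner ℂ (U z) (U z) * κ)
        * Complex.exp (e z)) = (((‖pz U z‖ ^ 2 - ‖ρ z‖ ^ 2 * ‖v z‖ ^ 2
        - ‖U z‖ ^ 2 * κ ^ 2 * ‖z‖ ^ 2 + ‖U z‖ ^ 2 * κ) * Real.exp (κ * ‖z‖ ^ 2) : ℝ) : ℂ) := by
    rw [inner_self_eq_norm_sq_to_K, inner_self_eq_norm_sq_to_K, he]
    simp only [Complex.mul_conj, Complex.normSq_eq_norm_sq]
    push_cast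
    rfl
  rw [hre, Complex.ofReal_re] at hG2
  have hUpos : 0 < ‖U z‖ := norm_pos_iff.2 hU0
  have hcs : ‖U z‖ ^ 2 * κ ^ 2 * ‖z‖ ^ 2 ≤ ‖pz U z‖ ^ 2 := by
    have h1 := norm_inner_le_norm (𝕜 := ℂ) (U z) (pz U z)
    rw [hcrit, inner_self_eq_norm_sq_to_K] at h1
    simp at h1
    have h2 : ‖U z‖ * (|κ| * ‖z‖) ≤ ‖pz U z‖ := by
      refine le_of_mul_le_mul_left ?_ hUpos
      calc _ = ‖U z‖ ^ 2 * (|κ| * ‖z‖) := by ring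
        _ ≤ _ := h1
    calc _ = (‖U z‖ * (|κ| * ‖z‖)) ^ 2 := by rw [mul_pow, mul_pow, sq_abs]; ring
      _ ≤ _ := by gcongr
  have hexp0 := Real.exp_pos (κ * ‖z‖ ^ 2)
  have h1 : 0 < ‖pz U z‖ ^ 2 - ‖ρ z‖ ^ 2 * ‖v z‖ ^ 2
        - ‖U z‖ ^ 2 * κ ^ 2 * ‖z‖ ^ 2 + ‖U z‖ ^ 2 * κ := by
    have : K * ‖U z‖ ^ 2 < κ * ‖U z‖ ^ 2 := by gcongr
    linarith
  exact absurd hG2 (not_le.2 (mul_pos h1 hexp0))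

end MaximumPrinciple

section UniqueContinuation

variable {E : Type} [NormedAddCommGroup E] [InnerProductSpace ℂ E] [NormedSpace ℝ E]
  [IsScalarTower ℝ ℂ E] {s v : ℂ → E}

/-- Strong unique continuation: a solution of `∂s/∂z̄ = -|s|² v` with `v ⟂ s` that vanishes to
infinite order at `0` vanishes near `0`. The maximum principle bounds `|s|² |z|⁻²ᴺ exp(κ|z|²)` by its
values on a fixed circle, with `κ` independent of `N`. -/
theorem eventually_eq_zero_of_flat (hs : SmoothNear s) (hv : SmoothNear v)
    (heq : ∀ᶠ z in 𝓝 (0 : ℂ), pzb s z = -(inner ℂ (s z) (s z) • v z))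
    (horth : ∀ᶠ z in 𝓝 (0 : ℂ), inner ℂ (v z) (s z) = 0)
    (hflat : ∀ k : ℕ, ∃ u : ℂ → E, SmoothNear u ∧ ∀ᶠ z in 𝓝 (0 : ℂ), s z = z ^ k • u z) :
    ∀ᶠ z in 𝓝 (0 : ℂ), s z = 0 := by
  obtain ⟨r, hr, hb⟩ := Metric.eventually_nhds_iff_ball.1
    (hs.and (hv.and (heq.and horth)))
  set R : ℝ := r / 2 with hR
  have hR0 : 0 < R := by positivity
  have hsub : ∀ z ∈ Metric.closedBall (0 : ℂ) R, z ∈ Metric.ball (0 : ℂ) r := fun z hz =>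
    Metric.closedBall_subset_ball (by linarith) hz
  have hball : ∀ z ∈ Metric.ball (0 : ℂ) r, ∀ᶠ w in 𝓝 z, w ∈ Metric.ball (0 : ℂ) r := fun z hz =>
    Metric.isOpen_ball.mem_nhds hz
  have hcpt : IsCompact (Metric.closedBall (0 : ℂ) R) := isCompact_closedBall _ _
  have hsc : ContinuousOn s (Metric.closedBall (0 : ℂ) R) := fun z hz =>
    (hb z (hsub z hz)).1.continuousAt.continuousWithinAt
  have hvc : ContinuousOn v (Metric.closedBall (0 : ℂ) R) := fun z hz =>
    (hb z (hsub z hz)).2.1.continuousAt.continuousWithinAt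
  obtain ⟨M, hM⟩ := hcpt.exists_bound_of_continuousOn hsc
  obtain ⟨B, hB⟩ := hcpt.exists_bound_of_continuousOn hvc
  have hM0 : 0 ≤ M := (norm_nonneg _).trans (hM 0 (by simp [hR0.le]))
  set κ : ℝ := M ^ 2 * B ^ 2 + 1 with hκ
  have hκ0 : 0 < κ := by positivity
  -- the estimate on the disc, for each power
  have main : ∀ N : ℕ, ∀ w ∈ Metric.closedBall (0 : ℂ) R,
      ‖(w ^ (N + 1))⁻¹ • s w‖ ^ 2 ≤ ((R ^ (N + 1))⁻¹ * M) ^ 2 * Real.exp (κ * R ^ 2) := by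
    intro N w hw
    set U : ℂ → E := fun z => (z ^ (N + 1))⁻¹ • s z with hUdef
    set g : ℂ → ℝ := fun z => ‖U z‖ ^ 2 * Real.exp (κ * ‖z‖ ^ 2) with hg
    have hUs : ∀ z ∈ Metric.ball (0 : ℂ) r, z ≠ 0 → ContDiffAt ℝ ∞ U z := fun z hz hz0 =>
      ((contDiffAt_id.pow _).inv (pow_ne_zero _ hz0)).smul (hb z hz).1
    have hUc : ContinuousOn U (Metric.closedBall (0 : ℂ) R) := by
      intro z hz
      refine ContinuousAt.continuousWithinAt ?_
      by_cases hz0 : z = 0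
      · obtain ⟨u, hu, hsu⟩ := hflat (N + 2)
        have h1 : U =ᶠ[𝓝 0] fun z => z • u z := by
          filter_upwards [hsu] with y hy
          by_cases hy0 : y = 0
          · simp [hUdef, hy0]
          · simp only [hUdef]
            rw [hy, smul_smul]
            congr 1
            field_simp
            ring
        rw [hz0]
        exact (continuousAt_id.smul hu.continuousAt).congr h1.symm
      · exact (hUs z (hsub z hz) hz0).continuousAt
    have hgc : ContinuousOn g (Metric.closedBall (0 : ℂ) R) := by
      refine (hUc.norm.pow 2).mul (Continuous.continuousOn ?_)
      fun_prop
    obtain ⟨z₁, hz₁, hmax⟩ := hcpt.exists_isMaxOn ⟨0, by simp [hR0.le]⟩ hgc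
    have hle : ‖U w‖ ^ 2 ≤ g z₁ := by
      calc ‖U w‖ ^ 2 = ‖U w‖ ^ 2 * 1 := (mul_one _).symm
        _ ≤ g w := by
          simp only [hg]
          gcongr
          exact Real.one_le_exp (by positivity)
        _ ≤ g z₁ := hmax hw
    refine hle.trans ?_
    by_cases hU0 : U z₁ = 0
    · have : g z₁ = 0 := by simp [hg, hU0]
      rw [this]
      positivity
    have hz0 : z₁ ≠ 0 := by
      rintro rfl
      exact hU0 (by simp [hUdef])
    rcases (mem_closedBall_zero_iff.1 hz₁).lt_or_eq with hlt | heqR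
    · exfalso
      have hz₁b := hsub z₁ hz₁
      have hne : ∀ᶠ z in 𝓝 z₁, z ≠ 0 := isOpen_ne.mem_nhds hz0
      refine not_isLocalMax_norm_sq_mul_exp (U := U) (v := v)
        (ρ := fun z => (z ^ (N + 1))⁻¹ * inner ℂ (s z) (s z)) (z := z₁) (K := M ^ 2 * B ^ 2)
        (κ := κ) ?_ ?_ ?_ ?_ ?_ hU0 ?_ (by linarith) ?_
      · filter_upwards [hball z₁ hz₁b, hne] with z h1 h2 using hUs z h1 h2
      · filter_upwards [hball z₁ hz₁b] with z h1 using (hb z h1).2.1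
      · filter_upwards [hball z₁ hz₁b, hne] with z h1 h2
        exact ((contDiffAt_id.pow _).inv (pow_ne_zero _ h2)).mul ((hb z h1).1.inner ℂ (hb z h1).1)
      · filter_upwards [hball z₁ hz₁b, hne] with z h1 h2
        have hi : ContDiffAt ℝ ∞ (fun z : ℂ => (z ^ (N + 1))⁻¹) z :=
          (contDiffAt_id.pow _).inv (pow_ne_zero _ h2)
        have hz : pzb (fun z : ℂ => (z ^ (N + 1))⁻¹) z = 0 :=
          pzb_eq_zero_of_hasDerivAt ((hasDerivAt_pow (N + 1) z).fun_inv (pow_ne_zero _ h2))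
        simp only [hUdef]
        rw [wirt_smul hi.diffAt (hb z h1).1.diffAt, hz, (hb z h1).2.2.1, zero_smul, zero_add,
          smul_neg, smul_smul]
      · filter_upwards [hball z₁ hz₁b] with z h1
        simp only [hUdef, inner_smul_right, (hb z h1).2.2.2, mul_zero]
      · simp only [hUdef, norm_smul, norm_mul]
        rw [inner_self_eq_norm_sq_to_K]
        have h1 := hM z₁ hz₁
        have h2 := hB z₁ hz₁
        simp only [norm_pow, RCLike.norm_ofReal, abs_norm]
        have h3 : ‖s z₁‖ ^ 2 * ‖v z₁‖ ^ 2 ≤ M ^ 2 * B ^ 2 := by gcongr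
        calc _ = (‖s z₁‖ ^ 2 * ‖v z₁‖ ^ 2) * (‖(z₁ ^ (N + 1))⁻¹‖ * ‖s z₁‖) ^ 2 := by ring
          _ ≤ _ := by gcongr
      · refine hmax.isLocalMax ?_
        exact Filter.mem_of_superset (Metric.isOpen_ball.mem_nhds
          (show z₁ ∈ Metric.ball (0 : ℂ) R by simpa using hlt)) Metric.ball_subset_closedBall
    · have h1 : ‖U z₁‖ = (R ^ (N + 1))⁻¹ * ‖s z₁‖ := by
        simp only [hUdef, norm_smul, norm_inv, norm_pow, heqR]
      simp only [hg, h1, heqR]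
      have := hM z₁ hz₁
      gcongr
  have hlim : ∀ w ∈ Metric.ball (0 : ℂ) R, s w = 0 := by
    intro w hw
    by_contra hsw
    have hwR : ‖w‖ < R := by simpa using hw
    have hw' := Metric.ball_subset_closedBall hw
    have h1 : ∀ N : ℕ, ‖s w‖ ^ 2 ≤
        (M ^ 2 * Real.exp (κ * R ^ 2)) * ((‖w‖ / R) ^ 2) ^ (N + 1) := by
      intro N
      by_cases hw0 : w = 0
      · obtain ⟨u, -, hsu⟩ := hflat 1
        have := hsu.self_of_nhds
        rw [hw0, this]
        simp
      have h2 := main N w hw'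
      rw [norm_smul, norm_inv, norm_pow] at h2
      have hwpos : 0 < ‖w‖ := norm_pos_iff.2 hw0
      have h3 : ‖s w‖ ^ 2 = (‖w‖ ^ (N + 1)) ^ 2 * (((‖w‖ ^ (N + 1))⁻¹) * ‖s w‖) ^ 2 := by
        field_simp
      rw [h3]
      calc _ ≤ (‖w‖ ^ (N + 1)) ^ 2 * (((R ^ (N + 1))⁻¹ * M) ^ 2 * Real.exp (κ * R ^ 2)) := by gcongr
        _ = _ := by
          rw [div_eq_mul_inv, ← inv_pow]
          ring_nf
    have hq : (‖w‖ / R) ^ 2 < 1 := by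
      rw [sq_lt_one_iff₀ (by positivity), div_lt_one hR0]
      exact hwR
    have h2 := ((tendsto_pow_atTop_nhds_zero_of_lt_one (by positivity) hq).comp
      (Filter.tendsto_add_atTop_nat 1)).const_mul (M ^ 2 * Real.exp (κ * R ^ 2))
    rw [mul_zero] at h2
    have h3 := ge_of_tendsto' h2 h1
    exact hsw (by simpa using h3)
  filter_upwards [Metric.ball_mem_nhds (0 : ℂ) hR0] with w hw using hlim w hw

/-- The local structure of solutions of `∂s/∂z̄ = -|s|² v` with `v ⟂ s`: they vanish identically near
`0`, or have an isolated zero that is a power of `z` times a nonvanishing smooth function. -/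
theorem eventually_eq_zero_or_exists_pow_smul [CompleteSpace E] (hs : SmoothNear s)
    (hv : SmoothNear v)
    (heq : ∀ᶠ z in 𝓝 (0 : ℂ), pzb s z = -(inner ℂ (s z) (s z) • v z))
    (horth : ∀ᶠ z in 𝓝 (0 : ℂ), inner ℂ (v z) (s z) = 0) :
    (∀ᶠ z in 𝓝 (0 : ℂ), s z = 0) ∨
    ∃ (k : ℕ) (u : ℂ → E), SmoothNear u ∧ u 0 ≠ 0 ∧ ∀ᶠ z in 𝓝 (0 : ℂ), s z = z ^ k • u z := by
  rcases exists_pow_smul_or_forall hs hs.neg hv (by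
    filter_upwards [heq] with z hz
    rw [hz, inner_neg_left, neg_smul]) with h | h
  · exact Or.inr h
  · exact Or.inl (eventually_eq_zero_of_flat hs hv heq horth h)

end UniqueContinuation

/-! ### Algebra of the vector product -/

section Cross

theorem toOct_coords {R : Type*} [CommRing R] (v : EuclideanSpace R (Fin 7)) :
    (toOct v).1.re = 0 ∧ (toOct v).1.imI = v 0 ∧ (toOct v).1.imJ = v 1 ∧ (toOct v).1.imK = v 2 ∧
    (toOct v).2.re = v 3 ∧ (toOct v).2.imI = v 4 ∧ (toOct v).2.imJ = v 5 ∧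
    (toOct v).2.imK = v 6 := ⟨rfl, rfl, rfl, rfl, rfl, rfl, rfl, rfl⟩

/-- The vector product in coordinates. -/
theorem cross_eq {R : Type*} [CommRing R] (v w : EuclideanSpace R (Fin 7)) :
    cross v w = WithLp.toLp 2 ![
      v 1 * w 2 - v 2 * w 1 + v 3 * w 4 - v 4 * w 3 + v 6 * w 5 - v 5 * w 6,
      v 2 * w 0 - v 0 * w 2 + v 3 * w 5 - v 5 * w 3 + v 4 * w 6 - v 6 * w 4,
      v 0 * w 1 - v 1 * w 0 + v 3 * w 6 - v 6 * w 3 + v 5 * w 4 - v 4 * w 5,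
      v 4 * w 0 - v 0 * w 4 + v 5 * w 1 - v 1 * w 5 + v 6 * w 2 - v 2 * w 6,
      v 0 * w 3 - v 3 * w 0 + v 2 * w 5 - v 5 * w 2 + v 6 * w 1 - v 1 * w 6,
      v 1 * w 3 - v 3 * w 1 + v 4 * w 2 - v 2 * w 4 + v 0 * w 6 - v 6 * w 0,
      v 2 * w 3 - v 3 * w 2 + v 1 * w 4 - v 4 * w 1 + v 5 * w 0 - v 0 * w 5] := by
  obtain ⟨a0, a1, a2, a3, a4, a5, a6, a7⟩ := toOct_coords v
  obtain ⟨b0, b1, b2, b3, b4, b5, b6, b7⟩ := toOct_coords w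
  simp only [cross, octIm, octMul, Quaternion.imI_sub, Quaternion.imJ_sub,
    Quaternion.imK_sub, Quaternion.re_add, Quaternion.imI_add, Quaternion.imJ_add,
    Quaternion.imK_add, Quaternion.re_mul, Quaternion.imI_mul, Quaternion.imJ_mul,
    Quaternion.imK_mul, Quaternion.re_star, Quaternion.imI_star, Quaternion.imJ_star,
    Quaternion.imK_star, a0, a1, a2, a3, a4, a5, a6, a7, b0, b1, b2, b3, b4, b5, b6, b7]
  congr 2
  · ring
  · congr 1
    · ring
    · congr 1
      · ring
      · congr 1
        · ring
        · congr 1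
          · ring
          · congr 1
            · ring
            · congr 1
              ring

theorem inner_conjVec (u w : C7) : inner ℂ (conjVec u) w = ∑ k, u k * w k := by
  simp [PiLp.inner_apply, conjVec, mul_comm]

theorem conjVec_conjVec (u : C7) : conjVec (conjVec u) = u := by
  ext k; simp [conjVec]

theorem inner_conjVec_conjVec (u w : C7) :
    inner ℂ (conjVec u) (conjVec w) = (starRingEnd ℂ) (inner ℂ u w) := by
  simp [PiLp.inner_apply, conjVec]

theorem conjVec_smul (c : ℂ) (u : C7) : conjVec (c • u) = (starRingEnd ℂ) c • conjVec u := by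
  ext k; simp [conjVec]

theorem conjVec_add (u w : C7) : conjVec (u + w) = conjVec u + conjVec w := by
  ext k; simp [conjVec]

theorem conjVec_eq_zero {u : C7} : conjVec u = 0 ↔ u = 0 := by
  constructor
  · intro h
    rw [← conjVec_conjVec u, h]
    ext k; simp [conjVec]
  · rintro rfl
    ext k; simp [conjVec]

theorem cross_add_left (a b c : C7) : cross (a + b) c = cross a c + cross b c := by
  simp only [cross_eq]
  ext k
  fin_cases k <;> simp <;> ring

theorem cross_smul_left (r : ℂ) (b c : C7) : cross (r • b) c = r • cross b c := by
  simp only [cross_eq]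
  ext k
  fin_cases k <;> simp <;> ring

theorem cross_anticomm (a b : C7) :
    cross a b = - cross b a := by
  simp only [cross_eq]
  ext k
  fin_cases k <;> simp <;> ring

theorem cross_add_right (a b c : C7) : cross a (b + c) = cross a b + cross a c := by
  rw [cross_anticomm, cross_add_left, neg_add, ← cross_anticomm, ← cross_anticomm]

theorem cross_smul_right (r : ℂ) (a b : C7) : cross a (r • b) = r • cross a b := by
  rw [cross_anticomm, cross_smul_left, ← smul_neg, ← cross_anticomm]

theorem cross_self (a : C7) : cross a a = 0 := by
  simp only [cross_eq]
  ext k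
  fin_cases k <;> simp <;> ring

theorem cross_conjVec (a b : C7) : cross (conjVec a) (conjVec b) = conjVec (cross a b) := by
  simp only [cross_eq, conjVec]
  ext k
  fin_cases k <;> simp

theorem cross_complexify (a b : R7) :
    cross (complexify a) (complexify b) = complexify (cross a b) := by
  simp only [cross_eq, complexify]
  ext k
  fin_cases k <;> simp

/-- The polarization of `a × (a × c) = (a, c) a - (a, a) c`, for the bilinear form
`(u, w) = ⟨ū, w⟩`. -/
theorem cross_cross_add (a b c : C7) :
    cross a (cross b c) + cross b (cross a c) = inner ℂ (conjVec a) c • b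
      + inner ℂ (conjVec b) c • a - (2 * inner ℂ (conjVec a) b) • c := by
  simp only [cross_eq, inner_conjVec, Fin.sum_univ_seven]
  ext k
  fin_cases k <;> simp <;> ring

/-- `a ×` is skew for the bilinear form. -/
theorem inner_conjVec_cross (a b c : C7) :
    inner ℂ (conjVec (cross a b)) c = - inner ℂ (conjVec b) (cross a c) := by
  simp only [cross_eq, inner_conjVec, Fin.sum_univ_seven]
  simp
  ring

theorem conjVec_complexify (v : R7) : conjVec (complexify v) = complexify v := by
  ext k; simp [conjVec, complexify]

theorem inner_complexify (v w : R7) :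
    inner ℂ (complexify v) (complexify w) = ((inner ℝ v w : ℝ) : ℂ) := by
  simp [PiLp.inner_apply, complexify]

/-- `v ↦ complexify v` as a continuous linear map. -/
def complexifyL : R7 →L[ℝ] C7 := LinearMap.toContinuousLinearMap
  { toFun := complexify
    map_add' := fun u w => by ext k; simp [complexify]
    map_smul' := fun r u => by ext k; simp [complexify] }

@[simp] theorem complexifyL_apply (v : R7) : complexifyL v = complexify v := rfl

theorem complexify_injective : Function.Injective complexify := by
  intro u w h
  ext k
  have := congrArg (fun x : C7 => x k) h
  simpa [complexify] using this

/-- Complex conjugation as a continuous real-linear map. -/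
def conjL : C7 →L[ℝ] C7 := LinearMap.toContinuousLinearMap
  { toFun := conjVec
    map_add' := conjVec_add
    map_smul' := fun r u => by ext k; simp [conjVec] }

@[simp] theorem conjL_apply (v : C7) : conjL v = conjVec v := rfl

/-- The vector product as a continuous real-bilinear map. -/
def crossL : C7 →L[ℝ] C7 →L[ℝ] C7 := LinearMap.toContinuousLinearMap
  (LinearMap.toContinuousLinearMap.toLinearMap ∘ₗ LinearMap.mk₂ ℝ cross cross_add_left
    (fun r a b => by
      rw [show r • a = (r : ℂ) • a from (Complex.coe_smul r a).symm, cross_smul_left,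
        Complex.coe_smul])
    cross_add_right
    (fun r a b => by
      rw [show r • b = (r : ℂ) • b from (Complex.coe_smul r b).symm, cross_smul_right,
        Complex.coe_smul]))

end Cross

/-! ### Vectors of type `(1,0)` -/

section TypeOneZero

variable {F u w : C7}

/-- A vector of type `(1, 0)` is orthogonal to `F`. -/
theorem inner_eq_zero_of_type (hF : conjVec F = F) (hu : cross F u = Complex.I • u) :
    inner ℂ F u = 0 := by
  have h1 := inner_conjVec_cross F F u
  rw [cross_self, hu, inner_smul_right, hF] at h1
  have h2 : inner ℂ (conjVec (0 : C7)) u = 0 := by rw [conjVec_eq_zero.2 rfl, inner_zero_left]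
  rw [h2] at h1
  have := mul_eq_zero.1 (neg_eq_zero.1 h1.symm)
  simpa using this

/-- The `(1, 0)`-vectors are isotropic for the bilinear form. -/
theorem inner_conjVec_eq_zero_of_type (hu : cross F u = Complex.I • u)
    (hw : cross F w = Complex.I • w) : inner ℂ (conjVec u) w = 0 := by
  have h1 := inner_conjVec_cross F u w
  rw [hu, hw, conjVec_smul, inner_smul_left, inner_smul_right] at h1
  simp only [Complex.conj_conj] at h1
  have h2 : (2 * Complex.I) * inner ℂ (conjVec u) w = 0 := by linear_combination h1
  simpa using h2

theorem cross_conjVec_of_type (hF : conjVec F = F) (hw : cross F w = Complex.I • w) :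
    cross F (conjVec w) = -(Complex.I • conjVec w) := by
  have := cross_conjVec F w
  rw [hF, hw, conjVec_smul] at this
  rw [this]
  simp

/-- The product of two `(1, 0)`-vectors is of type `(0, 1)`. -/
theorem cross_cross_of_type (hF : conjVec F = F) (hu : cross F u = Complex.I • u)
    (hw : cross F w = Complex.I • w) : cross F (cross u w) = -(Complex.I • cross u w) := by
  have h := cross_cross_add F u w
  rw [hw, cross_smul_right, hF, inner_eq_zero_of_type hF hw, inner_eq_zero_of_type hF hu,
    inner_conjVec_eq_zero_of_type hu hw] at h
  simp only [zero_smul, add_zero, mul_zero, sub_zero] at h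
  exact eq_neg_of_add_eq_zero_left h

/-- The product of a `(1, 0)`-vector and a `(0, 1)`-vector is a multiple of `F`. -/
theorem cross_conjVec_eq_smul (hF : conjVec F = F) (hu : cross F u = Complex.I • u)
    (hw : cross F w = Complex.I • w) :
    cross u (conjVec w) = (Complex.I * inner ℂ w u) • F := by
  have hFu := inner_eq_zero_of_type hF hu
  have hFw := inner_eq_zero_of_type hF hw
  have hFw' : inner ℂ F (conjVec w) = 0 := by
    rw [← hF, inner_conjVec_conjVec, hFw, map_zero]
  have h1 := cross_cross_add F u (conjVec w)
  have h2 := cross_cross_add F (conjVec w) u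
  rw [cross_conjVec_of_type hF hw, hF, hFw', hFu, inner_conjVec_conjVec, inner_conj_symm,
    ← neg_smul, cross_smul_right] at h1
  rw [hu, hF, hFw', hFu, conjVec_conjVec, cross_smul_right, cross_anticomm (conjVec w) u,
    ← neg_one_smul ℂ (cross u (conjVec w)), cross_smul_right] at h2
  have h3 : (2 * Complex.I) • cross u (conjVec w) = (-2 * inner ℂ w u) • F := by
    have : cross F (cross u (conjVec w)) = inner ℂ w u • F + Complex.I • cross u (conjVec w) := by
      linear_combination (norm := module) h1
    rw [this] at h2
    linear_combination (norm := module) (-1 : ℂ) • h2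
  have h4 : cross u (conjVec w) = (2 * Complex.I)⁻¹ • ((-2 * inner ℂ w u) • F) := by
    rw [← h3, smul_smul, inv_mul_cancel₀ (by simp), one_smul]
  rw [h4, smul_smul]
  congr 1
  have := Complex.I_sq
  field_simp
  linear_combination (-inner ℂ w u) * Complex.I_sq

/-- `ū₁ × (u₁ × u₂) = -2|u₁|² u₂` for orthogonal `(1, 0)`-vectors. -/
theorem conjVec_cross_cross (hF : conjVec F = F) (hu : cross F u = Complex.I • u)
    (hw : cross F w = Complex.I • w) (huw : inner ℂ u w = 0) :
    cross (conjVec u) (cross u w) = (-2 * inner ℂ u u) • w := by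
  have h := cross_cross_add (conjVec u) u w
  have h1 : cross (conjVec u) w = 0 := by
    rw [cross_anticomm, cross_conjVec_eq_smul hF hw hu, huw]
    simp
  have h0 : cross u (0 : C7) = 0 := by
    simpa using cross_smul_right 0 u 0
  rw [h1, h0, conjVec_conjVec, huw, inner_conjVec_eq_zero_of_type hu hw] at h
  rw [add_zero, zero_smul, zero_smul] at h
  rw [h]
  module

theorem cross_ne_zero_of_type (hF : conjVec F = F) (hu : cross F u = Complex.I • u)
    (hw : cross F w = Complex.I • w) (huw : inner ℂ u w = 0) (hu0 : u ≠ 0) (hw0 : w ≠ 0) :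
    cross u w ≠ 0 := by
  intro h
  have h1 := conjVec_cross_cross hF hu hw huw
  have h0 : cross (conjVec u) (0 : C7) = 0 := by
    simpa using cross_smul_right 0 (conjVec u) 0
  rw [h, h0] at h1
  have := smul_eq_zero.1 h1.symm
  simp [hu0, hw0] at this

end TypeOneZero

/-! ### The flag of an adapted frame -/

section Flag

/-- `F` is a real nonzero vector and `u`, `w` are nonzero orthogonal vectors of type `(1, 0)` for
`F ×`. -/
structure IsAdapted (F u w : C7) : Prop where
  conj : conjVec F = F
  ne_zero : F ≠ 0
  type_left : cross F u = Complex.I • u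
  type_right : cross F w = Complex.I • w
  orth : inner ℂ u w = 0
  left_ne_zero : u ≠ 0
  right_ne_zero : w ≠ 0

/-- The seven vectors `e₋₃, …, e₃` with `e₀ = F`, `e₁ = u`, `e₂ = w`, `e₃ = u × w` and `e₋ᵢ = ēᵢ`, and
`eᵢ = 0` for `|i| > 3`. -/
def legVec (F u w : C7) : ℤ → C7
  | 0 => F
  | 1 => u
  | 2 => w
  | 3 => cross u w
  | -1 => conjVec u
  | -2 => conjVec w
  | -3 => conjVec (cross u w)
  | _ => 0

variable {F u w : C7}

theorem legVec_eq_zero {i : ℤ} (hi : 3 < |i|) : legVec F u w i = 0 := by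
  unfold legVec
  split <;> first | rfl | (norm_num at hi)

theorem legVec_neg (hF : conjVec F = F) (i : ℤ) :
    legVec F u w (-i) = conjVec (legVec F u w i) := by
  by_cases hi : 3 < |i|
  · rw [legVec_eq_zero hi, legVec_eq_zero (by rwa [abs_neg]), conjVec_eq_zero.2 rfl]
  · obtain ⟨h1, h2⟩ := abs_le.1 (not_lt.1 hi)
    interval_cases i <;> simp [legVec, conjVec_conjVec, hF]

theorem conjVec_mem_span_singleton {x y : C7} (h : x ∈ Submodule.span ℂ {y}) :
    conjVec x ∈ Submodule.span ℂ {conjVec y} := by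
  obtain ⟨c, rfl⟩ := Submodule.mem_span_singleton.1 h
  rw [conjVec_smul]
  exact Submodule.smul_mem _ _ (Submodule.mem_span_singleton_self _)

/-- The conjugate of `u × w` is again of type `(1, 0)`. -/
theorem IsAdapted.type_conj_cross (h : IsAdapted F u w) :
    cross F (conjVec (cross u w)) = Complex.I • conjVec (cross u w) := by
  have h1 := cross_cross_of_type h.conj h.type_left h.type_right
  have h2 := cross_conjVec F (cross u w)
  rw [h.conj, h1, ← neg_smul, conjVec_smul] at h2
  rw [h2]
  simp

theorem cross_cross_eq_zero_of_type (hu : cross F u = Complex.I • u)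
    (hw : cross F w = Complex.I • w) : cross u (cross u w) = 0 := by
  have h := cross_cross_add u u w
  rw [inner_conjVec_eq_zero_of_type hu hw, inner_conjVec_eq_zero_of_type hu hu] at h
  simp only [zero_smul, mul_zero, sub_zero, ← two_smul ℂ] at h
  simpa using h

theorem IsAdapted.symm (h : IsAdapted F u w) : IsAdapted F w u :=
  ⟨h.conj, h.ne_zero, h.type_right, h.type_left, by rw [← inner_conj_symm, h.orth, map_zero],
    h.right_ne_zero, h.left_ne_zero⟩

theorem IsAdapted.legVec_ne_zero (h : IsAdapted F u w) {i : ℤ} (hi : |i| ≤ 3) :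
    legVec F u w i ≠ 0 := by
  have hc := cross_ne_zero_of_type h.conj h.type_left h.type_right h.orth h.left_ne_zero
    h.right_ne_zero
  obtain ⟨h1, h2⟩ := abs_le.1 hi
  interval_cases i <;>
    simp [legVec, conjVec_eq_zero, h.ne_zero, h.left_ne_zero, h.right_ne_zero, hc]

/-- A symmetric relation on `{-3, …, 3}` invariant under negation is determined by twelve pairs. -/
theorem forall_of_symm_of_neg {P : ℤ → ℤ → Prop} (swap : ∀ i j, P i j → P j i)
    (neg : ∀ i j, P i j → P (-i) (-j)) (far : ∀ i j, 3 < |i| → P i j)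
    (p10 : P 1 0) (p20 : P 2 0) (p30 : P 3 0) (p1n1 : P 1 (-1)) (p21 : P 2 1) (p2n1 : P 2 (-1))
    (p2n2 : P 2 (-2)) (p31 : P 3 1) (p3n1 : P 3 (-1)) (p32 : P 3 2) (p3n2 : P 3 (-2))
    (p3n3 : P 3 (-3)) {i j : ℤ} (hij : i ≠ j) : P i j := by
  have base : ∀ a b : ℤ, 0 ≤ a → a ≤ 3 → |b| ≤ a → a ≠ b → P a b := by
    intro a b ha1 ha2 hab hne
    obtain ⟨hb3, hb4⟩ := abs_le.1 hab
    interval_cases a <;> interval_cases b <;> first | exact absurd rfl hne | assumption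
  by_cases hi : 3 < |i|
  · exact far i j hi
  by_cases hj : 3 < |j|
  · exact swap _ _ (far j i hj)
  obtain ⟨h1, h2⟩ := abs_le.1 (not_lt.1 hi)
  obtain ⟨h3, h4⟩ := abs_le.1 (not_lt.1 hj)
  have key : ∀ i j : ℤ, -3 ≤ i → i ≤ 3 → |j| ≤ |i| → i ≠ j → P i j := by
    intro i j h1 h2 hji hne
    rcases le_total 0 i with h0 | h0
    · rw [abs_of_nonneg h0] at hji
      exact base i j h0 h2 hji hne
    · rw [abs_of_nonpos h0] at hji
      have := neg _ _ (base (-i) (-j) (by omega) (by omega) (by rwa [abs_neg]) (by omega))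
      rwa [neg_neg, neg_neg] at this
  rcases le_total |j| |i| with hji | hij'
  · exact key i j h1 h2 hji hij
  · exact swap _ _ (key j i h3 h4 hij' hij.symm)

theorem IsAdapted.cross_legVec_mem (h : IsAdapted F u w) (i j : ℤ) :
    cross (legVec F u w i) (legVec F u w j) ∈ Submodule.span ℂ {legVec F u w (i + j)} := by
  obtain ⟨P, hP⟩ : ∃ P : ℤ → ℤ → Prop, ∀ i j, P i j ↔
      cross (legVec F u w i) (legVec F u w j) ∈ Submodule.span ℂ {legVec F u w (i + j)} :=
    ⟨_, fun _ _ => Iff.rfl⟩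
  have hz : ∀ x : C7, cross x 0 = 0 := fun x => by simpa using cross_smul_right 0 x 0
  have swap : ∀ i j, P i j → P j i := fun i j hij => by
    simp only [hP] at hij ⊢
    rw [cross_anticomm, add_comm]
    exact Submodule.neg_mem _ hij
  have conj : ∀ i j, P i j → P (-i) (-j) := fun i j hij => by
    simp only [hP] at hij ⊢
    rw [← neg_add, legVec_neg h.conj, legVec_neg h.conj, legVec_neg h.conj, cross_conjVec]
    exact conjVec_mem_span_singleton hij
  have self : ∀ i, P i i := fun i => by
    simp only [hP, cross_self]
    exact Submodule.zero_mem _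
  have hsm : ∀ (c : ℂ) (x : C7), c • x ∈ Submodule.span ℂ {x} := fun c x =>
    Submodule.smul_mem _ _ (Submodule.mem_span_singleton_self _)
  have p01 : P 0 1 := by
    rw [hP]
    change cross F u ∈ Submodule.span ℂ {u}
    rw [h.type_left]; exact hsm _ _
  have p02 : P 0 2 := by
    rw [hP]
    change cross F w ∈ Submodule.span ℂ {w}
    rw [h.type_right]; exact hsm _ _
  have p03 : P 0 3 := by
    rw [hP]
    change cross F (cross u w) ∈ Submodule.span ℂ {cross u w}
    rw [cross_cross_of_type h.conj h.type_left h.type_right]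
    exact Submodule.neg_mem _ (hsm _ _)
  have p12 : P 1 2 := (hP _ _).2 <| Submodule.mem_span_singleton_self _
  have p13 : P 1 3 := by
    rw [hP]
    change cross u (cross u w) ∈ _
    rw [cross_cross_eq_zero_of_type h.type_left h.type_right]; exact Submodule.zero_mem _
  have p23 : P 2 3 := by
    rw [hP]
    change cross w (cross u w) ∈ _
    rw [cross_anticomm u w, ← neg_one_smul ℂ, cross_smul_right,
      cross_cross_eq_zero_of_type h.type_right h.type_left, smul_zero]
    exact Submodule.zero_mem _
  have p1n1 : P 1 (-1) := by
    rw [hP]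
    change cross u (conjVec u) ∈ Submodule.span ℂ {F}
    rw [cross_conjVec_eq_smul h.conj h.type_left h.type_left]; exact hsm _ _
  have p1n2 : P 1 (-2) := by
    rw [hP]
    change cross u (conjVec w) ∈ Submodule.span ℂ {conjVec u}
    rw [cross_conjVec_eq_smul h.conj h.type_left h.type_right, h.symm.orth, mul_zero, zero_smul]
    exact Submodule.zero_mem _
  have p2n2 : P 2 (-2) := by
    rw [hP]
    change cross w (conjVec w) ∈ Submodule.span ℂ {F}
    rw [cross_conjVec_eq_smul h.conj h.type_right h.type_right]; exact hsm _ _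
  have p3n1 : P 3 (-1) := by
    rw [hP]
    change cross (cross u w) (conjVec u) ∈ Submodule.span ℂ {w}
    rw [cross_anticomm, conjVec_cross_cross h.conj h.type_left h.type_right h.orth]
    exact Submodule.neg_mem _ (hsm _ _)
  have p3n2 : P 3 (-2) := by
    rw [hP]
    change cross (cross u w) (conjVec w) ∈ Submodule.span ℂ {u}
    rw [cross_anticomm, cross_anticomm u w, ← neg_one_smul ℂ (cross w u), cross_smul_right,
      conjVec_cross_cross h.conj h.type_right h.type_left h.symm.orth, smul_smul]
    exact Submodule.neg_mem _ (hsm _ _)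
  have p3n3 : P (-3) 3 := by
    have h1 := cross_conjVec_eq_smul h.conj h.type_conj_cross h.type_conj_cross
    rw [conjVec_conjVec] at h1
    rw [hP]
    change cross (conjVec (cross u w)) (cross u w) ∈ Submodule.span ℂ {F}
    rw [h1]; exact hsm _ _
  rw [← hP]
  by_cases hij : i = j
  · rw [hij]; exact self j
  refine forall_of_symm_of_neg swap conj (fun i j hi => ?_) (swap _ _ p01) (swap _ _ p02)
    (swap _ _ p03) p1n1 (swap _ _ p12) (swap _ _ (conj _ _ p1n2)) p2n2 (swap _ _ p13) p3n1
    (swap _ _ p23) p3n2 (swap _ _ p3n3) hij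
  simp only [hP]
  rw [legVec_eq_zero hi, cross_anticomm, hz, neg_zero]
  exact Submodule.zero_mem _

theorem IsAdapted.inner_legVec (h : IsAdapted F u w) {i j : ℤ} (hij : i ≠ j) :
    inner ℂ (legVec F u w i) (legVec F u w j) = 0 := by
  obtain ⟨P, hP⟩ : ∃ P : ℤ → ℤ → Prop, ∀ i j, P i j ↔
      inner ℂ (legVec F u w i) (legVec F u w j) = 0 := ⟨_, fun _ _ => Iff.rfl⟩
  have swap : ∀ i j, P i j → P j i := fun i j hij => by
    simp only [hP] at hij ⊢
    rw [← inner_conj_symm, hij, map_zero]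
  have conj : ∀ i j, P i j → P (-i) (-j) := fun i j hij => by
    simp only [hP] at hij ⊢
    rw [legVec_neg h.conj, legVec_neg h.conj, inner_conjVec_conjVec, hij, map_zero]
  have hz : ∀ x : C7, inner ℂ (conjVec x) (0 : C7) = 0 := fun x => inner_zero_right _
  -- the three legs of type `(1, 0)`
  have ty : ∀ k : ℤ, k = 1 ∨ k = 2 ∨ k = -3 →
      cross F (legVec F u w k) = Complex.I • legVec F u w k := by
    rintro k (rfl | rfl | rfl)
    exacts [h.type_left, h.type_right, h.type_conj_cross]
  have t0 : ∀ k : ℤ, k = 1 ∨ k = 2 ∨ k = -3 → P 0 k := fun k hk =>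
    (hP _ _).2 <| inner_eq_zero_of_type h.conj (ty k hk)
  have tc : ∀ k l : ℤ, (k = 1 ∨ k = 2 ∨ k = -3) → (l = 1 ∨ l = 2 ∨ l = -3) → P (-k) l :=
    fun k l hk hl => by
      simp only [hP]
      rw [legVec_neg h.conj]
      exact inner_conjVec_eq_zero_of_type (ty k hk) (ty l hl)
  have p12 : P 1 2 := (hP _ _).2 h.orth
  have p3n1 : P 3 (-1) := by
    rw [hP]
    change inner ℂ (cross u w) (conjVec u) = 0
    have := inner_conjVec_cross u w u
    rw [cross_self, hz, neg_zero] at this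
    rw [← conjVec_conjVec (cross u w), inner_conjVec_conjVec, this, map_zero]
  have p3n2 : P 3 (-2) := by
    rw [hP]
    change inner ℂ (cross u w) (conjVec w) = 0
    have := inner_conjVec_cross w u w
    rw [cross_self, hz, neg_zero, cross_anticomm, ← neg_one_smul ℂ, conjVec_smul,
      inner_smul_left] at this
    simp at this
    rw [← conjVec_conjVec (cross u w), inner_conjVec_conjVec, this, map_zero]
  rw [← hP]
  refine forall_of_symm_of_neg swap conj (fun i j hi => ?_) (swap _ _ (t0 1 (by norm_num)))
    (swap _ _ (t0 2 (by norm_num))) 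
    (swap _ _ (by simpa using conj _ _ (t0 (-3) (by norm_num))))
    (swap _ _ (tc 1 1 (by norm_num) (by norm_num))) (swap _ _ p12)
    (swap _ _ (tc 1 2 (by norm_num) (by norm_num))) (swap _ _ (tc 2 2 (by norm_num) (by norm_num)))
    
    (by simpa using tc (-3) 1 (by norm_num) (by norm_num)) p3n1 
    (by simpa using tc (-3) 2 (by norm_num) (by norm_num)) p3n2
    
    (by simpa using tc (-3) (-3) (by norm_num) (by norm_num)) hij
  simp only [hP]
  rw [legVec_eq_zero hi, inner_zero_left]

/-- The lines spanned by an adapted frame form a `G₂`-flag. -/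
theorem IsAdapted.isG2Flag (h : IsAdapted F u w) :
    IsG2Flag fun i => Submodule.span ℂ {legVec F u w i} where
  finrank_leg i hi := finrank_span_singleton (h.legVec_ne_zero hi)
  leg_eq_bot i hi := by rw [legVec_eq_zero hi, Submodule.span_singleton_eq_bot]
  orthogonal i j hij := by
    rw [Submodule.isOrtho_span]
    rintro x rfl y rfl
    exact h.inner_legVec hij
  iSup_eq_top := by
    have hli : LinearIndependent ℂ (fun k : Fin 7 => legVec F u w ((k : ℕ) - 3 : ℤ)) := by
      refine linearIndependent_of_ne_zero_of_inner_eq_zero (fun k => h.legVec_ne_zero ?_) ?_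
      · rw [abs_le]
        have := k.2
        omega
      · intro k l hkl
        refine h.inner_legVec ?_
        intro h'
        apply hkl
        ext
        omega
    have hspan := hli.span_eq_top_of_card_eq_finrank (by simp)
    rw [eq_top_iff, ← hspan, Submodule.span_le]
    rintro _ ⟨k, rfl⟩
    exact Submodule.mem_iSup_of_mem (p := fun i => Submodule.span ℂ {legVec F u w i}) _
      (Submodule.mem_span_singleton_self _)
  conj_mem i v := by
    constructor
    · intro hv
      have := conjVec_mem_span_singleton hv
      rwa [legVec_neg h.conj, conjVec_conjVec] at this
    · intro hv
      have := conjVec_mem_span_singleton hv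
      rwa [conjVec_conjVec, ← legVec_neg h.conj] at this
  cross_mem i j x y hx hy := by
    obtain ⟨a, rfl⟩ := Submodule.mem_span_singleton.1 hx
    obtain ⟨b, rfl⟩ := Submodule.mem_span_singleton.1 hy
    rw [cross_smul_left, cross_smul_right]
    exact Submodule.smul_mem _ _ (Submodule.smul_mem _ _ (h.cross_legVec_mem i j))

end Flag

/-! ### Local parameters on a Riemann surface -/

section Param

variable {M : Type*} [TopologicalSpace M] [ChartedSpace ℂ M]

/-- The local parametrization of `M` by the preferred chart at `p`, translated so that `0` goes
to `p`. -/
def param (p : M) (z : ℂ) : M := (chartAt ℂ p).symm (z + chartAt ℂ p p)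

/-- The local coordinate inverse to `param p`. -/
def coord (p q : M) : ℂ := chartAt ℂ p q - chartAt ℂ p p

@[simp] theorem param_zero (p : M) : param p 0 = p := by
  simp [param]

theorem continuous_add_chart (p : M) : Filter.Tendsto (fun z : ℂ => z + chartAt ℂ p p) (𝓝 0)
    (𝓝 (chartAt ℂ p p)) := by
  simpa using (continuous_add_const (chartAt ℂ p p)).tendsto (0 : ℂ)

theorem eventually_mem_target (p : M) :
    ∀ᶠ z in 𝓝 (0 : ℂ), z + chartAt ℂ p p ∈ (chartAt ℂ p).target :=
  (continuous_add_chart p).eventually ((chartAt ℂ p).open_target.mem_nhds (mem_chart_target ℂ p))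

theorem map_param_nhds (p : M) : Filter.map (param p) (𝓝 0) = 𝓝 p := by
  have h1 : Filter.map (fun z : ℂ => z + chartAt ℂ p p) (𝓝 0) = 𝓝 (chartAt ℂ p p) := by
    simp
  have h2 := (chartAt ℂ p).symm.map_nhds_eq (mem_chart_target ℂ p)
  rw [(chartAt ℂ p).left_inv (mem_chart_source ℂ p)] at h2
  rw [show param p = (chartAt ℂ p).symm ∘ fun z : ℂ => z + chartAt ℂ p p from rfl,
    ← Filter.map_map, h1]
  exact h2

theorem eventually_nhds_iff_param {p : M} {P : M → Prop} :
    (∀ᶠ q in 𝓝 p, P q) ↔ ∀ᶠ z in 𝓝 (0 : ℂ), P (param p z) := by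
  rw [← map_param_nhds p, Filter.eventually_map]

theorem eventually_coord_param (p : M) : ∀ᶠ z in 𝓝 (0 : ℂ), coord p (param p z) = z := by
  filter_upwards [eventually_mem_target p] with z hz
  simp [coord, param, (chartAt ℂ p).right_inv hz]

theorem eventually_param_mem_source (p : M) :
    ∀ᶠ z in 𝓝 (0 : ℂ), param p z ∈ (chartAt ℂ p).source := by
  filter_upwards [eventually_mem_target p] with z hz using (chartAt ℂ p).map_target hz

theorem eventually_param_eq_iff (p : M) : ∀ᶠ z in 𝓝 (0 : ℂ), (param p z = p ↔ z = 0) := by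
  filter_upwards [eventually_coord_param p] with z hz
  constructor
  · intro h
    rw [← hz, h]
    simp [coord]
  · rintro rfl
    simp

theorem eventually_punctured_iff_param {p : M} {P : M → Prop} :
    (∀ᶠ q in 𝓝[≠] p, P q) ↔ ∀ᶠ z in 𝓝 (0 : ℂ), z ≠ 0 → P (param p z) := by
  rw [eventually_nhdsWithin_iff, eventually_nhds_iff_param]
  constructor
  · intro h
    filter_upwards [h, eventually_param_eq_iff p] with z h1 h2 hz
    exact h1 fun h => hz (h2.1 h)
  · intro h
    filter_upwards [h, eventually_param_eq_iff p] with z h1 h2 hz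
    exact h1 fun h => hz (h2.2 h)

theorem neBot_punctured_nhds (p : M) : (𝓝[≠] p).NeBot := by
  refine ⟨fun h => ?_⟩
  have h1 : ∀ᶠ q in 𝓝[≠] p, False := by rw [h]; exact Filter.eventually_bot
  rw [eventually_punctured_iff_param] at h1
  have h2 : ∀ᶠ z in 𝓝[≠] (0 : ℂ), False := eventually_nhdsWithin_iff.2 h1
  rw [Filter.eventually_false_iff_eq_bot] at h2
  exact (NormedField.nhdsNE_neBot (0 : ℂ)).ne h2

theorem continuousAt_coord {p q : M} (hq : q ∈ (chartAt ℂ p).source) :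
    ContinuousAt (coord p) q :=
  ((chartAt ℂ p).continuousAt hq).sub continuousAt_const

/-- A property holding near `p` except at `p` holds, at every point near `p`, in a punctured
neighbourhood of that point. -/
theorem eventually_eventually_punctured {X : Type*} [TopologicalSpace X] [T1Space X] {p : X}
    {P : X → Prop} (h : ∀ᶠ q in 𝓝[≠] p, P q) : ∀ᶠ q in 𝓝 p, ∀ᶠ q' in 𝓝[≠] q, P q' := by
  rw [eventually_nhdsWithin_iff] at h
  filter_upwards [h.eventually_nhds] with q hq
  by_cases hqp : q = p
  · subst hqp
    exact eventually_nhdsWithin_iff.2 hq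
  · have h2 : ∀ᶠ q' in 𝓝 q, q' ≠ p := isOpen_ne.mem_nhds hqp
    exact Filter.Eventually.filter_mono nhdsWithin_le_nhds (by
      filter_upwards [hq, h2] with q' h3 h4 using h3 h4)

variable [IsManifold 𝓘(ℂ, ℂ) ω M]

variable (M) in
/-- A Riemann surface is a smooth real surface. -/
theorem isManifold_real : IsManifold 𝓘(ℝ, ℂ) ∞ M := by
  refine isManifold_of_contDiffOn _ _ _ fun e e' he he' => ?_
  have h := (contDiffGroupoid ω 𝓘(ℂ, ℂ)).compatible he he'
  rw [contDiffGroupoid, mem_groupoid_of_pregroupoid] at h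
  have h1 : ContDiffOn ℂ ω (𝓘(ℂ, ℂ) ∘ (e.symm ≫ₕ e') ∘ 𝓘(ℂ, ℂ).symm)
    (𝓘(ℂ, ℂ).symm ⁻¹' (e.symm ≫ₕ e').source ∩ Set.range 𝓘(ℂ, ℂ)) := h.1
  exact (h1.restrict_scalars ℝ).of_le le_top

theorem smoothNear_comp_param {W : Type*} [NormedAddCommGroup W] [NormedSpace ℝ W] {G : M → W}
    (hG : ContMDiff 𝓘(ℝ, ℂ) 𝓘(ℝ, W) ∞ G) (p : M) : SmoothNear fun z => G (param p z) := by
  have := isManifold_real M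
  filter_upwards [eventually_mem_target p] with z hz
  have h1 : ContMDiffAt 𝓘(ℝ, ℂ) 𝓘(ℝ, ℂ) ∞ (chartAt ℂ p).symm (z + chartAt ℂ p p) :=
    contMDiffAt_symm_of_mem_maximalAtlas (IsManifold.chart_mem_maximalAtlas p) hz
  have h2 : ContMDiffAt 𝓘(ℝ, ℂ) 𝓘(ℝ, ℂ) ∞ (fun z : ℂ => z + chartAt ℂ p p) z :=
    (contDiffAt_id.add contDiffAt_const).contMDiffAt
  have h3 := ContMDiffAt.comp z (hG _) (ContMDiffAt.comp z h1 h2)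
  exact contMDiffAt_iff_contDiffAt.1 h3

theorem contMDiffAt_coord (p : M) {q : M} (hq : q ∈ (chartAt ℂ p).source) :
    ContMDiffAt 𝓘(ℝ, ℂ) 𝓘(ℝ, ℂ) ∞ (coord p) q := by
  have := isManifold_real M
  have h1 : ContMDiffAt 𝓘(ℝ, ℂ) 𝓘(ℝ, ℂ) ∞ (chartAt ℂ p) q :=
    contMDiffAt_of_mem_maximalAtlas (IsManifold.chart_mem_maximalAtlas p) hq
  have h2 : ContMDiffAt 𝓘(ℝ, ℂ) 𝓘(ℝ, ℂ) ∞ (fun w : ℂ => w - chartAt ℂ p p) (chartAt ℂ p q) :=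
    (contDiffAt_id.sub contDiffAt_const).contMDiffAt
  exact ContMDiffAt.comp q h2 h1

theorem param_coord {p q : M} (hq : q ∈ (chartAt ℂ p).source) : param p (coord p q) = q := by
  simp [param, coord, (chartAt ℂ p).left_inv hq]

theorem contMDiffAt_of_comp_param {W : Type*} [NormedAddCommGroup W] [NormedSpace ℝ W]
    {G : M → W} {p : M} (hG : ContDiffAt ℝ ∞ (fun z => G (param p z)) 0) :
    ContMDiffAt 𝓘(ℝ, ℂ) 𝓘(ℝ, W) ∞ G p := by
  have h0 : coord p p = 0 := by simp [coord]
  have h1 : ContMDiffAt 𝓘(ℝ, ℂ) 𝓘(ℝ, W) ∞ (fun z => G (param p z)) (coord p p) := by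
    rw [h0]; exact hG.contMDiffAt
  have h2 := ContMDiffAt.comp p h1 (contMDiffAt_coord p (mem_chart_source ℂ p))
  refine h2.congr_of_eventuallyEq ?_
  filter_upwards [(chartAt ℂ p).open_source.mem_nhds (mem_chart_source ℂ p)] with q hq
  simp [param_coord hq]

/-- Passing from the preferred chart at a nearby point to the one at `p` multiplies tangent vectors
by a nonzero complex number. -/
theorem eventually_realDeriv_param (p : M) : ∀ᶠ z in 𝓝 (0 : ℂ), ∃ τ : ℂ, τ ≠ 0 ∧
    ∀ {W : Type} [NormedAddCommGroup W] [NormedSpace ℝ W] (G : M → W),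
      DifferentiableAt ℝ (fun y => G (param p y)) z →
      MDifferentiableAt 𝓘(ℝ, ℂ) 𝓘(ℝ, W) G (param p z) ∧
      ∀ v, realDeriv G (param p z) v = fderiv ℝ (fun y => G (param p y)) z (τ * v) := by
  filter_upwards [eventually_mem_target p, eventually_param_mem_source p,
    eventually_coord_param p] with z hz hsrc hco
  set q := param p z with hq
  have hqs := mem_chart_source ℂ q
  have hcc : ∀ a b : M, q ∈ (chartAt ℂ a).source → q ∈ (chartAt ℂ b).source →
      DifferentiableAt ℂ (chartAt ℂ a ∘ (chartAt ℂ b).symm) (chartAt ℂ b q) := by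
    intro a b ha hb
    have h1 := contDiffWithinAt_ext_coord_change (I := 𝓘(ℂ, ℂ)) (n := ω) a b
      (y := chartAt ℂ b q) (by
        simp only [mfld_simps]
        exact ⟨(chartAt ℂ b).map_source hb, by rwa [(chartAt ℂ b).left_inv hb]⟩)
    simp only [mfld_simps, contDiffWithinAt_univ] at h1
    exact h1.differentiableAt (by simp)
  set T : ℂ → ℂ := chartAt ℂ p ∘ (chartAt ℂ q).symm with hT
  set S : ℂ → ℂ := chartAt ℂ q ∘ (chartAt ℂ p).symm with hS
  have hTd := (hcc p q hsrc hqs).hasDerivAt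
  have hSd := (hcc q p hqs hsrc).hasDerivAt
  have hTq : T (chartAt ℂ q q) = chartAt ℂ p q := by
    simp [hT, (chartAt ℂ q).left_inv hqs]
  have hnear : ∀ᶠ y in 𝓝 (chartAt ℂ q q), (chartAt ℂ q).symm y ∈ (chartAt ℂ p).source := by
    have h1 := (chartAt ℂ q).symm.continuousAt (mem_chart_target ℂ q)
    have h2 : (chartAt ℂ q).symm (chartAt ℂ q q) = q := (chartAt ℂ q).left_inv hqs
    exact h1.eventually (by rw [h2]; exact (chartAt ℂ p).open_source.mem_nhds hsrc)
  have hST : S ∘ T =ᶠ[𝓝 (chartAt ℂ q q)] id := by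
    filter_upwards [hnear, (chartAt ℂ q).open_target.mem_nhds (mem_chart_target ℂ q)] with y h1 h2
    simp [hS, hT, (chartAt ℂ p).left_inv h1, (chartAt ℂ q).right_inv h2]
  have hτ : deriv T (chartAt ℂ q q) ≠ 0 := by
    have hSd' : HasDerivAt S (deriv S (chartAt ℂ p q)) (T (chartAt ℂ q q)) := by
      rw [hTq]; exact hSd
    have h1 := hSd'.comp _ hTd
    have h2 := (hasDerivAt_id (chartAt ℂ q q)).congr_of_eventuallyEq hST
    intro h0
    have h3 := h1.unique h2
    rw [h0, mul_zero] at h3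
    exact zero_ne_one h3
  refine ⟨_, hτ, fun {W} _ _ G hG => ?_⟩
  have hzc : z = coord p q := hco.symm
  have hGm : MDifferentiableAt 𝓘(ℝ, ℂ) 𝓘(ℝ, W) G q := by
    have h1 : MDifferentiableAt 𝓘(ℝ, ℂ) 𝓘(ℝ, W) (fun y => G (param p y)) (coord p q) := by
      rw [← hzc]; exact hG.mdifferentiableAt
    have h2 := MDifferentiableAt.comp q h1
      ((contMDiffAt_coord p hsrc).mdifferentiableAt (by simp))
    refine h2.congr_of_eventuallyEq ?_
    filter_upwards [(chartAt ℂ p).open_source.mem_nhds hsrc] with y hy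
    simp [param_coord hy]
  refine ⟨hGm, fun v => ?_⟩
  have h1 := hasFDerivAt_realDeriv G q hGm
  have h2 : HasFDerivAt (fun y : ℂ => T y - chartAt ℂ p p)
      ((ContinuousLinearMap.toSpanSingleton ℂ (deriv T (chartAt ℂ q q))).restrictScalars ℝ)
      (chartAt ℂ q q) := (hTd.hasFDerivAt.restrictScalars ℝ).sub_const _
  have hG' : HasFDerivAt (fun y => G (param p y)) (fderiv ℝ (fun y => G (param p y)) z)
      (T (chartAt ℂ q q) - chartAt ℂ p p) := by
    rw [hTq]
    have := hG.hasFDerivAt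
    rw [hzc] at this ⊢
    exact this
  have h3 := HasFDerivAt.comp (chartAt ℂ q q) (f := fun y : ℂ => T y - chartAt ℂ p p) hG' h2
  have h4 : (G ∘ (extChartAt 𝓘(ℝ, ℂ) q).symm) =ᶠ[𝓝 (chartAt ℂ q q)]
      ((fun y => G (param p y)) ∘ fun y : ℂ => T y - chartAt ℂ p p) := by
    filter_upwards [hnear] with y hy
    simp [hT, param, (chartAt ℂ p).left_inv hy]
  have h5 := h3.congr_of_eventuallyEq h4
  have h6 : HasFDerivAt (G ∘ (extChartAt 𝓘(ℝ, ℂ) q).symm) (realDeriv G q) (chartAt ℂ q q) := by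
    simpa using h1
  rw [h6.unique h5]
  simp [mul_comm]

theorem eventually_dz_param (p : M) : ∀ᶠ z in 𝓝 (0 : ℂ), ∃ τ : ℂ, τ ≠ 0 ∧
    ∀ (G : M → C7), DifferentiableAt ℝ (fun y => G (param p y)) z →
      MDifferentiableAt 𝓘(ℝ, ℂ) 𝓘(ℝ, C7) G (param p z) ∧
      dz G (param p z) = τ • pz (fun y => G (param p y)) z ∧
      dzbar G (param p z) = (starRingEnd ℂ) τ • pzb (fun y => G (param p y)) z := by
  filter_upwards [eventually_realDeriv_param p] with z ⟨τ, hτ, h⟩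
  refine ⟨τ, hτ, fun G hG => ?_⟩
  obtain ⟨h1, h2⟩ := h G hG
  refine ⟨h1, ?_, ?_⟩
  · simp only [dz, h2, fderiv_eq_pz_pzb _ z, map_mul, Complex.conj_I, map_one]
    match_scalars
    · linear_combination (-τ / 2) * Complex.I_sq
    · linear_combination ((starRingEnd ℂ) τ / 2) * Complex.I_sq
  · simp only [dzbar, h2, fderiv_eq_pz_pzb _ z, map_mul, Complex.conj_I, map_one]
    match_scalars
    · linear_combination (τ / 2) * Complex.I_sq
    · linear_combination (-(starRingEnd ℂ) τ / 2) * Complex.I_sq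

/-- A map to `ℂ⁷` whose derivatives vanish is constant. -/
theorem apply_eq_of_wirt_eq_zero [ConnectedSpace M] {g : M → C7}
    (h : ∀ p, ∀ᶠ z in 𝓝 (0 : ℂ), DifferentiableAt ℝ (fun y => g (param p y)) z ∧
      pz (fun y => g (param p y)) z = 0 ∧ pzb (fun y => g (param p y)) z = 0) (p q : M) :
    g p = g q := by
  have hloc : IsLocallyConstant g := by
    rw [IsLocallyConstant.iff_eventually_eq]
    intro p
    obtain ⟨r, hr, hb⟩ := Metric.eventually_nhds_iff_ball.1 (h p)
    rw [eventually_nhds_iff_param]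
    filter_upwards [Metric.ball_mem_nhds (0 : ℂ) hr] with z hz
    have h1 := (convex_ball (0 : ℂ) r).is_const_of_fderivWithin_eq_zero (𝕜 := ℝ)
      (f := fun y => g (param p y)) (fun y hy => (hb y hy).1.differentiableWithinAt)
      (fun y hy => by
        rw [fderivWithin_of_isOpen Metric.isOpen_ball hy]
        ext1 v
        rw [fderiv_eq_pz_pzb, (hb y hy).2.1, (hb y hy).2.2]
        simp) hz (Metric.mem_ball_self hr)
    simpa only [param_zero] using h1
  exact hloc.apply_eq_of_preconnectedSpace p q

end Param

/-! ### Line bundles with local frames -/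

section LineProjection

theorem isBoundedBilinearMap_rankOne {E : Type*} [NormedAddCommGroup E] [InnerProductSpace ℂ E] :
    IsBoundedBilinearMap ℝ fun x : E × E => InnerProductSpace.rankOne ℂ x.1 x.2 where
  add_left a b c := by simp
  smul_left r a b := by
    ext1 w
    rw [InnerProductSpace.rankOne_apply, smul_apply, InnerProductSpace.rankOne_apply, smul_comm]
  add_right a b c := by simp
  smul_right r a b := by
    ext1 w
    rw [InnerProductSpace.rankOne_apply, smul_apply, InnerProductSpace.rankOne_apply,
      ← Complex.coe_smul r b, ← Complex.coe_smul r, inner_smul_left, Complex.conj_ofReal,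
      smul_smul]
  bound := ⟨1, one_pos, fun x y => by simp⟩

theorem starProjection_span_singleton {E : Type*} [NormedAddCommGroup E] [InnerProductSpace ℂ E]
    (u : E) :
    (Submodule.span ℂ {u}).starProjection = (inner ℂ u u)⁻¹ • InnerProductSpace.rankOne ℂ u u := by
  ext1 w
  rw [Submodule.starProjection_singleton, smul_apply, InnerProductSpace.rankOne_apply, smul_smul,
    inner_self_eq_norm_sq_to_K]
  congr 1
  push_cast
  rw [div_eq_inv_mul]

theorem contDiffAt_starProjection_span {E : Type*} [NormedAddCommGroup E] [InnerProductSpace ℂ E]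
    {u : ℂ → E} {z : ℂ} (hu : ContDiffAt ℝ ∞ u z) (h0 : u z ≠ 0) :
    ContDiffAt ℝ ∞ (fun y => (Submodule.span ℂ {u y}).starProjection) z := by
  have h1 : ContDiffAt ℝ ∞ (fun y => (inner ℂ (u y) (u y))⁻¹) z :=
    (hu.inner ℂ hu).inv (inner_self_ne_zero.2 h0)
  have h2 : ContDiffAt ℝ ∞ (fun y => InnerProductSpace.rankOne ℂ (u y) (u y)) z :=
    ContDiffAt.comp (g := fun x : E × E => InnerProductSpace.rankOne ℂ x.1 x.2) z
      isBoundedBilinearMap_rankOne.contDiff.contDiffAt (hu.prodMk hu)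
  have h4 : (fun y => (Submodule.span ℂ {u y}).starProjection)
      = fun y => (inner ℂ (u y) (u y))⁻¹ • InnerProductSpace.rankOne ℂ (u y) (u y) :=
    funext fun y => starProjection_span_singleton (u y)
  rw [h4]
  exact h1.smul h2

/-- The case of `ℂ⁷`, with the real scalar action that comes from the coordinates. -/
theorem contDiffAt_starProjection {u : ℂ → C7} {z : ℂ} (hu : ContDiffAt ℝ ∞ u z) (h0 : u z ≠ 0) :
    ContDiffAt ℝ ∞ (fun y => (Submodule.span ℂ {u y}).starProjection) z :=
  contDiffAt_starProjection_span hu h0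

end LineProjection

section Frames

variable {M : Type*} [TopologicalSpace M] [ChartedSpace ℂ M]

/-- `s` is a smooth nonvanishing local section spanning `φ` near `p`, written in the local
parameter at `p`. -/
def IsFrame (φ : M → Submodule ℂ C7) (p : M) (s : ℂ → C7) : Prop :=
  SmoothNear s ∧ ∀ᶠ z in 𝓝 (0 : ℂ), s z ≠ 0 ∧ φ (param p z) = Submodule.span ℂ {s z}

theorem SmoothNear.eventually_ne {E : Type*} [NormedAddCommGroup E] [NormedSpace ℝ E] {u : ℂ → E}
    (hu : SmoothNear u) (h0 : u 0 ≠ 0) : ∀ᶠ z in 𝓝 (0 : ℂ), u z ≠ 0 :=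
  hu.contDiffAt.continuousAt.eventually_ne h0

theorem IsFrame.apply_zero {φ : M → Submodule ℂ C7} {p : M} {s : ℂ → C7} (h : IsFrame φ p s) :
    s 0 ≠ 0 ∧ φ p = Submodule.span ℂ {s 0} := by
  simpa using h.2.self_of_nhds

variable [IsManifold 𝓘(ℂ, ℂ) ω M]

theorem isSmoothSubbundle_of_isFrame {φ : M → Submodule ℂ C7} (h : ∀ p, ∃ s, IsFrame φ p s) :
    IsSmoothSubbundle φ := by
  intro p
  obtain ⟨s, hs⟩ := h p
  refine contMDiffAt_of_comp_param ?_
  refine (contDiffAt_starProjection hs.1.contDiffAt hs.apply_zero.1).congr_of_eventuallyEq ?_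
  filter_upwards [hs.2] with z hz
  simp only [proj, hz.2]

/-- `A''_{φ,ψ}(s) = π_ψ (∂_z̄ s)` for every section `s` of `φ`. -/
theorem secondFormBar_section {φ ψ : M → Submodule ℂ C7} (hφ : IsSmoothSubbundle φ) (p : M)
    (hφψ : φ p ⟂ ψ p) (s : M → C7) (hs : ∀ q, s q ∈ φ q)
    (hsd : MDifferentiableAt 𝓘(ℝ, ℂ) 𝓘(ℝ, C7) s p) :
    (secondFormBar φ ψ p ⟨s p, hs p⟩ : C7) = (ψ p).starProjection (dzbar s p) := by
  have hP : MDifferentiableAt 𝓘(ℝ, ℂ) 𝓘(ℝ, C7 →L[ℂ] C7) (proj φ) p :=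
    (hφ p).mdifferentiableAt (by simp)
  have hsP : (fun q => proj φ q (s q)) = s := by
    funext q; exact Submodule.starProjection_eq_self_iff.2 (hs q)
  have key := realDeriv_apply (proj φ) s p hP hsd
  rw [hsP] at key
  have h0 : ∀ w, (ψ p).starProjection (proj φ p w) = 0 := fun w => by
    rw [Submodule.starProjection_apply_eq_zero_iff]
    exact hφψ ((φ p).starProjection_apply_mem w)
  have e : (secondFormBar φ ψ p ⟨s p, hs p⟩ : C7)
      = (ψ p).starProjection (dzbar (proj φ) p (s p)) := rfl
  rw [e]
  unfold dzbar
  rw [key 1, key Complex.I]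
  simp [h0]

/-- The second fundamental forms on a local frame, up to the factor relating the charts. -/
theorem eventually_secondForm_frame {φ : M → Submodule ℂ C7} (hφ : IsSmoothSubbundle φ) {p : M}
    {s : ℂ → C7} (hs : IsFrame φ p s) :
    ∀ᶠ z in 𝓝 (0 : ℂ), ∃ (hm : s z ∈ φ (param p z)) (τ : ℂ), τ ≠ 0 ∧
      ∀ ψ : M → Submodule ℂ C7, φ (param p z) ⟂ ψ (param p z) →
        (secondForm φ ψ (param p z) ⟨s z, hm⟩ : C7)
          = τ • (ψ (param p z)).starProjection (pz s z) ∧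
        (secondFormBar φ ψ (param p z) ⟨s z, hm⟩ : C7)
          = (starRingEnd ℂ) τ • (ψ (param p z)).starProjection (pzb s z) := by
  classical
  -- the frame, extended by zero to a global section
  set S : M → C7 := fun q => if s (coord p q) ∈ φ q then s (coord p q) else 0 with hS
  have hSmem : ∀ q, S q ∈ φ q := fun q => by
    simp only [hS]
    split_ifs with h
    exacts [h, Submodule.zero_mem _]
  have hSs : (fun z => S (param p z)) =ᶠ[𝓝 0] s := by
    filter_upwards [hs.2, eventually_coord_param p] with z h1 h2
    simp only [hS, h2]
    rw [if_pos]
    rw [h1.2]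
    exact Submodule.mem_span_singleton_self _
  filter_upwards [hs.1, hSs.eventuallyEq_nhds, eventually_dz_param p] with z h1 h2 ⟨τ, hτ, h3⟩
  have h4 : S (param p z) = s z := h2.eq_of_nhds
  have hm : s z ∈ φ (param p z) := by rw [← h4]; exact hSmem _
  refine ⟨hm, τ, hτ, fun ψ hψ => ?_⟩
  obtain ⟨h5, h6, h7⟩ := h3 S (h1.diffAt.congr_of_eventuallyEq h2)
  have e : (⟨s z, hm⟩ : φ (param p z)) = ⟨S (param p z), hSmem _⟩ := Subtype.ext h4.symm
  rw [e, secondForm_section hφ _ hψ S hSmem h5, secondFormBar_section hφ _ hψ S hSmem h5, h6, h7,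
    wirt_congr_at h2, wirt_congr_at h2, map_smul, map_smul]
  exact ⟨rfl, rfl⟩

theorem map_subtype_range_eq_span {A B : Submodule ℂ C7} (T : A →L[ℂ] B) {x y : C7} (hx : x ∈ A)
    (hA : A = Submodule.span ℂ {x}) (hT : (T ⟨x, hx⟩ : C7) = y) :
    Submodule.map B.subtype (LinearMap.range T.toLinearMap) = Submodule.span ℂ {y} := by
  ext w
  simp only [Submodule.mem_map, LinearMap.mem_range, Submodule.mem_span_singleton]
  constructor
  · rintro ⟨_, ⟨⟨a, ha⟩, rfl⟩, rfl⟩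
    obtain ⟨c, rfl⟩ := Submodule.mem_span_singleton.1 (hA ▸ ha)
    refine ⟨c, ?_⟩
    rw [← hT]
    exact (congrArg Subtype.val (T.map_smul c ⟨x, hx⟩)).symm
  · rintro ⟨c, rfl⟩
    refine ⟨_, ⟨c • ⟨x, hx⟩, rfl⟩, ?_⟩
    rw [← hT]
    exact congrArg Subtype.val (T.map_smul c ⟨x, hx⟩)

/-- If `χ` is spanned away from `p` by a smooth section that does not vanish at `p`, then this
section is a frame of the family with its zeros filled out. -/
theorem isFrame_limitFibre [T2Space M] {χ : M → Submodule ℂ C7} {p : M} {w : ℂ → C7}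
    (hw : SmoothNear w) (hw0 : w 0 ≠ 0)
    (h : ∀ᶠ z in 𝓝 (0 : ℂ), z ≠ 0 → χ (param p z) = Submodule.span ℂ {w z}) :
    IsFrame (limitFibre χ) p w := by
  refine ⟨hw, ?_⟩
  set ψ : M → Submodule ℂ C7 := fun q => Submodule.span ℂ {w (coord p q)} with hψ
  have h1 : ∀ᶠ q in 𝓝[≠] p, χ q = ψ q := by
    rw [eventually_punctured_iff_param]
    filter_upwards [h, eventually_coord_param p] with z h1 h2 hz
    simp only [hψ, h2, h1 hz]
  have h2 := eventually_nhds_iff_param.1 (eventually_eventually_punctured h1)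
  filter_upwards [h2, hw, hw.eventually_ne hw0, eventually_coord_param p,
    eventually_param_mem_source p] with z h3 h4 h5 h6 h7
  have := neBot_punctured_nhds (param p z)
  refine ⟨h5, ?_⟩
  rw [limitFibre_eq (ψ := ψ) ?_ h3]
  · simp only [hψ, h6]
  · have h8 := (contDiffAt_starProjection h4 h5).continuousAt
    rw [← h6] at h8
    exact ContinuousAt.comp (f := coord p) h8 (continuousAt_coord h7)

variable [T2Space M]

/-- If `∂s/∂z = a s + m w` with `w ⟂ s` and `m` vanishing at most at `0`, then `w` is a frame of the
`∂'`-Gauss transform. -/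
theorem isFrame_gaussPrime {φ : M → Submodule ℂ C7} (hφ : IsSmoothSubbundle φ) {p : M}
    {s w : ℂ → C7} {a m : ℂ → ℂ} (hs : IsFrame φ p s) (hw : SmoothNear w) (hw0 : w 0 ≠ 0)
    (hm : ∀ z, z ≠ 0 → m z ≠ 0)
    (heq : ∀ᶠ z in 𝓝 (0 : ℂ), pz s z = a z • s z + m z • w z)
    (horth : ∀ᶠ z in 𝓝 (0 : ℂ), inner ℂ (s z) (w z) = 0) : IsFrame (gaussPrime φ) p w := by
  refine isFrame_limitFibre hw hw0 ?_
  filter_upwards [eventually_secondForm_frame hφ hs, hs.2, heq, horth]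
    with z ⟨hmem, τ, hτ, h1⟩ h2 h3 h4 hz
  have h5 := (h1 (fun x => (φ x)ᗮ) (Submodule.isOrtho_orthogonal_right _)).1
  rw [map_subtype_range_eq_span _ hmem h2.2 h5]
  have h6 : (φ (param p z))ᗮ.starProjection (pz s z) = m z • w z := by
    rw [h3, map_add, map_smul, map_smul]
    have e1 : (φ (param p z))ᗮ.starProjection (s z) = 0 := by
      rw [Submodule.starProjection_apply_eq_zero_iff]
      exact Submodule.le_orthogonal_orthogonal _ hmem
    have e2 : (φ (param p z))ᗮ.starProjection (w z) = w z := by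
      rw [Submodule.starProjection_eq_self_iff, h2.2, Submodule.mem_orthogonal_singleton_iff_inner_right]
      exact h4
    rw [e1, e2, smul_zero, zero_add]
  rw [h6, smul_smul]
  exact Submodule.span_singleton_smul_eq (IsUnit.mk0 _ (mul_ne_zero hτ (hm z hz))) _

/-- The counterpart of `isFrame_gaussPrime` for `∂/∂z̄` and the `∂''`-Gauss transform. -/
theorem isFrame_gaussDoublePrime {φ : M → Submodule ℂ C7} (hφ : IsSmoothSubbundle φ) {p : M}
    {s w : ℂ → C7} {a m : ℂ → ℂ} (hs : IsFrame φ p s) (hw : SmoothNear w) (hw0 : w 0 ≠ 0)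
    (hm : ∀ z, z ≠ 0 → m z ≠ 0)
    (heq : ∀ᶠ z in 𝓝 (0 : ℂ), pzb s z = a z • s z + m z • w z)
    (horth : ∀ᶠ z in 𝓝 (0 : ℂ), inner ℂ (s z) (w z) = 0) :
    IsFrame (gaussDoublePrime φ) p w := by
  refine isFrame_limitFibre hw hw0 ?_
  filter_upwards [eventually_secondForm_frame hφ hs, hs.2, heq, horth]
    with z ⟨hmem, τ, hτ, h1⟩ h2 h3 h4 hz
  have h5 := (h1 (fun x => (φ x)ᗮ) (Submodule.isOrtho_orthogonal_right _)).2
  rw [map_subtype_range_eq_span _ hmem h2.2 h5]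
  have h6 : (φ (param p z))ᗮ.starProjection (pzb s z) = m z • w z := by
    rw [h3, map_add, map_smul, map_smul]
    have e1 : (φ (param p z))ᗮ.starProjection (s z) = 0 := by
      rw [Submodule.starProjection_apply_eq_zero_iff]
      exact Submodule.le_orthogonal_orthogonal _ hmem
    have e2 : (φ (param p z))ᗮ.starProjection (w z) = w z := by
      rw [Submodule.starProjection_eq_self_iff, h2.2, Submodule.mem_orthogonal_singleton_iff_inner_right]
      exact h4
    rw [e1, e2, smul_zero, zero_add]
  rw [h6, smul_smul]
  refine Submodule.span_singleton_smul_eq (IsUnit.mk0 _ (mul_ne_zero ?_ (hm z hz))) _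
  simpa using hτ

/-- A second fundamental form vanishes if the derivative of a frame is orthogonal to the target. -/
theorem secondForm_eq_zero {φ ψ : M → Submodule ℂ C7} (hφ : IsSmoothSubbundle φ) {p : M}
    {s t : ℂ → C7} (hs : IsFrame φ p s) (ht : IsFrame ψ p t) (hφψ : φ p ⟂ ψ p)
    (h : inner ℂ (t 0) (pz s 0) = 0) : secondForm φ ψ p = 0 := by
  have key0 := (eventually_secondForm_frame hφ hs).self_of_nhds
  have hp : param p 0 = p := param_zero p
  obtain ⟨q, rfl, key⟩ : ∃ q, p = q ∧ ∃ (hm : s 0 ∈ φ q) (τ : ℂ),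
      ∀ ψ : M → Submodule ℂ C7, φ q ⟂ ψ q →
        (secondForm φ ψ q ⟨s 0, hm⟩ : C7) = τ • (ψ q).starProjection (pz s 0) := by
    obtain ⟨hm, τ, -, h1⟩ := key0
    exact ⟨_, hp.symm, hm, τ, fun ψ hψ => (h1 ψ hψ).1⟩
  obtain ⟨hm, τ, h1⟩ := key
  have h2 := h1 ψ hφψ
  have h3 : (ψ p).starProjection (pz s 0) = 0 := by
    rw [Submodule.starProjection_apply_eq_zero_iff, ht.apply_zero.2,
      Submodule.mem_orthogonal_singleton_iff_inner_right]
    exact h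
  rw [h3, smul_zero] at h2
  ext ⟨x, hx⟩ : 1
  obtain ⟨c, rfl⟩ := Submodule.mem_span_singleton.1 (hs.apply_zero.2 ▸ hx)
  have h4 : secondForm φ ψ p ⟨s 0, hm⟩ = 0 := Subtype.ext h2
  have : (⟨c • s 0, hx⟩ : φ p) = c • ⟨s 0, hm⟩ := rfl
  rw [this, map_smul, h4, smul_zero]
  rfl

end Frames

/-- On a connected space, a closed condition whose zeros are locally isolated or locally everything
holds everywhere or has isolated zeros only. -/
theorem forall_or_forall_eventually_not {X : Type*} [TopologicalSpace X] [ConnectedSpace X]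
    [T1Space X] (hX : ∀ x : X, (𝓝[≠] x).NeBot) {P : X → Prop}
    (h : ∀ x, (∀ᶠ y in 𝓝 x, P y) ∨ ∀ᶠ y in 𝓝[≠] x, ¬ P y) :
    (∀ x, P x) ∨ ∀ x, ∀ᶠ y in 𝓝[≠] x, ¬ P y := by
  set Z : Set X := {x | ∀ᶠ y in 𝓝 x, P y} with hZ
  have ho : IsOpen Z := isOpen_iff_mem_nhds.2 fun x hx => hx.eventually_nhds
  have hc : IsClosed Z := by
    refine ⟨isOpen_iff_mem_nhds.2 fun x hx => ?_⟩
    have h1 := (h x).resolve_left hx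
    filter_upwards [eventually_eventually_punctured h1] with y hy hyZ
    have := hX y
    obtain ⟨w, hw1, hw2⟩ := (hy.and (hyZ.filter_mono nhdsWithin_le_nhds)).exists
    exact hw1 hw2
  rcases isClopen_iff.1 ⟨hc, ho⟩ with h1 | h1
  · refine Or.inr fun x => (h x).resolve_left fun hx => ?_
    have : x ∈ Z := hx
    rw [h1] at this
    exact this
  · refine Or.inl fun x => ?_
    have : x ∈ Z := by rw [h1]; trivial
    exact Filter.Eventually.self_of_nhds this

/-! ### The moving frame of an almost complex germ -/

section Germ

theorem wirt_conjVec {c : ℂ} {f : ℂ → C7} {z : ℂ} (hf : DifferentiableAt ℝ f z) :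
    wirt c (fun w => conjVec (f w)) z = conjVec (wirt ((starRingEnd ℂ) c) f z) :=
  wirt_clm (c := (starRingEnd ℂ) c) conjL (fun x => by simp [conjVec_smul])
    (fun x => by simp [conjVec_smul, map_ofNat]) hf

theorem wirt_cross {c : ℂ} {f g : ℂ → C7} {z : ℂ} (hf : DifferentiableAt ℝ f z)
    (hg : DifferentiableAt ℝ g z) :
    wirt c (fun w => cross (f w) (g w)) z = cross (wirt c f z) (g z) + cross (f z) (wirt c g z) :=
  wirt_bilin (c₁ := c) (c₂ := c) crossL (fun x y => cross_smul_left c x y)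
    (fun x y => cross_smul_left _ x y) (fun x y => cross_smul_right c x y)
    (fun x y => cross_smul_right _ x y) hf hg

theorem wirt_const_smul {c : ℂ} (r : ℂ) {f : ℂ → C7} {z : ℂ} (hf : DifferentiableAt ℝ f z) :
    wirt c (fun w => r • f w) z = r • wirt c f z := by
  have h := wirt_smul (c := c) (a := fun _ => r) (differentiableAt_const r) hf
  rw [wirt_const] at h
  simpa using h

theorem SmoothNear.conjVec {f : ℂ → C7} (hf : SmoothNear f) :
    SmoothNear fun z => conjVec (f z) := by
  filter_upwards [hf] with z hz
  exact conjL.contDiff.contDiffAt.comp z hz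

theorem SmoothNear.cross {f g : ℂ → C7} (hf : SmoothNear f) (hg : SmoothNear g) :
    SmoothNear fun z => cross (f z) (g z) := by
  filter_upwards [hf, hg] with z h1 h2
  exact (crossL.contDiff.contDiffAt.comp z h1).clm_apply h2

theorem SmoothNear.inv {a : ℂ → ℂ} (ha : SmoothNear a) (h0 : a 0 ≠ 0) :
    SmoothNear fun z => (a z)⁻¹ := by
  filter_upwards [ha, ha.eventually_ne h0] with z h1 h2 using h1.inv h2

theorem conjVec_neg (u : C7) : conjVec (-u) = -conjVec u := by
  ext k; simp [AlmostComplexS6.conjVec]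

/-- A germ at `0 ∈ ℂ` of an almost complex map into `S⁶`, seen as a real unit vector of `ℂ⁷`: its
derivative `∂G/∂z` is of type `(1, 0)`. -/
structure IsAlmostComplexGerm (G : ℂ → C7) : Prop where
  smooth : SmoothNear G
  conj : ∀ᶠ z in 𝓝 (0 : ℂ), conjVec (G z) = G z
  inner_self : ∀ᶠ z in 𝓝 (0 : ℂ), inner ℂ (G z) (G z) = 1
  type : ∀ᶠ z in 𝓝 (0 : ℂ), cross (G z) (pz G z) = Complex.I • pz G z

variable {G u w : ℂ → C7} {k l : ℕ}

theorem IsAlmostComplexGerm.pzb_eq (h : IsAlmostComplexGerm G) :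
    ∀ᶠ z in 𝓝 (0 : ℂ), pzb G z = conjVec (pz G z) := by
  filter_upwards [h.smooth, h.conj.eventually_nhds] with z h1 h2
  have h3 : pzb (fun y => conjVec (G y)) z = pzb G z := wirt_congr_at h2
  rw [← h3, wirt_conjVec h1.diffAt, Complex.conj_I]

/-- Almost complex maps are harmonic. -/
theorem IsAlmostComplexGerm.pzb_pz (h : IsAlmostComplexGerm G) :
    ∀ᶠ z in 𝓝 (0 : ℂ), pzb (pz G) z = -(inner ℂ (pz G z) (pz G z) • G z) := by
  filter_upwards [h.smooth, h.conj, h.type, h.type.eventually_nhds, h.pzb_eq,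
    h.pzb_eq.eventually_nhds] with z h1 h2 h3 h3' h4 h4'
  have h5 := (contDiffAt_wirt (c := -Complex.I) h1).diffAt
  -- the Laplacian of a real map is real
  have hreal : conjVec (pzb (pz G) z) = pzb (pz G) z := by
    have e1 : pz (pzb G) z = pz (fun y => conjVec (pz G y)) z := wirt_congr_at h4'
    rw [wirt_comm h1, wirt_conjVec h5] at e1
    rw [map_neg, Complex.conj_I, neg_neg] at e1
    exact e1.symm
  have e2 : pzb (fun y => cross (G y) (pz G y)) z = pzb (fun y => Complex.I • pz G y) z :=
    wirt_congr_at h3'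
  rw [wirt_cross h1.diffAt h5, wirt_const_smul _ h5, h4, cross_anticomm (conjVec _),
    cross_conjVec_eq_smul h2 h3 h3] at e2
  have e3 := congrArg conjVec e2
  rw [conjVec_add, ← cross_conjVec, hreal, h2, conjVec_smul, hreal, conjVec_neg, conjVec_smul,
    h2, map_mul, inner_conj_symm, Complex.conj_I] at e3
  have e4 : (2 * Complex.I) • pzb (pz G) z
      = (2 * Complex.I) • -(inner ℂ (pz G z) (pz G z) • G z) := by
    linear_combination (norm := module) e3 - e2
  exact smul_right_injective _ (by simp) e4

/-- The derivative of an almost complex germ vanishes identically or to a finite order. -/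
theorem IsAlmostComplexGerm.eventually_eq_zero_or (h : IsAlmostComplexGerm G) :
    (∀ᶠ z in 𝓝 (0 : ℂ), pz G z = 0) ∨ ∃ (k : ℕ) (u : ℂ → C7), SmoothNear u ∧ u 0 ≠ 0 ∧
      ∀ᶠ z in 𝓝 (0 : ℂ), pz G z = z ^ k • u z := by
  refine eventually_eq_zero_or_exists_pow_smul (h.smooth.wirt _) h.smooth h.pzb_pz ?_
  filter_upwards [h.conj, h.type] with z h1 h2 using inner_eq_zero_of_type h1 h2

/-- `u` is the derivative of the almost complex germ `G` with its zero of order `k` divided out. -/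
structure IsFirstFrame (G u : ℂ → C7) (k : ℕ) : Prop extends IsAlmostComplexGerm G where
  smooth_frame : SmoothNear u
  ne_zero : u 0 ≠ 0
  pz_base : ∀ᶠ z in 𝓝 (0 : ℂ), pz G z = z ^ k • u z

theorem IsFirstFrame.eventually_ne_zero (h : IsFirstFrame G u k) :
    ∀ᶠ z in 𝓝 (0 : ℂ), u z ≠ 0 := h.smooth_frame.eventually_ne h.ne_zero

theorem IsFirstFrame.pzb_base (h : IsFirstFrame G u k) :
    ∀ᶠ z in 𝓝 (0 : ℂ), pzb G z = (starRingEnd ℂ) z ^ k • conjVec (u z) := by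
  filter_upwards [h.pzb_eq, h.pz_base] with z h1 h2
  rw [h1, h2, conjVec_smul, map_pow]

theorem IsFirstFrame.type_frame (h : IsFirstFrame G u k) :
    ∀ᶠ z in 𝓝 (0 : ℂ), cross (G z) (u z) = Complex.I • u z := by
  refine eventuallyEq_of_punctured (h.smooth.cross h.smooth_frame).continuousAt
    ((smoothNear_const Complex.I).smul h.smooth_frame).continuousAt ?_
  filter_upwards [h.type, h.pz_base] with z h1 h2 hz
  rw [h2, cross_smul_right, smul_comm] at h1
  exact smul_right_injective _ (pow_ne_zero k hz) h1

theorem IsFirstFrame.pzb_frame (h : IsFirstFrame G u k) : ∀ᶠ z in 𝓝 (0 : ℂ),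
    pzb u z = -(((starRingEnd ℂ) z ^ k * inner ℂ (u z) (u z)) • G z) := by
  refine eventuallyEq_of_punctured (h.smooth_frame.wirt _).continuousAt
    ((((smoothNear_conj_pow k).smul (h.smooth_frame.inner h.smooth_frame)).smul
      h.smooth).neg).continuousAt ?_
  filter_upwards [h.pzb_pz, h.pz_base, h.pz_base.eventually_nhds, h.smooth_frame]
    with z h1 h2 h2' h3 hz
  have e : pzb (pz G) z = pzb (fun y => y ^ k • u y) z := wirt_congr_at h2'
  rw [e, pzb_pow_smul h3.diffAt, h2, inner_smul_left, inner_smul_right, map_pow] at h1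
  refine smul_right_injective _ (pow_ne_zero k hz) ?_
  simp only [h1]
  module

/-- The component of `∂u/∂z` orthogonal to `u`. -/
def secondDeriv (u : ℂ → C7) (z : ℂ) : C7 :=
  pz u z - ((inner ℂ (u z) (u z))⁻¹ * inner ℂ (u z) (pz u z)) • u z

theorem pz_eq_add_secondDeriv (u : ℂ → C7) (z : ℂ) : pz u z =
    ((inner ℂ (u z) (u z))⁻¹ * inner ℂ (u z) (pz u z)) • u z + secondDeriv u z := by
  rw [secondDeriv]; abel

theorem SmoothNear.secondDeriv (hu : SmoothNear u) (h0 : u 0 ≠ 0) :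
    SmoothNear (secondDeriv u) :=
  (hu.wirt _).sub ((((hu.inner hu).inv (inner_self_ne_zero.2 h0)).smul
    (hu.inner (hu.wirt _))).smul hu)

theorem inner_secondDeriv {z : ℂ} (h : u z ≠ 0) : inner ℂ (u z) (secondDeriv u z) = 0 := by
  have h1 : inner ℂ (u z) (u z) ≠ 0 := inner_self_ne_zero.2 h
  rw [secondDeriv, inner_sub_right, inner_smul_right]
  field_simp
  ring

theorem IsFirstFrame.type_secondDeriv (h : IsFirstFrame G u k) :
    ∀ᶠ z in 𝓝 (0 : ℂ), cross (G z) (secondDeriv u z) = Complex.I • secondDeriv u z := by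
  filter_upwards [h.type_frame, h.type_frame.eventually_nhds, h.smooth, h.smooth_frame, h.pz_base]
    with z h1 h1' h2 h3 h4
  have e : pz (fun y => cross (G y) (u y)) z = pz (fun y => Complex.I • u y) z :=
    wirt_congr_at h1'
  rw [wirt_cross h2.diffAt h3.diffAt, wirt_const_smul _ h3.diffAt, h4, cross_smul_left, cross_self,
    smul_zero, zero_add] at e
  have e2 := pz_eq_add_secondDeriv u z
  rw [e2, cross_add_right, cross_smul_right, h1] at e
  linear_combination (norm := module) e

theorem IsFirstFrame.pzb_secondDeriv (h : IsFirstFrame G u k) : ∀ᶠ z in 𝓝 (0 : ℂ),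
    pzb (secondDeriv u) z = -(inner ℂ (secondDeriv u z) (secondDeriv u z) •
      ((inner ℂ (u z) (u z))⁻¹ • u z)) := by
  have hS := h.smooth_frame.secondDeriv h.ne_zero
  have hU := h.smooth_frame.inner h.smooth_frame
  have hc := (smoothNear_conj_pow k).smul hU
  have ha := (hU.inv (inner_self_ne_zero.2 h.ne_zero)).smul
    (h.smooth_frame.inner (h.smooth_frame.wirt (-Complex.I)))
  have hGs : ∀ᶠ z in 𝓝 (0 : ℂ), inner ℂ (G z) (secondDeriv u z) = 0 := by
    filter_upwards [h.conj, h.type_secondDeriv] with z h1 h2 using inner_eq_zero_of_type h1 h2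
  have hus : ∀ᶠ z in 𝓝 (0 : ℂ), inner ℂ (u z) (secondDeriv u z) = 0 := by
    filter_upwards [h.eventually_ne_zero] with z hz using inner_secondDeriv hz
  filter_upwards [h.smooth, h.smooth_frame, hS, hc, ha, h.pz_base, h.pzb_frame,
    h.pzb_frame.eventually_nhds, hGs.eventually_nhds, hus, hus.eventually_nhds,
    h.eventually_ne_zero, h.conj, h.type_frame, h.inner_self]
    with z h1 h2 h3 h4 h5 h6 h7 h7' h8 h9 h9' h10 h11 h12 h13
  have hGu : inner ℂ (G z) (u z) = 0 := inner_eq_zero_of_type h11 h12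
  -- `∂̄ s` is a combination of `G` and `u`
  obtain ⟨α, β, hαβ⟩ : ∃ α β : ℂ, pzb (secondDeriv u) z = α • G z + β • u z := by
    have e1 : pzb (pz u) z = pz (fun y => -(((starRingEnd ℂ) y ^ k * inner ℂ (u y) (u y)) • G y)) z := by
      rw [wirt_comm h2]
      exact wirt_congr_at h7'
    have h4' : ContDiffAt ℝ ∞ (fun y => (starRingEnd ℂ) y ^ k * inner ℂ (u y) (u y)) z := h4
    have h5' : ContDiffAt ℝ ∞
      (fun y => (inner ℂ (u y) (u y))⁻¹ * inner ℂ (u y) (pz u y)) z := h5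
    have e2 : pzb (secondDeriv u) z = pzb (pz u) z -
        pzb (fun y => ((inner ℂ (u y) (u y))⁻¹ * inner ℂ (u y) (pz u y)) • u y) z :=
      wirt_sub (contDiffAt_wirt h2).diffAt (h5'.smul h2).diffAt
    rw [e2, e1, wirt_neg, wirt_smul h4'.diffAt h1.diffAt, wirt_smul h5'.diffAt h2.diffAt, h6, h7]
    refine ⟨-pz (fun y => (starRingEnd ℂ) y ^ k * inner ℂ (u y) (u y)) z
      + ((inner ℂ (u z) (u z))⁻¹ * inner ℂ (u z) (pz u z)) *
        ((starRingEnd ℂ) z ^ k * inner ℂ (u z) (u z)),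
      -((starRingEnd ℂ) z ^ k * inner ℂ (u z) (u z)) * z ^ k
      - pzb (fun y => (inner ℂ (u y) (u y))⁻¹ * inner ℂ (u y) (pz u y)) z, ?_⟩
    module
  have h0 : ∀ {f : ℂ → ℂ}, (∀ᶠ y in 𝓝 z, f y = 0) → pzb f z = 0 := fun {f} hf => by
    rw [wirt_congr_at (g := fun _ => (0 : ℂ)) hf, wirt_const]
  have e3 := h0 h8
  rw [wirt_inner h1.diffAt h3.diffAt, Complex.conj_I, h6, inner_smul_left, h9, mul_zero, zero_add,
    hαβ, inner_add_right, inner_smul_right, inner_smul_right, h13, hGu, mul_one, mul_zero,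
    add_zero] at e3
  have e4 := h0 h9'
  have hUz : inner ℂ (u z) (u z) ≠ 0 := inner_self_ne_zero.2 h10
  rw [wirt_inner h2.diffAt h3.diffAt, Complex.conj_I, pz_eq_add_secondDeriv u z, inner_add_left,
    inner_smul_left, h9, mul_zero, zero_add, hαβ, e3, zero_smul, zero_add, inner_smul_right] at e4
  rw [hαβ, e3, zero_smul, zero_add, smul_smul, ← neg_smul]
  congr 1
  field_simp
  linear_combination e4

/-- The second derivative of an almost complex germ vanishes identically or to a finite order. -/
theorem IsFirstFrame.secondDeriv_eventually_eq_zero_or (h : IsFirstFrame G u k) :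
    (∀ᶠ z in 𝓝 (0 : ℂ), secondDeriv u z = 0) ∨ ∃ (l : ℕ) (w : ℂ → C7), SmoothNear w ∧ w 0 ≠ 0 ∧
      ∀ᶠ z in 𝓝 (0 : ℂ), secondDeriv u z = z ^ l • w z := by
  have hU := h.smooth_frame.inner h.smooth_frame
  refine eventually_eq_zero_or_exists_pow_smul (h.smooth_frame.secondDeriv h.ne_zero)
    ((hU.inv (inner_self_ne_zero.2 h.ne_zero)).smul h.smooth_frame) h.pzb_secondDeriv ?_
  filter_upwards [h.eventually_ne_zero] with z hz
  rw [inner_smul_left, inner_secondDeriv hz, mul_zero]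

/-- `w` is the second derivative with its zero of order `l` divided out. -/
structure IsSecondFrame (G u w : ℂ → C7) (k l : ℕ) : Prop extends IsFirstFrame G u k where
  smooth_second : SmoothNear w
  second_ne_zero : w 0 ≠ 0
  secondDeriv_eq : ∀ᶠ z in 𝓝 (0 : ℂ), secondDeriv u z = z ^ l • w z

theorem IsSecondFrame.pz_frame (h : IsSecondFrame G u w k l) : ∀ᶠ z in 𝓝 (0 : ℂ),
    pz u z = ((inner ℂ (u z) (u z))⁻¹ * inner ℂ (u z) (pz u z)) • u z + z ^ l • w z := by
  filter_upwards [h.secondDeriv_eq] with z hz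
  rw [← hz]
  exact pz_eq_add_secondDeriv u z

theorem IsSecondFrame.type_second (h : IsSecondFrame G u w k l) :
    ∀ᶠ z in 𝓝 (0 : ℂ), cross (G z) (w z) = Complex.I • w z := by
  refine eventuallyEq_of_punctured (h.smooth.cross h.smooth_second).continuousAt
    ((smoothNear_const Complex.I).smul h.smooth_second).continuousAt ?_
  filter_upwards [h.type_secondDeriv, h.secondDeriv_eq] with z h1 h2 hz
  rw [h2, cross_smul_right, smul_comm] at h1
  exact smul_right_injective _ (pow_ne_zero l hz) h1

theorem IsSecondFrame.inner_eq_zero (h : IsSecondFrame G u w k l) :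
    ∀ᶠ z in 𝓝 (0 : ℂ), inner ℂ (u z) (w z) = 0 := by
  refine eventuallyEq_of_punctured (h.smooth_frame.inner h.smooth_second).continuousAt
    continuousAt_const ?_
  filter_upwards [h.eventually_ne_zero, h.secondDeriv_eq] with z h1 h2 hz
  have h3 := inner_secondDeriv h1
  rw [h2, inner_smul_right] at h3
  exact (mul_eq_zero.1 h3).resolve_left (pow_ne_zero l hz)

theorem IsSecondFrame.pzb_second (h : IsSecondFrame G u w k l) : ∀ᶠ z in 𝓝 (0 : ℂ),
    pzb w z = -(((starRingEnd ℂ) z ^ l * (inner ℂ (w z) (w z) * (inner ℂ (u z) (u z))⁻¹)) • u z) := by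
  have hU := h.smooth_frame.inner h.smooth_frame
  refine eventuallyEq_of_punctured (h.smooth_second.wirt _).continuousAt
    ((((smoothNear_conj_pow l).smul ((h.smooth_second.inner h.smooth_second).smul
      (hU.inv (inner_self_ne_zero.2 h.ne_zero)))).smul
      h.smooth_frame).neg).continuousAt ?_
  filter_upwards [h.pzb_secondDeriv, h.secondDeriv_eq, h.secondDeriv_eq.eventually_nhds,
    h.smooth_second] with z h1 h2 h2' h3 hz
  have e : pzb (secondDeriv u) z = pzb (fun y => y ^ l • w y) z := wirt_congr_at h2'
  rw [e, pzb_pow_smul h3.diffAt, h2, inner_smul_left, inner_smul_right, map_pow] at h1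
  refine smul_right_injective _ (pow_ne_zero l hz) ?_
  simp only [h1]
  module

theorem IsSecondFrame.isAdapted (h : IsSecondFrame G u w k l) :
    ∀ᶠ z in 𝓝 (0 : ℂ), IsAdapted (G z) (u z) (w z) := by
  filter_upwards [h.conj, h.inner_self, h.type_frame, h.type_second, h.inner_eq_zero,
    h.eventually_ne_zero, h.smooth_second.eventually_ne h.second_ne_zero]
    with z h1 h2 h3 h4 h5 h6 h7
  refine ⟨h1, fun h0 => ?_, h3, h4, h5, h6, h7⟩
  rw [h0, inner_zero_left] at h2
  exact zero_ne_one h2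

end Germ

/-! ### Derivatives of the frame of the flag -/

section Legs

variable {G u w : ℂ → C7} {k l : ℕ}

/-- The frame of the flag attached to `G`, `u`, `w`. -/
def legFrame (G u w : ℂ → C7) (i : ℤ) (z : ℂ) : C7 := legVec (G z) (u z) (w z) i

theorem IsSecondFrame.smoothNear_legFrame (h : IsSecondFrame G u w k l) (i : ℤ) :
    SmoothNear (legFrame G u w i) := by
  by_cases hi : 3 < |i|
  · exact (smoothNear_const (0 : C7)).congr
      (Filter.Eventually.of_forall fun z => legVec_eq_zero hi)
  · obtain ⟨h1, h2⟩ := abs_le.1 (not_lt.1 hi)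
    interval_cases i
    exacts [(h.smooth_frame.cross h.smooth_second).conjVec, h.smooth_second.conjVec,
      h.smooth_frame.conjVec, h.smooth, h.smooth_frame, h.smooth_second,
      h.smooth_frame.cross h.smooth_second]

/-- Orthogonality and reality of the frame make the matrix of `∂/∂z` skew about the
antidiagonal. -/
theorem IsSecondFrame.inner_pz_legFrame (h : IsSecondFrame G u w k l) {i j : ℤ} (hij : i ≠ j) :
    ∀ᶠ z in 𝓝 (0 : ℂ), inner ℂ (legFrame G u w j z) (pz (legFrame G u w i) z)
      = - inner ℂ (legFrame G u w (-i) z) (pz (legFrame G u w (-j)) z) := by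
  have horth : ∀ᶠ z in 𝓝 (0 : ℂ), inner ℂ (legFrame G u w j z) (legFrame G u w i z) = 0 := by
    filter_upwards [h.isAdapted] with z hz using hz.inner_legVec hij.symm
  have hconj : ∀ m, ∀ᶠ z in 𝓝 (0 : ℂ), legFrame G u w (-m) z = conjVec (legFrame G u w m z) := by
    intro m
    filter_upwards [h.conj] with z hz using legVec_neg hz m
  filter_upwards [horth.eventually_nhds, hconj i, (hconj j).eventually_nhds,
    h.smoothNear_legFrame i, h.smoothNear_legFrame j] with z h1 h2 h3 h4 h5
  have e1 : pz (fun y => inner ℂ (legFrame G u w j y) (legFrame G u w i y)) z = 0 := by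
    rw [wirt_congr_at (g := fun _ => (0 : ℂ)) h1, wirt_const]
  rw [wirt_inner h5.diffAt h4.diffAt, map_neg, Complex.conj_I, neg_neg] at e1
  have e2 : pz (legFrame G u w (-j)) z = conjVec (pzb (legFrame G u w j) z) := by
    rw [wirt_congr_at (g := fun y => conjVec (legFrame G u w j y)) h3, wirt_conjVec h5.diffAt,
      map_neg, Complex.conj_I, neg_neg]
  rw [e2, h2, inner_conjVec_conjVec, inner_conj_symm]
  linear_combination e1

/-- The symmetry `(i, j) ↦ (-j, -i)` reduces the vanishing off the arrows to the rows `0`, `±1`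
and `-2`. -/
theorem forall_of_rows {P : ℤ → ℤ → Prop} (symm : ∀ i j, i ≠ j → P (-j) (-i) → P i j)
    (anti : ∀ i, i ≠ 0 → P i (-i)) (row0 : ∀ j, j ≠ 0 → j ≠ 1 → P 0 j)
    (row1 : ∀ j, j ≠ 1 → j ≠ 2 → P 1 j) (row1' : ∀ j, j ≠ -1 → j ≠ 0 → P (-1) j)
    (row2' : ∀ j, j ≠ -2 → j ≠ -1 → P (-2) j) {i j : ℤ} (hi : |i| ≤ 3) (hj : |j| ≤ 3)
    (hij : i ≠ j) (hA : ¬ IsArrow i j) : P i j := by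
  have rows : ∀ i j, |j| ≤ 3 → i ≠ j → ¬ IsArrow i j → (i = 0 ∨ i = 1 ∨ i = -1 ∨ i = -2) →
      P i j := by
    rintro i j - hij hA (rfl | rfl | rfl | rfl)
    · exact row0 j hij.symm fun h => hA (Or.inl (by omega))
    · exact row1 j hij.symm fun h => hA (Or.inl (by omega))
    · exact row1' j hij.symm fun h => hA (Or.inl (by omega))
    · exact row2' j hij.symm fun h => hA (Or.inl (by omega))
  by_cases h1 : i = 0 ∨ i = 1 ∨ i = -1 ∨ i = -2
  · exact rows i j hj hij hA h1
  by_cases h2 : i = -j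
  · subst h2
    have := anti (-j) (by omega)
    rwa [neg_neg] at this
  · refine symm i j hij (rows _ _ (by rwa [abs_neg]) (by omega) (fun h => hA ?_) ?_)
    · unfold IsArrow at h ⊢
      omega
    · obtain ⟨h3, h4⟩ := abs_le.1 hi
      obtain ⟨h5, h6⟩ := abs_le.1 hj
      unfold IsArrow at hA
      omega

/-- The derivatives of the frame have components along the arrows of the diagram only. -/
theorem IsSecondFrame.inner_pz_legFrame_eq_zero (h : IsSecondFrame G u w k l) {i j : ℤ}
    (hi : |i| ≤ 3) (hj : |j| ≤ 3) (hij : i ≠ j) (hA : ¬ IsArrow i j) :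
    ∀ᶠ z in 𝓝 (0 : ℂ), inner ℂ (legFrame G u w j z) (pz (legFrame G u w i) z) = 0 := by
  have horth : ∀ {i j : ℤ}, i ≠ j →
      ∀ᶠ z in 𝓝 (0 : ℂ), inner ℂ (legFrame G u w i z) (legFrame G u w j z) = 0 := by
    intro i j hij
    filter_upwards [h.isAdapted] with z hz using hz.inner_legVec hij
  refine forall_of_rows (P := fun i j => ∀ᶠ z in 𝓝 (0 : ℂ),
    inner ℂ (legFrame G u w j z) (pz (legFrame G u w i) z) = 0) ?_ ?_ ?_ ?_ ?_ ?_ hi hj hij hA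
  · intro i j hij h1
    filter_upwards [h1, h.inner_pz_legFrame hij] with z h2 h3
    rw [h3, h2, neg_zero]
  · intro i hi
    filter_upwards [h.inner_pz_legFrame (i := i) (j := -i) (by omega)] with z h3
    rw [neg_neg] at h3
    exact self_eq_neg.1 h3
  · intro j h0 h1
    filter_upwards [horth h1, h.pz_base] with z h2 h3
    have e : pz (legFrame G u w 0) z = z ^ k • legFrame G u w 1 z := h3
    rw [e, inner_smul_right, h2, mul_zero]
  · intro j h0 h1
    filter_upwards [horth h0, horth h1, h.pz_frame] with z h2 h3 h4
    have e : pz (legFrame G u w 1) z = _ • legFrame G u w 1 z + z ^ l • legFrame G u w 2 z := h4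
    rw [e, inner_add_right, inner_smul_right, inner_smul_right, h2, h3, mul_zero, mul_zero,
      add_zero]
  · intro j h0 h1
    filter_upwards [horth h1, h.pzb_frame, h.conj, h.smooth_frame] with z h2 h3 h4 h5
    have e : pz (legFrame G u w (-1)) z
        = -((starRingEnd ℂ) ((starRingEnd ℂ) z ^ k * inner ℂ (u z) (u z))
          • legFrame G u w 0 z) := by
      refine (wirt_conjVec (c := -Complex.I) h5.diffAt).trans ?_
      rw [map_neg, Complex.conj_I, neg_neg, h3, conjVec_neg, conjVec_smul, h4]
      rfl
    rw [e, inner_neg_right, inner_smul_right, h2, mul_zero, neg_zero]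
  · intro j h0 h1
    filter_upwards [horth h1, h.pzb_second, h.smooth_second] with z h2 h3 h5
    have e : pz (legFrame G u w (-2)) z
        = -((starRingEnd ℂ) ((starRingEnd ℂ) z ^ l *
          (inner ℂ (w z) (w z) * (inner ℂ (u z) (u z))⁻¹)) • legFrame G u w (-1) z) := by
      refine (wirt_conjVec (c := -Complex.I) h5.diffAt).trans ?_
      rw [map_neg, Complex.conj_I, neg_neg, h3, conjVec_neg, conjVec_smul]
      rfl
    rw [e, inner_neg_right, inner_smul_right, h2, mul_zero, neg_zero]

end Legs

/-! ### Frames of the Gauss bundles -/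

section Surface

variable {M : Type*} [TopologicalSpace M] [ChartedSpace ℂ M]

/-- The map `F` as a `ℂ⁷`-valued function of the local parameter at `p`. -/
def germ (F : M → S6) (p : M) (z : ℂ) : C7 := complexify (toR7 F (param p z))

theorem norm_toR7 (F : M → S6) (p : M) : ‖toR7 F p‖ = 1 := by
  have := (F p).2
  rwa [mem_sphere_zero_iff_norm] at this

theorem inner_germ_self (F : M → S6) (p : M) (z : ℂ) : inner ℂ (germ F p z) (germ F p z) = 1 := by
  rw [germ, inner_complexify, real_inner_self_eq_norm_sq, norm_toR7]
  simp

variable [IsManifold 𝓘(ℂ, ℂ) ω M] {F : M → S6}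

theorem IsAlmostComplex.contMDiff_toR7 (hF : IsAlmostComplex F) :
    ContMDiff 𝓘(ℝ, ℂ) 𝓘(ℝ, R7) ∞ (toR7 F) :=
  have := Fact.mk (@finrank_euclideanSpace_fin ℝ _ (6 + 1))
  (contMDiff_coe_sphere (E := EuclideanSpace ℝ (Fin (6 + 1))) (n := 6)).comp hF.1

theorem IsAlmostComplex.smoothNear_toR7 (hF : IsAlmostComplex F) (p : M) :
    SmoothNear fun z => toR7 F (param p z) :=
  smoothNear_comp_param hF.contMDiff_toR7 p

theorem IsAlmostComplex.isAlmostComplexGerm (hF : IsAlmostComplex F) (p : M) :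
    IsAlmostComplexGerm (germ F p) where
  smooth := by
    filter_upwards [hF.smoothNear_toR7 p] with z hz
    exact complexifyL.contDiff.contDiffAt.comp z hz
  conj := Filter.Eventually.of_forall fun z => conjVec_complexify _
  inner_self := Filter.Eventually.of_forall fun z => inner_germ_self F p z
  type := by
    filter_upwards [hF.smoothNear_toR7 p, eventually_realDeriv_param p] with z hz ⟨τ, hτ, h⟩
    have h1 := (h (toR7 F) hz.diffAt).2
    set D := fderiv ℝ (fun y => toR7 F (param p y)) z with hD
    have h2 : ∀ v, D (Complex.I * v) = cross (toR7 F (param p z)) (D v) := by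
      intro v
      have h3 := hF.2 (param p z) (τ⁻¹ * v)
      rw [h1, h1, mul_inv_cancel_left₀ hτ] at h3
      rw [← h3]
      congr 1
      field_simp
    have h4 : ∀ v, fderiv ℝ (germ F p) z v = complexify (D v) := by
      intro v
      have := (complexifyL.hasFDerivAt.comp z hz.diffAt.hasFDerivAt).fderiv
      change fderiv ℝ (complexifyL ∘ fun y => toR7 F (param p y)) z v = _
      rw [this]
      rfl
    have h5 := h2 1
    have h6 := h2 Complex.I
    rw [mul_one] at h5
    rw [Complex.I_mul_I, map_neg] at h6
    have h7 : complexify (-D 1) = -complexify (D 1) := complexifyL.map_neg _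
    simp only [wirt, h4, cross_smul_right, cross_add_right]
    rw [germ, cross_complexify, cross_complexify, ← h5, ← h6, h7]
    match_scalars
    · linear_combination (1 / 2 : ℂ) * Complex.I_sq
    · ring

/-- An almost complex map is constant, or its derivative has isolated zeros. -/
theorem IsAlmostComplex.exists_isFirstFrame [T2Space M] [ConnectedSpace M]
    (hF : IsAlmostComplex F) (hnc : ∃ p q : M, F p ≠ F q) (p : M) :
    ∃ u k, IsFirstFrame (germ F p) u k := by
  have hP : ∀ p : M, ∀ᶠ z in 𝓝 (0 : ℂ),
      (dz (fun q => complexify (toR7 F q)) (param p z) = 0 ↔ pz (germ F p) z = 0) := by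
    intro p
    filter_upwards [(hF.isAlmostComplexGerm p).smooth, eventually_dz_param p] with z hz ⟨τ, hτ, h⟩
    rw [(h (fun q => complexify (toR7 F q)) hz.diffAt).2.1]
    exact smul_eq_zero_iff_right hτ
  have hdich := forall_or_forall_eventually_not (X := M)
    (P := fun q => dz (fun q => complexify (toR7 F q)) q = 0) neBot_punctured_nhds fun p => by
      rcases (hF.isAlmostComplexGerm p).eventually_eq_zero_or with h | ⟨k, u, hu, hu0, h⟩
      · refine Or.inl (eventually_nhds_iff_param.2 ?_)
        filter_upwards [hP p, h] with z h1 h2 using h1.2 h2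
      · refine Or.inr (eventually_punctured_iff_param.2 ?_)
        filter_upwards [hP p, h, hu.eventually_ne hu0] with z h1 h2 h3 hz h4
        have h5 := h1.1 h4
        rw [h2] at h5
        exact smul_ne_zero (pow_ne_zero k hz) h3 h5
  rcases hdich with h | h
  · exfalso
    obtain ⟨a, b, hab⟩ := hnc
    refine hab (Subtype.ext (complexify_injective ?_))
    refine apply_eq_of_wirt_eq_zero (g := fun q => complexify (toR7 F q)) (fun p => ?_) a b
    have hG := hF.isAlmostComplexGerm p
    filter_upwards [hP p, hG.pzb_eq, hG.smooth] with z h2 h3 h4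
    have h5 := h2.1 (h _)
    refine ⟨h4.diffAt, h5, h3.trans ?_⟩
    rw [h5, conjVec_eq_zero.2 rfl]
  · rcases (hF.isAlmostComplexGerm p).eventually_eq_zero_or with h1 | ⟨k, u, hu, hu0, h1⟩
    · exfalso
      have h2 := eventually_punctured_iff_param.1 (h p)
      have h3 : ∀ᶠ z in 𝓝[≠] (0 : ℂ), False := by
        rw [eventually_nhdsWithin_iff]
        filter_upwards [h2, hP p, h1] with z h4 h5 h6 hz
        exact h4 hz (h5.2 h6)
      exact (NormedField.nhdsNE_neBot (0 : ℂ)).ne (Filter.eventually_false_iff_eq_bot.1 h3)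
    · exact ⟨u, k, hF.isAlmostComplexGerm p, hu, hu0, h1⟩

theorem IsAlmostComplex.isFrame_lineOf (hF : IsAlmostComplex F) (p : M) :
    IsFrame (lineOf F) p (germ F p) := by
  refine ⟨(hF.isAlmostComplexGerm p).smooth, Filter.Eventually.of_forall fun z => ⟨fun h => ?_, rfl⟩⟩
  have h1 := inner_germ_self F p z
  rw [h, inner_zero_left] at h1
  exact zero_ne_one h1

theorem IsAlmostComplex.isSmoothSubbundle_lineOf (hF : IsAlmostComplex F) :
    IsSmoothSubbundle (lineOf F) :=
  isSmoothSubbundle_of_isFrame fun p => ⟨_, hF.isFrame_lineOf p⟩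

variable [T2Space M] {p : M} {u w : ℂ → C7} {k l : ℕ}

theorem IsFirstFrame.isFrame_gaussPrime (h : IsFirstFrame (germ F p) u k)
    (hF : IsAlmostComplex F) : IsFrame (gaussPrime (lineOf F)) p u := by
  refine AlmostComplexS6.isFrame_gaussPrime hF.isSmoothSubbundle_lineOf (hF.isFrame_lineOf p)
    h.smooth_frame h.ne_zero (a := 0) (m := fun z => z ^ k) (fun z hz => pow_ne_zero k hz) ?_ ?_
  · filter_upwards [h.pz_base] with z hz
    simp [hz]
  · filter_upwards [h.conj, h.type_frame] with z h1 h2 using inner_eq_zero_of_type h1 h2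

theorem IsFirstFrame.isFrame_gaussDoublePrime (h : IsFirstFrame (germ F p) u k)
    (hF : IsAlmostComplex F) :
    IsFrame (gaussDoublePrime (lineOf F)) p fun z => conjVec (u z) := by
  refine AlmostComplexS6.isFrame_gaussDoublePrime hF.isSmoothSubbundle_lineOf
    (hF.isFrame_lineOf p) h.smooth_frame.conjVec (fun h0 => h.ne_zero (conjVec_eq_zero.1 h0))
    (a := 0) (m := fun z => (starRingEnd ℂ) z ^ k)
    (fun z hz => pow_ne_zero k (by simpa using hz)) ?_ ?_
  · filter_upwards [h.pzb_base] with z hz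
    simp [hz]
  · filter_upwards [h.conj, h.type_frame] with z h1 h2
    rw [← h1, inner_conjVec_conjVec, inner_eq_zero_of_type h1 h2, map_zero]

theorem IsSecondFrame.isFrame_gaussPrime_two (h : IsSecondFrame (germ F p) u w k l)
    (hF : IsAlmostComplex F) (h1 : IsSmoothSubbundle (gaussPrime (lineOf F))) :
    IsFrame (gaussPrime (gaussPrime (lineOf F))) p w :=
  AlmostComplexS6.isFrame_gaussPrime h1 (h.isFrame_gaussPrime hF) h.smooth_second h.second_ne_zero
    (fun _ hz => pow_ne_zero l hz) h.pz_frame h.inner_eq_zero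

theorem IsSecondFrame.isFrame_gaussDoublePrime_two (h : IsSecondFrame (germ F p) u w k l)
    (hF : IsAlmostComplex F) (h1 : IsSmoothSubbundle (gaussDoublePrime (lineOf F))) :
    IsFrame (gaussDoublePrime (gaussDoublePrime (lineOf F))) p fun z => conjVec (w z) := by
  refine AlmostComplexS6.isFrame_gaussDoublePrime h1 (h.isFrame_gaussDoublePrime hF)
    h.smooth_second.conjVec (fun h0 => h.second_ne_zero (conjVec_eq_zero.1 h0))
    (a := fun z => (starRingEnd ℂ) ((inner ℂ (u z) (u z))⁻¹ * inner ℂ (u z) (pz u z)))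
    (m := fun z => (starRingEnd ℂ) z ^ l)
    (fun z hz => pow_ne_zero l (by simpa using hz)) ?_ ?_
  · filter_upwards [h.pz_frame, h.smooth_frame] with y h2 h3
    have e := congrArg conjVec h2
    rw [conjVec_add, conjVec_smul, conjVec_smul, map_pow] at e
    rw [wirt_conjVec h3.diffAt, Complex.conj_I]
    exact e
  · filter_upwards [h.inner_eq_zero] with z h2
    rw [inner_conjVec_conjVec, h2, map_zero]

/-- The second fundamental form of `f₁` vanishes exactly where the second derivative does. -/
theorem IsFirstFrame.eventually_secondForm_eq_zero_iff (h : IsFirstFrame (germ F p) u k)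
    (hF : IsAlmostComplex F) (h1 : IsSmoothSubbundle (gaussPrime (lineOf F))) :
    ∀ᶠ z in 𝓝 (0 : ℂ), (secondForm (gaussPrime (lineOf F))
      (fun x => (gaussPrime (lineOf F) x)ᗮ) (param p z) = 0 ↔ secondDeriv u z = 0) := by
  have hfr := h.isFrame_gaussPrime hF
  filter_upwards [eventually_secondForm_frame h1 hfr, hfr.2] with z ⟨hm, τ, hτ, h2⟩ ⟨h3, h4⟩
  have h5 := (h2 (fun x => (gaussPrime (lineOf F) x)ᗮ) (Submodule.isOrtho_orthogonal_right _)).1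
  have h6 : (gaussPrime (lineOf F) (param p z))ᗮ.starProjection (pz u z) = secondDeriv u z := by
    rw [pz_eq_add_secondDeriv u z, map_add, map_smul]
    have e1 : (gaussPrime (lineOf F) (param p z))ᗮ.starProjection (u z) = 0 := by
      rw [Submodule.starProjection_apply_eq_zero_iff]
      exact Submodule.le_orthogonal_orthogonal _ hm
    have e2 : (gaussPrime (lineOf F) (param p z))ᗮ.starProjection (secondDeriv u z)
        = secondDeriv u z := by
      rw [Submodule.starProjection_eq_self_iff, h4,
        Submodule.mem_orthogonal_singleton_iff_inner_right]
      exact inner_secondDeriv h3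
    rw [e1, e2, smul_zero, zero_add]
  rw [h6] at h5
  constructor
  · intro h7
    rw [h7] at h5
    exact (smul_eq_zero_iff_right hτ).1 h5.symm
  · intro h7
    rw [h7, smul_zero] at h5
    ext ⟨x, hx⟩ : 1
    obtain ⟨c, rfl⟩ := Submodule.mem_span_singleton.1 (h4 ▸ hx)
    have h8 := Subtype.ext (a2 := (0 : ((gaussPrime (lineOf F) (param p z))ᗮ : Submodule ℂ C7))) h5
    have h9 := (secondForm (gaussPrime (lineOf F))
      (fun x => (gaussPrime (lineOf F) x)ᗮ) (param p z)).map_smul c ⟨u z, hm⟩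
    rw [h8, smul_zero] at h9
    exact h9

theorem IsAlmostComplex.isSmoothSubbundle_gaussPrime [ConnectedSpace M] (hF : IsAlmostComplex F)
    (hnc : ∃ p q : M, F p ≠ F q) : IsSmoothSubbundle (gaussPrime (lineOf F)) :=
  isSmoothSubbundle_of_isFrame fun p => by
    obtain ⟨u, k, h⟩ := hF.exists_isFirstFrame hnc p
    exact ⟨u, h.isFrame_gaussPrime hF⟩

theorem IsAlmostComplex.isSmoothSubbundle_gaussDoublePrime [ConnectedSpace M]
    (hF : IsAlmostComplex F) (hnc : ∃ p q : M, F p ≠ F q) :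
    IsSmoothSubbundle (gaussDoublePrime (lineOf F)) :=
  isSmoothSubbundle_of_isFrame fun p => by
    obtain ⟨u, k, h⟩ := hF.exists_isFirstFrame hnc p
    exact ⟨_, h.isFrame_gaussDoublePrime hF⟩

/-- The second fundamental form of `f₁` vanishes identically, or its zeros can be divided out. -/
theorem IsAlmostComplex.forall_secondDeriv_or [ConnectedSpace M] (hF : IsAlmostComplex F)
    (hnc : ∃ p q : M, F p ≠ F q) :
    (∀ p, ∃ u k, IsFirstFrame (germ F p) u k ∧ ∀ᶠ z in 𝓝 (0 : ℂ), secondDeriv u z = 0) ∨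
    ∀ p, ∃ u w k l, IsSecondFrame (germ F p) u w k l := by
  have hs := hF.isSmoothSubbundle_gaussPrime hnc
  rcases forall_or_forall_eventually_not (X := M)
    (P := fun q => secondForm (gaussPrime (lineOf F))
      (fun x => (gaussPrime (lineOf F) x)ᗮ) q = 0) neBot_punctured_nhds fun p => by
      obtain ⟨u, k, h⟩ := hF.exists_isFirstFrame hnc p
      rcases h.secondDeriv_eventually_eq_zero_or with h1 | ⟨l, w, hw, hw0, h1⟩
      · refine Or.inl (eventually_nhds_iff_param.2 ?_)
        filter_upwards [h.eventually_secondForm_eq_zero_iff hF hs, h1] with z h2 h3 using h2.2 h3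
      · refine Or.inr (eventually_punctured_iff_param.2 ?_)
        filter_upwards [h.eventually_secondForm_eq_zero_iff hF hs, h1, hw.eventually_ne hw0]
          with z h2 h3 h4 hz h5
        have h6 := h2.1 h5
        rw [h3] at h6
        exact smul_ne_zero (pow_ne_zero l hz) h4 h6 with h | h
  · refine Or.inl fun p => ?_
    obtain ⟨u, k, hu⟩ := hF.exists_isFirstFrame hnc p
    refine ⟨u, k, hu, ?_⟩
    filter_upwards [hu.eventually_secondForm_eq_zero_iff hF hs] with z hz using hz.1 (h _)
  · refine Or.inr fun p => ?_
    obtain ⟨u, k, hu⟩ := hF.exists_isFirstFrame hnc p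
    rcases hu.secondDeriv_eventually_eq_zero_or with h1 | ⟨l, w, hw, hw0, h1⟩
    · exfalso
      have h2 := eventually_punctured_iff_param.1 (h p)
      have h3 : ∀ᶠ z in 𝓝[≠] (0 : ℂ), False := by
        rw [eventually_nhdsWithin_iff]
        filter_upwards [h2, hu.eventually_secondForm_eq_zero_iff hF hs, h1] with z h4 h5 h6 hz
        exact h4 hz (h5.2 h6)
      exact (NormedField.nhdsNE_neBot (0 : ℂ)).ne (Filter.eventually_false_iff_eq_bot.1 h3)
    · exact ⟨u, w, k, l, hu, hw, hw0, h1⟩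

end Surface

/-! ### The flag of Gauss bundles -/

section FlagBundle

variable {M : Type*} [TopologicalSpace M] [ChartedSpace ℂ M]

/-- The span of the products of vectors in two subspaces. -/
def crossSpan (A B : Submodule ℂ C7) : Submodule ℂ C7 :=
  Submodule.span ℂ {x | ∃ a ∈ A, ∃ b ∈ B, cross a b = x}

theorem crossSpan_span_singleton (a b : C7) :
    crossSpan (Submodule.span ℂ {a}) (Submodule.span ℂ {b}) = Submodule.span ℂ {cross a b} := by
  refine le_antisymm (Submodule.span_le.2 ?_) ((Submodule.span_singleton_le_iff_mem _ _).2
    (Submodule.subset_span ⟨a, Submodule.mem_span_singleton_self a, b,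
      Submodule.mem_span_singleton_self b, rfl⟩))
  rintro x ⟨a', ha, b', hb, rfl⟩
  obtain ⟨c, rfl⟩ := Submodule.mem_span_singleton.1 ha
  obtain ⟨d, rfl⟩ := Submodule.mem_span_singleton.1 hb
  rw [cross_smul_left, cross_smul_right]
  exact Submodule.smul_mem _ _ (Submodule.smul_mem _ _ (Submodule.mem_span_singleton_self _))

/-- The Gauss bundles `G⁽ⁱ⁾(f)` for `|i| ≤ 2`, completed by the products of `G⁽¹⁾(f)` and
`G⁽²⁾(f)` and of `G⁽⁻¹⁾(f)` and `G⁽⁻²⁾(f)`. -/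
def flagBundle (F : M → S6) (i : ℤ) : M → Submodule ℂ C7 :=
  if |i| ≤ 2 then gaussBundle (lineOf F) i
  else if i = 3 then fun p => crossSpan (gaussBundle (lineOf F) 1 p) (gaussBundle (lineOf F) 2 p)
  else if i = -3 then
    fun p => crossSpan (gaussBundle (lineOf F) (-1) p) (gaussBundle (lineOf F) (-2) p)
  else fun _ => ⊥

theorem flagBundle_eq_bot (F : M → S6) {i : ℤ} (hi : 3 < |i|) : flagBundle F i = fun _ => ⊥ := by
  rw [flagBundle, if_neg (by omega), if_neg, if_neg]
  · rintro rfl; norm_num at hi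
  · rintro rfl; norm_num at hi

variable [IsManifold 𝓘(ℂ, ℂ) ω M] [T2Space M] [ConnectedSpace M] {F : M → S6}
  {p : M} {u w : ℂ → C7} {k l : ℕ}

theorem IsSecondFrame.isFrame_flagBundle (h : IsSecondFrame (germ F p) u w k l)
    (hF : IsAlmostComplex F) (hnc : ∃ p q : M, F p ≠ F q) {i : ℤ} (hi : |i| ≤ 3) :
    IsFrame (flagBundle F i) p (legFrame (germ F p) u w i) := by
  have f0 : IsFrame (gaussBundle (lineOf F) 0) p (germ F p) := hF.isFrame_lineOf p
  have f1 : IsFrame (gaussBundle (lineOf F) 1) p u := h.isFrame_gaussPrime hF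
  have f2 : IsFrame (gaussBundle (lineOf F) 2) p w :=
    h.isFrame_gaussPrime_two hF (hF.isSmoothSubbundle_gaussPrime hnc)
  have f1' : IsFrame (gaussBundle (lineOf F) (-1)) p fun z => conjVec (u z) :=
    h.isFrame_gaussDoublePrime hF
  have f2' : IsFrame (gaussBundle (lineOf F) (-2)) p fun z => conjVec (w z) :=
    h.isFrame_gaussDoublePrime_two hF (hF.isSmoothSubbundle_gaussDoublePrime hnc)
  obtain ⟨h1, h2⟩ := abs_le.1 hi
  have hne : ∀ᶠ z in 𝓝 (0 : ℂ), legFrame (germ F p) u w i z ≠ 0 := by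
    filter_upwards [h.isAdapted] with z hz using hz.legVec_ne_zero hi
  have hsm := h.smoothNear_legFrame i
  interval_cases i
  · refine ⟨hsm, ?_⟩
    filter_upwards [hne, f1'.2, f2'.2] with z h3 h4 h5
    refine ⟨h3, ?_⟩
    have e : flagBundle F (-3) (param p z) = crossSpan (gaussBundle (lineOf F) (-1) (param p z))
      (gaussBundle (lineOf F) (-2) (param p z)) := rfl
    rw [e, h4.2, h5.2, crossSpan_span_singleton, cross_conjVec]
    rfl
  · exact f2'
  · exact f1'
  · exact f0
  · exact f1
  · exact f2
  · refine ⟨hsm, ?_⟩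
    filter_upwards [hne, f1.2, f2.2] with z h3 h4 h5
    refine ⟨h3, ?_⟩
    have e : flagBundle F 3 (param p z) = crossSpan (gaussBundle (lineOf F) 1 (param p z))
      (gaussBundle (lineOf F) 2 (param p z)) := rfl
    rw [e, h4.2, h5.2, crossSpan_span_singleton]
    rfl

theorem isSmoothSubbundle_flagBundle (hF : IsAlmostComplex F) (hnc : ∃ p q : M, F p ≠ F q)
    (h : ∀ p, ∃ u w k l, IsSecondFrame (germ F p) u w k l) (i : ℤ) :
    IsSmoothSubbundle (flagBundle F i) := by
  by_cases hi : |i| ≤ 3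
  · refine isSmoothSubbundle_of_isFrame fun p => ?_
    obtain ⟨u, w, k, l, hp⟩ := h p
    exact ⟨_, hp.isFrame_flagBundle hF hnc hi⟩
  · rw [flagBundle_eq_bot F (not_le.1 hi)]
    exact (contMDiff_const : ContMDiff 𝓘(ℝ, ℂ) 𝓘(ℝ, C7 →L[ℂ] C7) ∞
      fun _ : M => (⊥ : Submodule ℂ C7).starProjection)

theorem isG2Flag_flagBundle (hF : IsAlmostComplex F) (hnc : ∃ p q : M, F p ≠ F q)
    (h : ∀ p, ∃ u w k l, IsSecondFrame (germ F p) u w k l) (p : M) :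
    IsG2Flag fun i => flagBundle F i p := by
  obtain ⟨u, w, k, l, hp⟩ := h p
  have e : (fun i => flagBundle F i p)
      = fun i => Submodule.span ℂ {legVec (germ F p 0) (u 0) (w 0) i} := by
    funext i
    by_cases hi : |i| ≤ 3
    · exact (hp.isFrame_flagBundle hF hnc hi).apply_zero.2
    · rw [flagBundle_eq_bot F (not_le.1 hi), legVec_eq_zero (not_le.1 hi),
        Submodule.span_singleton_eq_bot.2 rfl]
  rw [e]
  exact hp.isAdapted.self_of_nhds.isG2Flag

theorem secondForm_flagBundle_eq_zero (hF : IsAlmostComplex F) (hnc : ∃ p q : M, F p ≠ F q)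
    (h : ∀ p, ∃ u w k l, IsSecondFrame (germ F p) u w k l) {i j : ℤ} (hi : |i| ≤ 3)
    (hj : |j| ≤ 3) (hij : i ≠ j) (hA : ¬ IsArrow i j) (p : M) :
    secondForm (flagBundle F i) (flagBundle F j) p = 0 := by
  obtain ⟨u, w, k, l, hp⟩ := h p
  exact secondForm_eq_zero (isSmoothSubbundle_flagBundle hF hnc h i)
    (hp.isFrame_flagBundle hF hnc hi) (hp.isFrame_flagBundle hF hnc hj)
    ((isG2Flag_flagBundle hF hnc h p).orthogonal i j hij)
    (hp.inner_pz_legFrame_eq_zero hi hj hij hA).self_of_nhds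

end FlagBundle

/-! ### The constant plane when the second derivative vanishes -/

section Plane

theorem wirt_mul {c : ℂ} {a b : ℂ → ℂ} {z : ℂ} (ha : DifferentiableAt ℝ a z)
    (hb : DifferentiableAt ℝ b z) :
    wirt c (fun y => a y * b y) z = wirt c a z * b z + a z * wirt c b z :=
  wirt_smul ha hb

theorem wirt_inner_const {c : ℂ} {f : ℂ → C7} (x : C7) {z : ℂ} (hf : DifferentiableAt ℝ f z) :
    wirt c (fun y => inner ℂ (f y) x) z = inner ℂ (wirt ((starRingEnd ℂ) c) f z) x := by
  rw [wirt_inner (g := fun _ => x) hf (differentiableAt_const x), wirt_const, inner_zero_right,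
    add_zero]

/-- The orthogonal projection of `x` to the plane spanned by `G`, `u` and `ū`. -/
def planeProj (G u : ℂ → C7) (x : C7) (z : ℂ) : C7 :=
  inner ℂ (G z) x • G z + ((inner ℂ (u z) (u z))⁻¹ * inner ℂ (u z) x) • u z
    + ((inner ℂ (u z) (u z))⁻¹ * inner ℂ (conjVec (u z)) x) • conjVec (u z)

variable {G u : ℂ → C7} {k : ℕ}

theorem IsFirstFrame.smoothNear_planeProj (h : IsFirstFrame G u k) (x : C7) :
    SmoothNear (planeProj G u x) := by
  have hR := (h.smooth_frame.inner h.smooth_frame).inv (inner_self_ne_zero.2 h.ne_zero)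
  have hc := h.smooth_frame.conjVec
  exact (((h.smooth.inner (smoothNear_const x)).smul h.smooth).add
    ((hR.smul (h.smooth_frame.inner (smoothNear_const x))).smul h.smooth_frame)).add
    ((hR.smul (hc.inner (smoothNear_const x))).smul hc)

theorem conj_inner_self (x : C7) : (starRingEnd ℂ) (inner ℂ x x) = inner ℂ x x :=
  inner_conj_symm x x

/-- The terms of the derivative cancel in pairs: those from `∂G/∂z` against those from `∂ū/∂z` and
`∂u/∂z̄`, and those from `∂u/∂z` against those from the normalizing factor. -/
theorem IsFirstFrame.pz_planeProj (h : IsFirstFrame G u k)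
    (hs : ∀ᶠ z in 𝓝 (0 : ℂ), secondDeriv u z = 0) (x : C7) :
    ∀ᶠ z in 𝓝 (0 : ℂ), pz (planeProj G u x) z = 0 := by
  have hN := h.smooth_frame.inner h.smooth_frame
  have hR := hN.inv (inner_self_ne_zero.2 h.ne_zero)
  filter_upwards [hs, h.smooth, h.smooth_frame, hN, hR, h.pz_base, h.pzb_base, h.pzb_frame,
    h.eventually_ne_zero, h.eventually_ne_zero.eventually_nhds, h.conj, h.type_frame]
    with z h0 h1 h2 hN hR h3 h3' h4 h5 h5' h6 h7
  have dG := h1.diffAt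
  have du := h2.diffAt
  have dR := hR.diffAt
  have dc : DifferentiableAt ℝ (fun y => conjVec (u y)) z := (conjL.differentiableAt.comp z du)
  have hGu := inner_eq_zero_of_type h6 h7
  have hNR : inner ℂ (u z) (u z) * (inner ℂ (u z) (u z))⁻¹ = 1 :=
    mul_inv_cancel₀ (inner_self_ne_zero.2 h5)
  have hu := pz_eq_add_secondDeriv u z
  rw [h0, add_zero] at hu
  set a : ℂ := (inner ℂ (u z) (u z))⁻¹ * inner ℂ (u z) (pz u z) with ha
  have hc1 : pz (fun y => conjVec (u y)) z = -((z ^ k * inner ℂ (u z) (u z)) • G z) := by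
    rw [wirt_conjVec du, map_neg, Complex.conj_I, neg_neg, h4, conjVec_neg, conjVec_smul, h6,
      map_mul, conj_inner_self, map_pow, Complex.conj_conj]
  have hc2 : pzb (fun y => conjVec (u y)) z = (starRingEnd ℂ) a • conjVec (u z) := by
    rw [wirt_conjVec du, Complex.conj_I, hu, conjVec_smul]
  have hN1 : pz (fun y => inner ℂ (u y) (u y)) z = a * inner ℂ (u z) (u z) := by
    rw [wirt_inner du du, map_neg, Complex.conj_I, neg_neg, h4, hu, inner_neg_left,
      inner_smul_left, hGu, inner_smul_right]
    ring
  have hR1 : pz (fun y => (inner ℂ (u y) (u y))⁻¹) z = -(a * (inner ℂ (u z) (u z))⁻¹) := by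
    have e1 : pz (fun y => inner ℂ (u y) (u y) * (inner ℂ (u y) (u y))⁻¹) z = 0 := by
      rw [wirt_congr_at (g := fun _ => (1 : ℂ)), wirt_const]
      filter_upwards [h5'] with y hy using mul_inv_cancel₀ (inner_self_ne_zero.2 hy)
    rw [wirt_mul hN.diffAt dR, hN1] at e1
    have e2 : inner ℂ (u z) (u z) * (pz (fun y => (inner ℂ (u y) (u y))⁻¹) z
        + a * (inner ℂ (u z) (u z))⁻¹) = 0 := by linear_combination e1
    have e3 := (mul_eq_zero.1 e2).resolve_left (inner_self_ne_zero.2 h5)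
    linear_combination e3
  have i1 : pz (fun y => inner ℂ (G y) x) z = z ^ k * inner ℂ (conjVec (u z)) x := by
    rw [wirt_inner_const x dG, map_neg, Complex.conj_I, neg_neg, h3', inner_smul_left, map_pow,
      Complex.conj_conj]
  have i2 : pz (fun y => inner ℂ (u y) x) z
      = -(z ^ k * inner ℂ (u z) (u z)) * inner ℂ (G z) x := by
    rw [wirt_inner_const x du, map_neg, Complex.conj_I, neg_neg, h4, inner_neg_left,
      inner_smul_left, map_mul, conj_inner_self, map_pow, Complex.conj_conj]
    ring
  have i3 : pz (fun y => inner ℂ (conjVec (u y)) x) z = a * inner ℂ (conjVec (u z)) x := by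
    rw [wirt_inner_const x dc, map_neg, Complex.conj_I, neg_neg, hc2, inner_smul_left,
      Complex.conj_conj]
  have d1 : DifferentiableAt ℝ (fun y => inner ℂ (G y) x) z :=
    dG.inner ℂ (differentiableAt_const x)
  have d2 : DifferentiableAt ℝ (fun y => inner ℂ (u y) x) z :=
    du.inner ℂ (differentiableAt_const x)
  have d3 : DifferentiableAt ℝ (fun y => inner ℂ (conjVec (u y)) x) z :=
    dc.inner ℂ (differentiableAt_const x)
  have m2 : DifferentiableAt ℝ (fun y => (inner ℂ (u y) (u y))⁻¹ * inner ℂ (u y) x) z := dR.mul d2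
  have m3 : DifferentiableAt ℝ
    (fun y => (inner ℂ (u y) (u y))⁻¹ * inner ℂ (conjVec (u y)) x) z := dR.mul d3
  have t1 : DifferentiableAt ℝ (fun y => inner ℂ (G y) x • G y) z := d1.smul dG
  have t2 : DifferentiableAt ℝ
    (fun y => ((inner ℂ (u y) (u y))⁻¹ * inner ℂ (u y) x) • u y) z := m2.smul du
  have t3 : DifferentiableAt ℝ
    (fun y => ((inner ℂ (u y) (u y))⁻¹ * inner ℂ (conjVec (u y)) x) • conjVec (u y)) z :=
    m3.smul dc
  have t12 : DifferentiableAt ℝ (fun y => inner ℂ (G y) x • G y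
    + ((inner ℂ (u y) (u y))⁻¹ * inner ℂ (u y) x) • u y) z := t1.add t2
  unfold planeProj
  rw [wirt_add t12 t3, wirt_add t1 t2, wirt_smul d1 dG, wirt_smul m2 du, wirt_smul m3 dc,
    wirt_mul dR d2, wirt_mul dR d3, i1, i2, i3, hR1, hc1, h3, hu]
  match_scalars
  · linear_combination (-(z ^ k * inner ℂ (conjVec (u z)) x)) * hNR
  · linear_combination (-(z ^ k * inner ℂ (G z) x)) * hNR
  · ring

theorem conjVec_planeProj {x : C7} {z : ℂ} (hG : conjVec (G z) = G z) :
    conjVec (planeProj G u x z) = planeProj G u (conjVec x) z := by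
  have e1 : (starRingEnd ℂ) (inner ℂ (G z) x) = inner ℂ (G z) (conjVec x) := by
    rw [← inner_conjVec_conjVec, hG]
  have e2 : (starRingEnd ℂ) (inner ℂ (conjVec (u z)) x) = inner ℂ (u z) (conjVec x) := by
    rw [← inner_conjVec_conjVec, conjVec_conjVec]
  rw [planeProj, planeProj, conjVec_add, conjVec_add, conjVec_smul, conjVec_smul, conjVec_smul,
    conjVec_conjVec, hG, e1, map_mul, map_mul, map_inv₀, conj_inner_self, e2,
    ← inner_conjVec_conjVec]
  abel

/-- If the second derivative vanishes, the plane spanned by `G`, `u` and `ū` is parallel. -/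
theorem IsFirstFrame.wirt_planeProj (h : IsFirstFrame G u k)
    (hs : ∀ᶠ z in 𝓝 (0 : ℂ), secondDeriv u z = 0) (x : C7) : ∀ᶠ z in 𝓝 (0 : ℂ),
    pz (planeProj G u x) z = 0 ∧ pzb (planeProj G u x) z = 0 := by
  filter_upwards [h.pz_planeProj hs x, h.pz_planeProj hs (conjVec x), h.conj.eventually_nhds,
    h.smoothNear_planeProj (conjVec x)] with z h1 h2 h3 h4
  refine ⟨h1, ?_⟩
  have e : pzb (planeProj G u x) z = pzb (fun y => conjVec (planeProj G u (conjVec x) y)) z := by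
    refine wirt_congr_at ?_
    filter_upwards [h3] with y hy
    rw [conjVec_planeProj hy, conjVec_conjVec]
  rw [e, wirt_conjVec h4.diffAt, Complex.conj_I, h2, conjVec_eq_zero.2 rfl]

variable {M : Type*} [TopologicalSpace M] [ChartedSpace ℂ M] [IsManifold 𝓘(ℂ, ℂ) ω M] [T2Space M]
  [ConnectedSpace M] {F : M → S6}

/-- If the second derivatives vanish, all values of `F` are in the span of `F p`, `u` and `ū`, where
`u` spans the first Gauss bundle at `p`. -/
theorem IsAlmostComplex.exists_mem_span (hF : IsAlmostComplex F)
    (h : ∀ p, ∃ u k, IsFirstFrame (germ F p) u k ∧ ∀ᶠ z in 𝓝 (0 : ℂ), secondDeriv u z = 0)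
    (p : M) : ∃ u : C7, u ≠ 0 ∧ cross (complexify (toR7 F p)) u = Complex.I • u ∧
      ∀ q, complexify (toR7 F q) ∈
        Submodule.span ℂ {complexify (toR7 F p), u, conjVec u} := by
  -- the projection to `f₋₁ ⊕ f₀ ⊕ f₁`
  set H : C7 → M → C7 := fun x q => proj (lineOf F) q x + proj (gaussPrime (lineOf F)) q x
    + proj (gaussDoublePrime (lineOf F)) q x with hH
  have hloc : ∀ {p u k}, IsFirstFrame (germ F p) u k → ∀ x,
      (fun z => H x (param p z)) =ᶠ[𝓝 0] planeProj (germ F p) u x := by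
    intro p u k hu x
    filter_upwards [(hF.isFrame_lineOf p).2, (hu.isFrame_gaussPrime hF).2,
      (hu.isFrame_gaussDoublePrime hF).2] with z h1 h2 h3
    simp only [hH, proj, planeProj]
    simp only [h1.2, h2.2, h3.2, starProjection_span_singleton, smul_apply, InnerProductSpace.rankOne_apply,
      smul_smul, inner_germ_self, inner_conjVec_conjVec, inner_conj_symm, inv_one, one_mul]
  have hconst : ∀ x p q, H x p = H x q := by
    intro x
    refine apply_eq_of_wirt_eq_zero fun p => ?_
    obtain ⟨u, k, hu, hs⟩ := h p
    filter_upwards [(hloc hu x).eventuallyEq_nhds, hu.wirt_planeProj hs x,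
      hu.smoothNear_planeProj x] with z h1 h2 h3
    rw [wirt_congr_at h1, wirt_congr_at h1]
    exact ⟨h3.diffAt.congr_of_eventuallyEq h1, h2⟩
  have hself : ∀ q, H (complexify (toR7 F q)) q = complexify (toR7 F q) := by
    intro q
    obtain ⟨u, k, hu, -⟩ := h q
    have h1 := (hloc hu (complexify (toR7 F q))).self_of_nhds
    have h2 := hu.conj.self_of_nhds
    have h3 := inner_eq_zero_of_type h2 hu.type_frame.self_of_nhds
    have h4 : complexify (toR7 F q) = germ F q 0 := by rw [germ, param_zero]
    have h5 : inner ℂ (u 0) (germ F q 0) = 0 := by rw [← inner_conj_symm, h3, map_zero]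
    have h6 : inner ℂ (conjVec (u 0)) (germ F q 0) = 0 := by
      rw [← h2, inner_conjVec_conjVec, h5, map_zero]
    simp only [param_zero] at h1
    rw [h1, planeProj, h4, inner_germ_self, h5, h6]
    simp
  obtain ⟨u, k, hu, -⟩ := h p
  have h4 : complexify (toR7 F p) = germ F p 0 := by rw [germ, param_zero]
  refine ⟨u 0, hu.ne_zero, by rw [h4]; exact hu.type_frame.self_of_nhds, fun q => ?_⟩
  have h1 := (hloc hu (complexify (toR7 F q))).self_of_nhds
  simp only [param_zero] at h1
  rw [← hself q, hconst _ q p, h1, h4, planeProj]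
  refine Submodule.add_mem _ (Submodule.add_mem _ (Submodule.smul_mem _ _ ?_)
    (Submodule.smul_mem _ _ ?_)) (Submodule.smul_mem _ _ ?_) <;>
  · exact Submodule.subset_span (by simp)

end Plane

/-! ### Associative subspaces -/

section RealCross

theorem inner_cross (a b c : R7) : ⟪cross a b, c⟫_ℝ = -⟪b, cross a c⟫_ℝ := by
  simp only [cross_eq, PiLp.inner_apply, Fin.sum_univ_seven]
  simp
  ring

theorem cross_swap (a b : R7) : cross a b = -cross b a := by
  simp only [cross_eq]
  ext k
  fin_cases k <;> simp <;> ring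

theorem cross_cross_left (a c : R7) : cross a (cross a c) = ⟪a, c⟫_ℝ • a - ⟪a, a⟫_ℝ • c := by
  simp only [cross_eq, PiLp.inner_apply, Fin.sum_univ_seven]
  ext k
  fin_cases k <;> simp <;> ring

theorem cross_add_smul (a b c : R7) (r : ℝ) : cross a (b + r • c) = cross a b + r • cross a c := by
  simp only [cross_eq]
  ext k
  fin_cases k <;> simp <;> ring

theorem cross_neg (a b : R7) : cross a (-b) = -cross a b := by
  simp only [cross_eq]
  ext k
  fin_cases k <;> simp <;> ring

theorem cross_smul (a b : R7) (r : ℝ) : cross a (r • b) = r • cross a b := by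
  simp only [cross_eq]
  ext k
  fin_cases k <;> simp <;> ring

theorem cross_same (a : R7) : cross a a = 0 := by
  simp only [cross_eq]
  ext k
  fin_cases k <;> simp <;> ring

/-- The octonion with real part `r` and imaginary part `v`. -/
def octOf (r : ℝ) (v : R7) : Oct ℝ := (⟨r, v 0, v 1, v 2⟩, ⟨v 3, v 4, v 5, v 6⟩)

theorem octOf_zero (v : R7) : octOf 0 v = toOct v := rfl

theorem octOf_coords (r : ℝ) (v : R7) :
    (octOf r v).1.re = r ∧ (octOf r v).1.imI = v 0 ∧ (octOf r v).1.imJ = v 1 ∧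
    (octOf r v).1.imK = v 2 ∧ (octOf r v).2.re = v 3 ∧ (octOf r v).2.imI = v 4 ∧
    (octOf r v).2.imJ = v 5 ∧ (octOf r v).2.imK = v 6 := ⟨rfl, rfl, rfl, rfl, rfl, rfl, rfl, rfl⟩

theorem octOf_inj {r s : ℝ} {v w : R7} : octOf r v = octOf s w ↔ r = s ∧ v = w := by
  constructor
  · intro h
    obtain ⟨h1, h2⟩ := Prod.ext_iff.1 h
    obtain ⟨a0, a1, a2, a3⟩ := Quaternion.ext_iff.1 h1
    obtain ⟨b0, b1, b2, b3⟩ := Quaternion.ext_iff.1 h2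
    refine ⟨a0, ?_⟩
    ext k
    fin_cases k
    exacts [a1, a2, a3, b0, b1, b2, b3]
  · rintro ⟨rfl, rfl⟩
    rfl

theorem octMul_octOf (r s : ℝ) (v w : R7) : octMul (octOf r v) (octOf s w)
    = octOf (r * s - ⟪v, w⟫_ℝ) (r • w + s • v + cross v w) := by
  obtain ⟨a0, a1, a2, a3, a4, a5, a6, a7⟩ := octOf_coords r v
  obtain ⟨b0, b1, b2, b3, b4, b5, b6, b7⟩ := octOf_coords s w
  simp only [cross_eq, PiLp.inner_apply, Fin.sum_univ_seven]
  refine Prod.ext ?_ ?_ <;> ext <;>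
  · simp only [octMul, Quaternion.re_sub, Quaternion.imI_sub, Quaternion.imJ_sub,
      Quaternion.imK_sub, Quaternion.re_add, Quaternion.imI_add, Quaternion.imJ_add,
      Quaternion.imK_add, Quaternion.re_mul, Quaternion.imI_mul, Quaternion.imJ_mul,
      Quaternion.imK_mul, Quaternion.re_star, Quaternion.imI_star, Quaternion.imJ_star,
      Quaternion.imK_star, a0, a1, a2, a3, a4, a5, a6, a7, b0, b1, b2, b3, b4, b5, b6, b7]
    simp [octOf]
    ring

theorem octOf_add (r s : ℝ) (v w : R7) : octOf (r + s) (v + w) = octOf r v + octOf s w := by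
  refine Prod.ext ?_ ?_ <;> ext <;> rfl

theorem octOf_smul (r s : ℝ) (v : R7) : octOf (r * s) (r • v) = r • octOf s v := by
  refine Prod.ext ?_ ?_ <;> ext <;> rfl

theorem octOf_one : octOf 1 0 = (1, 0) := by
  refine Prod.ext ?_ ?_ <;> ext <;> simp [octOf]

/-- Orthonormal vectors `x` and `a` of `Im 𝕆` generate a quaternion subalgebra, whose imaginary part
is spanned by `x`, `a` and `x × a`. -/
theorem isAssociative_span {x a : R7} (hx : ⟪x, x⟫_ℝ = 1) (ha : ⟪a, a⟫_ℝ = 1)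
    (hxa : ⟪x, a⟫_ℝ = 0) : IsAssociative (Submodule.span ℝ {x, a, cross x a}) := by
  have hax : ⟪a, x⟫_ℝ = 0 := by rw [real_inner_comm, hxa]
  have hxc : cross x (cross x a) = -a := by rw [cross_cross_left, hxa, hx]; module
  have hac : cross a (cross x a) = x := by
    rw [cross_swap x a, cross_neg, cross_cross_left, hax, ha]; module
  have hcx' : ⟪cross x a, x⟫_ℝ = 0 := by rw [inner_cross, cross_same, inner_zero_right, neg_zero]
  have hca' : ⟪cross x a, a⟫_ℝ = 0 := by
    have := inner_cross x a a
    rw [real_inner_comm (cross x a) a] at this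
    linarith
  have hcc' : ⟪cross x a, cross x a⟫_ℝ = 1 := by
    rw [inner_cross, hxc, inner_neg_right, ha, neg_neg]
  have hcx : cross (cross x a) x = a := by rw [cross_swap, hxc, neg_neg]
  have hca : cross (cross x a) a = -x := by rw [cross_swap, hac]
  have hax' : cross a x = -cross x a := cross_swap a x
  have hxx := cross_same x
  have haa := cross_same a
  have hcc := cross_same (cross x a)
  have hxc' : ⟪x, cross x a⟫_ℝ = 0 := by rw [real_inner_comm, hcx']
  have hac' : ⟪a, cross x a⟫_ℝ = 0 := by rw [real_inner_comm, hca']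
  obtain ⟨c, hc⟩ : ∃ c, cross x a = c := ⟨_, rfl⟩
  rw [hc] at hxc hac hcx' hca' hcc' hcx hca hax' hcc hxc' hac' ⊢
  set L : ℍ[ℝ] → R7 := fun q => q.imI • x + q.imJ • a + q.imK • c with hL
  have hLadd : ∀ p q, L (p + q) = L p + L q := fun p q => by
    simp only [hL, Quaternion.imI_add, Quaternion.imJ_add, Quaternion.imK_add]
    module
  have hLsmul : ∀ (r : ℝ) q, L (r • q) = r • L q := fun r q => by
    simp only [hL, Quaternion.imI_smul, Quaternion.imJ_smul, Quaternion.imK_smul, smul_eq_mul]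
    module
  have hcross : ∀ y q, cross y (L q) = q.imI • cross y x + q.imJ • cross y a
      + q.imK • cross y c := by
    intro y q
    rw [hL, cross_add_smul, cross_add_smul, cross_smul]
  have hLx : ∀ q, cross (L q) x = -(q.imJ • c) + q.imK • a := by
    intro q
    rw [cross_swap, hcross, hxx, hc, hxc]; module
  have hLa : ∀ q, cross (L q) a = q.imI • c - q.imK • x := by
    intro q
    rw [cross_swap, hcross, haa, hax', hac]; module
  have hLc : ∀ q, cross (L q) c = -(q.imI • a) + q.imJ • x := by
    intro q
    rw [cross_swap, hcross, hcc, hcx, hca]; module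
  have hinner : ∀ p q : ℍ[ℝ], ⟪L p, L q⟫_ℝ = p.imI * q.imI + p.imJ * q.imJ + p.imK * q.imK := by
    intro p q
    simp only [hL, inner_add_left, inner_add_right, real_inner_smul_left, real_inner_smul_right,
      hx, ha, hcc', hxa, hax, hxc', hcx', hac', hca']
    ring
  refine ⟨
    { toFun := fun q => octOf q.re (L q)
      map_add' := fun p q => by
        rw [← octOf_add, ← hLadd, Quaternion.re_add]
      map_smul' := fun r q => by
        rw [RingHom.id_apply, ← octOf_smul, ← hLsmul, Quaternion.re_smul, smul_eq_mul] }, ?_, ?_, ?_, ?_⟩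
  · intro p q hpq
    obtain ⟨h0, h1⟩ := octOf_inj.1 hpq
    have hin : ∀ y, ⟪L p, y⟫_ℝ = ⟪L q, y⟫_ℝ := fun y => by rw [h1]
    have e1 := hin x
    have e2 := hin a
    have e3 := hin c
    simp only [hL, inner_add_left, real_inner_smul_left, hx, ha, hcc', hxa, hax, hxc', hcx', hac',
      hca', mul_zero, mul_one, add_zero, zero_add] at e1 e2 e3
    exact Quaternion.ext_iff.2 ⟨h0, e1, e2, e3⟩
  · have : L 1 = 0 := by simp [hL]
    change octOf (1 : ℍ[ℝ]).re (L 1) = _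
    rw [this, Quaternion.re_one, octOf_one]
  · intro p q
    change octOf (p * q).re (L (p * q)) = octMul (octOf p.re (L p)) (octOf q.re (L q))
    rw [octMul_octOf, octOf_inj, hinner, hcross, hLx, hLa, hLc]
    constructor
    · rw [Quaternion.re_mul]; ring
    · simp only [hL, Quaternion.imI_mul, Quaternion.imJ_mul, Quaternion.imK_mul]
      module
  · intro v
    rw [Submodule.mem_span_triple]
    constructor
    · rintro ⟨r, s, t, rfl⟩
      exact ⟨⟨0, r, s, t⟩, rfl⟩
    · rintro ⟨q, hq⟩
      exact ⟨q.imI, q.imJ, q.imK, (octOf_inj.1 hq).2⟩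

theorem IsAssociative.finrank_le {P : Submodule ℝ R7} (hP : IsAssociative P) :
    Module.finrank ℝ P ≤ 4 := by
  obtain ⟨j, -, -, -, hj⟩ := hP
  let T : R7 →ₗ[ℝ] Oct ℝ :=
    { toFun := toOct
      map_add' := fun u w => by
        rw [← octOf_zero, ← octOf_zero, ← octOf_zero, ← octOf_add, add_zero]
      map_smul' := fun r u => by
        rw [RingHom.id_apply, ← octOf_zero, ← octOf_zero, ← octOf_smul, mul_zero] }
  have h1 : ∀ v : P, (T ∘ₗ P.subtype) v ∈ LinearMap.range j := fun v => (hj v).1 v.2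
  have hinj : Function.Injective ((T ∘ₗ P.subtype).codRestrict (LinearMap.range j) h1) := by
    intro v w hvw
    have h2 : octOf 0 v.1 = octOf 0 w.1 := congrArg Subtype.val hvw
    exact Subtype.ext (octOf_inj.1 h2).2
  calc Module.finrank ℝ P ≤ Module.finrank ℝ (LinearMap.range j) :=
        LinearMap.finrank_le_finrank_of_injective hinj
    _ ≤ Module.finrank ℝ ℍ[ℝ] := LinearMap.finrank_range_le j
    _ = 4 := Quaternion.finrank_eq_four

/-- The complexification `P ⊗ ℂ ⊆ ℂ⁷` of a subspace of `ℝ⁷`. -/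
def complexSpan (P : Submodule ℝ R7) : Submodule ℂ C7 := Submodule.span ℂ (complexify '' P)

theorem complexify_mem_complexSpan {P : Submodule ℝ R7} {v : R7} (hv : v ∈ P) :
    complexify v ∈ complexSpan P := Submodule.subset_span ⟨v, hv, rfl⟩

theorem conjVec_mem_complexSpan {P : Submodule ℝ R7} {x : C7} (hx : x ∈ complexSpan P) :
    conjVec x ∈ complexSpan P := by
  induction hx using Submodule.span_induction with
  | mem x hx =>
    obtain ⟨v, hv, rfl⟩ := hx
    rw [conjVec_complexify]
    exact complexify_mem_complexSpan hv
  | zero => rw [conjVec_eq_zero.2 rfl]; exact Submodule.zero_mem _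
  | add x y _ _ hx hy => rw [conjVec_add]; exact Submodule.add_mem _ hx hy
  | smul c x _ hx => rw [conjVec_smul]; exact Submodule.smul_mem _ _ hx

theorem finrank_complexSpan_le (P : Submodule ℝ R7) :
    Module.finrank ℂ (complexSpan P) ≤ Module.finrank ℝ P := by
  set b := Module.finBasis ℝ P with hb
  have h1 : complexSpan P ≤ Submodule.span ℂ (Set.range fun i => complexify (b i : R7)) := by
    refine Submodule.span_le.2 ?_
    rintro _ ⟨v, hv, rfl⟩
    have h2 := congrArg (fun y : P => complexifyL (y : R7)) (b.sum_repr ⟨v, hv⟩)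
    simp only [Submodule.coe_sum, Submodule.coe_smul, map_sum, map_smul, complexifyL_apply] at h2
    rw [← h2]
    refine Submodule.sum_mem _ fun i _ => ?_
    rw [← Complex.coe_smul]
    exact Submodule.smul_mem _ _ (Submodule.subset_span ⟨i, rfl⟩)
  calc Module.finrank ℂ (complexSpan P) ≤ _ := Submodule.finrank_mono h1
    _ ≤ Fintype.card (Fin (Module.finrank ℝ P)) := finrank_range_le_card _
    _ = Module.finrank ℝ P := Fintype.card_fin _

/-- The span of a real vector `x`, a vector of type `(1, 0)` for `x` and its conjugate is the
complexification of an associative subspace. -/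
theorem exists_isAssociative {x : R7} {u : C7} (hx : ⟪x, x⟫_ℝ = 1) (hu0 : u ≠ 0)
    (hu : cross (complexify x) u = Complex.I • u) :
    ∃ P : Submodule ℝ R7, IsAssociative P ∧ ∀ y : R7,
      complexify y ∈ Submodule.span ℂ {complexify x, u, conjVec u} → y ∈ P := by
  -- the real and imaginary parts of `u`
  set a : R7 := WithLp.toLp 2 fun k => (u k).re with ha
  set b : R7 := WithLp.toLp 2 fun k => (u k).im with hb
  have hab : u = complexify a + Complex.I • complexify b := by
    ext k
    simp [complexify, ha, hb, mul_comm Complex.I, Complex.re_add_im]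
  have key : ∀ c d e f : R7, complexify c + Complex.I • complexify d
      = complexify e + Complex.I • complexify f → c = e ∧ d = f := by
    intro c d e f h
    constructor
    · ext k
      have := congrArg (fun y : C7 => (y k).re) h
      simpa [complexify] using this
    · ext k
      have := congrArg (fun y : C7 => (y k).im) h
      simpa [complexify] using this
  have h1 : complexify (cross x a) + Complex.I • complexify (cross x b)
      = complexify (-b) + Complex.I • complexify a := by
    have h2 : complexify (-b) = -complexify b := complexifyL.map_neg b
    rw [← cross_complexify, ← cross_complexify, ← cross_smul_right, ← cross_add_right, ← hab, hu,
      hab, h2]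
    match_scalars
    · ring
    · linear_combination Complex.I_sq
  obtain ⟨hxa, hxb⟩ := key _ _ _ _ h1
  have hb' : b = -cross x a := by rw [hxa, neg_neg]
  have ha0 : a ≠ 0 := by
    intro h0
    have h2 : cross x (0 : R7) = 0 := by simpa using cross_smul x 0 0
    rw [hb', h0, h2, neg_zero] at hab
    refine hu0 (hab.trans ?_)
    have : complexify 0 = 0 := complexifyL.map_zero
    rw [this, smul_zero, add_zero]
  have hxa0 : ⟪x, a⟫_ℝ = 0 := by
    rw [← hxb, real_inner_comm, inner_cross, cross_same, inner_zero_right, neg_zero]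
  have hn : ‖a‖ ≠ 0 := norm_ne_zero_iff.2 ha0
  refine ⟨_, isAssociative_span (x := x) (a := ‖a‖⁻¹ • a) hx ?_ ?_, fun y hy => ?_⟩
  · rw [real_inner_smul_left, real_inner_smul_right, real_inner_self_eq_norm_sq]
    field_simp
  · rw [real_inner_smul_right, hxa0, mul_zero]
  obtain ⟨α, β, γ, h2⟩ := Submodule.mem_span_triple.1 hy
  have h3 : y = α.re • x + (β.re + γ.re) • a + (γ.im - β.im) • b := by
    ext k
    have := congrArg (fun y : C7 => (y k).re) h2
    simp [complexify, conjVec] at this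
    simp [ha, hb, ← this]
    ring
  rw [Submodule.mem_span_triple]
  refine ⟨α.re, (β.re + γ.re) * ‖a‖, -((γ.im - β.im) * ‖a‖), ?_⟩
  rw [h3, hb', cross_smul]
  match_scalars <;> field_simp

end RealCross

/-! ### Conformality and the dimension count -/

section Conclusion

variable {M : Type*} [TopologicalSpace M] [ChartedSpace ℂ M] {F : M → S6}

/-- `x ×` is a rotation by a right angle on the image of the differential. -/
theorem IsAlmostComplex.isWeaklyConformal (hF : IsAlmostComplex F) : IsWeaklyConformal F := by
  intro p
  set D := realDeriv (toR7 F) p with hD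
  set x := toR7 F p with hx
  have h1 : D Complex.I = cross x (D 1) := by simpa using hF.2 p 1
  have h2 : cross x (D Complex.I) = -D 1 := by
    have := hF.2 p Complex.I
    rw [Complex.I_mul_I, map_neg] at this
    exact this.symm
  have e1 : ⟪D Complex.I, D Complex.I⟫_ℝ = ⟪D 1, D 1⟫_ℝ := by
    conv_lhs => rw [h1]
    rw [inner_cross, ← h1, h2, inner_neg_right, neg_neg]
  have e2 : ⟪D 1, D Complex.I⟫_ℝ = 0 := by
    have := inner_cross x (D 1) (D 1)
    rw [← h1, real_inner_comm] at this
    linarith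
  have e3 : ⟪D Complex.I, D 1⟫_ℝ = 0 := by rw [real_inner_comm, e2]
  refine ⟨⟪D 1, D 1⟫_ℝ, real_inner_self_nonneg, fun v w => ?_⟩
  have hv : ∀ v : ℂ, D v = v.re • D 1 + v.im • D Complex.I := by
    intro v
    rw [← map_smul, ← map_smul, ← map_add]
    congr 1
    simp [Complex.re_add_im]
  rw [hv v, hv w]
  simp only [inner_add_left, inner_add_right, real_inner_smul_left, real_inner_smul_right, e1, e2,
    e3, Complex.inner]
  simp
  ring

theorem eventually_wirt_mem {S : Submodule ℂ C7} {f : ℂ → C7} {c : ℂ} (hf : SmoothNear f)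
    (h : ∀ᶠ z in 𝓝 (0 : ℂ), f z ∈ S) : ∀ᶠ z in 𝓝 (0 : ℂ), wirt c f z ∈ S := by
  have hS : ∀ x, x ∈ S ↔ Sᗮ.starProjection x = 0 := fun x => by
    rw [Submodule.starProjection_apply_eq_zero_iff, Submodule.orthogonal_orthogonal]
  filter_upwards [hf, h.eventually_nhds] with z h1 h2
  have e := wirt_clm (c := c) (c' := c) (Sᗮ.starProjection.restrictScalars ℝ)
    (fun x => map_smul Sᗮ.starProjection c x) (fun x => map_smul Sᗮ.starProjection _ x) h1.diffAt
  rw [wirt_congr_at (g := fun _ => (0 : C7)), wirt_const] at e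
  · exact (hS _).2 e.symm
  · filter_upwards [h2] with y hy using (hS _).1 hy

/-- Dividing out a zero keeps a section in a closed subspace. -/
theorem eventually_mem_of_pow_smul {S : Submodule ℂ C7} {f u : ℂ → C7} {k : ℕ} (hu : SmoothNear u)
    (h : ∀ᶠ z in 𝓝 (0 : ℂ), f z ∈ S) (hfu : ∀ᶠ z in 𝓝 (0 : ℂ), f z = z ^ k • u z) :
    ∀ᶠ z in 𝓝 (0 : ℂ), u z ∈ S := by
  have hS : ∀ x, x ∈ S ↔ Sᗮ.starProjection x = 0 := fun x => by
    rw [Submodule.starProjection_apply_eq_zero_iff, Submodule.orthogonal_orthogonal]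
  have h0 : (fun z => Sᗮ.starProjection (u z)) =ᶠ[𝓝 0] fun _ => 0 := by
    refine eventuallyEq_of_punctured
      (Sᗮ.starProjection.continuous.continuousAt.comp hu.continuousAt) continuousAt_const ?_
    filter_upwards [h, hfu] with z h1 h2 hz
    rw [h2, S.smul_mem_iff (pow_ne_zero k hz)] at h1
    exact (hS _).1 h1
  filter_upwards [h0] with z hz using (hS _).2 hz

/-- The flag is not contained in the complexification of an associative subspace. -/
theorem IsSecondFrame.not_forall_mem {G u w : ℂ → C7} {k l : ℕ} (h : IsSecondFrame G u w k l)
    {P : Submodule ℝ R7} (hP : IsAssociative P) : ¬ ∀ z, G z ∈ complexSpan P := by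
  intro hG
  set S := complexSpan P with hS
  have h1 : ∀ᶠ z in 𝓝 (0 : ℂ), u z ∈ S := eventually_mem_of_pow_smul h.smooth_frame
    (eventually_wirt_mem h.smooth (Filter.Eventually.of_forall hG)) h.pz_base
  have h2 : ∀ᶠ z in 𝓝 (0 : ℂ), secondDeriv u z ∈ S := by
    filter_upwards [h1, eventually_wirt_mem (c := -Complex.I) h.smooth_frame h1] with z h3 h4
    exact Submodule.sub_mem _ h4 (Submodule.smul_mem _ _ h3)
  have h3 := (eventually_mem_of_pow_smul h.smooth_second h2 h.secondDeriv_eq).self_of_nhds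
  have h4 := h1.self_of_nhds
  have hA := h.isAdapted.self_of_nhds
  -- five orthogonal vectors in a space of dimension at most four
  set e : Fin 5 → C7 := fun i => legVec (G 0) (u 0) (w 0) ((i : ℤ) - 2) with he
  have hli : LinearIndependent ℂ e := by
    refine linearIndependent_of_ne_zero_of_inner_eq_zero (fun i => hA.legVec_ne_zero ?_)
      fun i j hij => hA.inner_legVec ?_
    · have := i.2
      rw [abs_le]
      omega
    · intro h5
      exact hij (Fin.ext (by omega))
  have hmem : Submodule.span ℂ (Set.range e) ≤ S := by
    refine Submodule.span_le.2 ?_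
    rintro _ ⟨i, rfl⟩
    fin_cases i
    exacts [conjVec_mem_complexSpan h3, conjVec_mem_complexSpan h4, hG 0, h4, h3]
  have h5 := finrank_span_eq_card hli
  have h6 := Submodule.finrank_mono hmem
  have h7 := finrank_complexSpan_le P
  rw [← hS] at h7
  have h8 := hP.finrank_le
  rw [h5, Fintype.card_fin] at h6
  omega

variable [IsManifold 𝓘(ℂ, ℂ) ω M] [T2Space M] [ConnectedSpace M]

/-- The second Gauss transform of `f` is zero if the second derivatives vanish. -/
theorem IsAlmostComplex.gaussBundle_two_eq_bot (hF : IsAlmostComplex F)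
    (hnc : ∃ p q : M, F p ≠ F q)
    (h : ∀ p, ∃ u k, IsFirstFrame (germ F p) u k ∧ ∀ᶠ z in 𝓝 (0 : ℂ), secondDeriv u z = 0)
    (p : M) : gaussBundle (lineOf F) 2 p = ⊥ := by
  have h1 : ∀ q, secondForm (gaussPrime (lineOf F))
      (fun x => (gaussPrime (lineOf F) x)ᗮ) q = 0 := by
    intro q
    obtain ⟨u, k, hu, hs⟩ := h q
    have h2 := (hu.eventually_secondForm_eq_zero_iff hF
      (hF.isSmoothSubbundle_gaussPrime hnc)).self_of_nhds.2 hs.self_of_nhds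
    rwa [param_zero] at h2
  have := neBot_punctured_nhds p
  refine limitFibre_eq (ψ := fun _ : M => ⊥) continuousAt_const
    (Filter.Eventually.of_forall fun q => ?_)
  rw [h1 q]
  simp

end Conclusion


end AlmostComplexS6

end

open AlmostComplexS6
theorem mainTheorem12 {M : Type*} [TopologicalSpace M] [T2Space M] [ConnectedSpace M]
    [ChartedSpace ℂ M] [IsManifold 𝓘(ℂ, ℂ) ω M]
    (F : M → S6) (hF : IsAlmostComplex F) (hnc : ∃ p q : M, F p ≠ F q) :
    Xor
      (IsWeaklyConformal F ∧ ∃ P : Submodule ℝ R7, IsAssociative P ∧ ∀ p, toR7 F p ∈ P)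
      (∃ ψ : ℤ → M → Submodule ℂ C7,
        (∀ i, IsSmoothSubbundle (ψ i)) ∧
        (∀ p, IsG2Flag fun i => ψ i p) ∧
        (∀ i : ℤ, |i| ≤ 2 → ψ i = gaussBundle (lineOf F) i) ∧
        ∀ i j : ℤ, |i| ≤ 3 → |j| ≤ 3 → i ≠ j → ¬ IsArrow i j →
          ∀ p, secondForm (ψ i) (ψ j) p = 0) := by
  obtain ⟨p₀, -, -⟩ := id hnc
  rcases hF.forall_secondDeriv_or hnc with h | h
  · refine Or.inl ⟨⟨hF.isWeaklyConformal, ?_⟩, ?_⟩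
    · obtain ⟨u, hu0, hu, hmem⟩ := hF.exists_mem_span h p₀
      obtain ⟨P, hP, hPm⟩ := exists_isAssociative
        (by rw [real_inner_self_eq_norm_sq, norm_toR7, one_pow]) hu0 hu
      exact ⟨P, hP, fun q => hPm _ (hmem q)⟩
    · rintro ⟨ψ, -, hψ, hG, -⟩
      have h1 : Module.finrank ℂ (ψ 2 p₀) = 1 := (hψ p₀).finrank_leg 2 (by norm_num)
      rw [hG 2 (by norm_num), hF.gaussBundle_two_eq_bot hnc h p₀, finrank_bot] at h1
      exact zero_ne_one h1
  · refine Or.inr ⟨⟨flagBundle F, isSmoothSubbundle_flagBundle hF hnc h,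
      isG2Flag_flagBundle hF hnc h, fun i hi => if_pos hi,
      fun i j hi hj hij hA p => secondForm_flagBundle_eq_zero hF hnc h hi hj hij hA p⟩, ?_⟩
    rintro ⟨-, P, hP, hPm⟩
    obtain ⟨u, w, k, l, hw⟩ := h p₀
    exact hw.not_forall_mem hP fun z => complexify_mem_complexSpan (hPm _)
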